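/- Let $(M,F)$ be a closed oriented smooth Finsler surface, $SM=\{(x,\xi)\in TM: F(x,\xi)=1\}$ its unit sphere bundle, and let $g_\xi(u,w)=\frac12\frac{\partial^2 F^2}{\partial\xi^i\partial\xi^j}(x,\xi)\,u^iw^j$ be the fundamental tensor. For $(x,\xi)\in SM$ let $i\xi\in T_xM$ be the vector with $g_\xi(\xi,i\xi)=0$, $g_\xi(i\xi,i\xi)=1$ such that $(\xi,i\xi)$ is positively oriented. On $SM$ let $X$ be the geodesic vector field of $F$, $V$ the vertical vector field given by $i\xi$, and $H=[V,X]$; let $I,J,K$ be the functions on $SM$ determined by $$[H,V]=X+IH+JV,\qquad [X,H]=KV .$$ Let $\lambda\in C^\infty(SM)$ and let $\phi_t(x,\xi)=(\gamma_{x,\xi}(t),\dot\gamma_{x,\xi}(t))$ be the flow on $SM$ generated by ${\bf F}=X+\lambda V$ (the generalized thermostat $(M,F,\lambda)$). Assume that it has no conjugate points: for every $x\in M$ the $C^1$ map $\exp^\lambda_x:T_xM\to M$, $\exp^\lambda_x(t\xi)=\gamma_{x,\xi}(t)$ $(t\ge 0,\ \xi\in S_xM)$, is a local diffeomorphism. Put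 $$K_\lambda=K-H(\lambda)-\lambda J+\lambda^2+\lambda I\,V(\lambda)-{\bf F}(\lambda I),$$ and for $(x,\xi)\in SM$ consider the Riccati equation along the orbit of $(x,\xi)$, $$\dot r+r^2+K_\lambda(\phi_t(x,\xi))-\bigl(\lambda I+V(\lambda)\bigr)(\phi_t(x,\xi))\,r=0. \tag{R}$$ Then: 1. For every $(x,\xi)\in SM$ and $R>0$ there are unique solutions $r_R^+(x,\xi,t)$ and $r_R^-(x,\xi,t)$ of (R) with $r_R^+(x,\xi,t)\to+\infty$ as $t\downarrow -R$ and $r_R^-(x,\xi,t)\to-\infty$ as $t\uparrow R$, and they are defined for all $t>-R$ and all $t<R$ respectively. 2. The limits $r^\pm(x,\xi)=\lim_{R\to+\infty}r_R^\pm(x,\xi,0)$ exist (and are finite) for all $(x,\xi)\in SM$; they are solutions, in the sense that $t\mapsto r^\pm(\phi_t(x,\xi))$ satisfies (R) for all $t\in\mathbb R$. 3. The functions $r^\pm$ are bounded on $SM$. More precisely, there are constants $B,C\ge 0$ with $|K_\lambda|\le B^2$ and $|\lambda I+V(\lambda)|\le C$ on $SM$, and for any such constants, with $A=\max\{B,C\}$,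 $$|r^\pm(x,\xi)|\le \frac{A}{2}\,(1+\sqrt5)\qquad\text{for all }(x,\xi)\in SM .$$ -/

import Mathlib

open Set Filter
open scoped Manifold ContDiff Topology Matrix

noncomputable section

/-- The model plane `ℝ²`. -/
abbrev Plane : Type := EuclideanSpace ℝ (Fin 2)

/-- The atlas of the surface `M` is oriented: all transition maps have positive Jacobian.
Consequently every tangent space `T_x M`, which Mathlib identifies with `ℝ²` through the preferred
chart at `x`, is oriented by the standard orientation of `ℝ²`. -/
class OrientedAtlas (M : Type*) [TopologicalSpace M] [ChartedSpace Plane M] : Prop where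
  det_pos : ∀ e ∈ atlas Plane M, ∀ e' ∈ atlas Plane M, ∀ x ∈ e.source ∩ e'.source,
    0 < (fderiv ℝ (fun u : Plane => e' (e.symm u)) (e x)).det

section Surface

variable {M : Type*} [TopologicalSpace M] [ChartedSpace Plane M]

/-- The fundamental tensor `g_ξ(u, w) = ½ ∂²(F²)/∂ξ^i∂ξ^j u^i w^j` at `p = (x, ξ)`: the second
derivative of `½ F²` restricted to the vector space `T_x M`. -/
def fundamentalTensor (F : TangentBundle (𝓡 2) M → ℝ) (p : TangentBundle (𝓡 2) M)
    (u w : Plane) : ℝ :=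
  fderiv ℝ (fun η : Plane =>
    fderiv ℝ (fun ζ : Plane => F ⟨p.proj, ζ⟩ ^ 2 / 2) η u) (p.snd : Plane) w

/-- The tangent bundle without its zero section. -/
def slitBundle (M : Type*) [TopologicalSpace M] [ChartedSpace Plane M] :
    Set (TangentBundle (𝓡 2) M) :=
  {p | (p.snd : Plane) ≠ 0}

/-- A smooth Finsler metric on the surface `M` (not necessarily reversible). -/
structure FinslerMetric (M : Type*) [TopologicalSpace M] [ChartedSpace Plane M]
    [IsManifold (𝓡 2) ∞ M] where
  /-- the Finsler norm on the tangent bundle -/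
  toFun : TangentBundle (𝓡 2) M → ℝ
  smooth : ContMDiffOn (𝓡 2).tangent 𝓘(ℝ, ℝ) ∞ toFun (slitBundle M)
  pos : ∀ p ∈ slitBundle M, 0 < toFun p
  homogeneous : ∀ (x : M) (ξ : Plane) (c : ℝ), 0 ≤ c → toFun ⟨x, c • ξ⟩ = c * toFun ⟨x, ξ⟩
  convex : ∀ p ∈ slitBundle M, ∀ u : Plane, u ≠ 0 → 0 < fundamentalTensor toFun p u u

end Surface

namespace FinslerMetric

variable {M : Type*} [TopologicalSpace M] [ChartedSpace Plane M] [IsManifold (𝓡 2) ∞ M]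
variable (F : FinslerMetric M)

/-- The unit sphere bundle `SM = {(x, ξ) : F(x, ξ) = 1}`. -/
def unitBundle : Set (TangentBundle (𝓡 2) M) := {p | F.toFun p = 1}

/-- The fundamental tensor of the Finsler metric. -/
def g (p : TangentBundle (𝓡 2) M) (u w : Plane) : ℝ := fundamentalTensor F.toFun p u w

/-- Standard basis vector of `ℝ²`. -/
def basisVec (i : Fin 2) : Plane := EuclideanSpace.single i 1

/-- The matrix `g_{ij}(x, ξ)` of the fundamental tensor, in the preferred chart at `x`. -/
def gMatrix (p : TangentBundle (𝓡 2) M) : Matrix (Fin 2) (Fin 2) ℝ :=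
  Matrix.of fun i j => F.g p (basisVec i) (basisVec j)

/-- The rotation `iξ` of `ξ` by `π/2` at `p = (x, ξ)`: the vector with `g_ξ(ξ, iξ) = 0`,
`g_ξ(iξ, iξ) = F(x, ξ)²` for which `(ξ, iξ)` is positively oriented. -/
def rot (p : TangentBundle (𝓡 2) M) : Plane :=
  (Real.sqrt (F.gMatrix p).det)⁻¹ •
    !₂[-F.g p (p.snd : Plane) (basisVec 1), F.g p (p.snd : Plane) (basisVec 0)]

/-- `½ F²` in the coordinates `(x, ξ)` of the tangent bundle that are induced by the preferred
chart at the base point of `p`. -/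
def energyInChart (p : TangentBundle (𝓡 2) M) (q : Plane × Plane) : ℝ :=
  F.toFun ((extChartAt (𝓡 2).tangent p).symm q) ^ 2 / 2

/-- The acceleration `-2 G^i = g^{il} (∂L/∂x^l - ξ^k ∂²L/∂x^k∂ξ^l)`, with `L = ½ F²`, of the
Finsler geodesic through `p = (x, ξ)`, in the coordinates of the preferred chart at `x`. -/
def geodesicAcceleration (p : TangentBundle (𝓡 2) M) : Plane :=
  WithLp.toLp 2 ((F.gMatrix p)⁻¹ *ᵥ fun l =>
    fderiv ℝ (F.energyInChart p) (extChartAt (𝓡 2).tangent p p) (basisVec l, 0)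
      - fderiv ℝ (fun q : Plane × Plane => fderiv ℝ (F.energyInChart p) q (0, basisVec l))
          (extChartAt (𝓡 2).tangent p p) ((p.snd : Plane), 0))

/-! A tangent vector of `TM` at `p = (x, ξ)` is an element `(a, b)` of `ℝ² × ℝ²`: its coordinates
with respect to the coordinates `(x, ξ)` of `TM` induced by the preferred chart at `x`. In
particular `a` is its projection to `T_x M`, and `(0, b)` is the vertical lift of `b ∈ T_x M`.
The vector fields below are defined on `TM` without the zero section and are tangent to `SM`. -/

/-- The geodesic vector field `X`. -/
def fieldX (p : TangentBundle (𝓡 2) M) : TangentSpace (𝓡 2).tangent p :=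
  (((p.snd : Plane), F.geodesicAcceleration p) : Plane × Plane)

/-- The vertical vector field `V`, the vertical lift of `iξ`. -/
def fieldV (p : TangentBundle (𝓡 2) M) : TangentSpace (𝓡 2).tangent p :=
  ((0, F.rot p) : Plane × Plane)

/-- The horizontal vector field `H = [V, X]`. -/
def fieldH (p : TangentBundle (𝓡 2) M) : TangentSpace (𝓡 2).tangent p :=
  VectorField.mlieBracket (𝓡 2).tangent F.fieldV F.fieldX p

/-- Projection to `T_x M` of a tangent vector of `TM` at `p = (x, ξ)`. -/
def base (p : TangentBundle (𝓡 2) M) (Z : TangentSpace (𝓡 2).tangent p) : Plane :=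
  (show Plane × Plane from Z).1

/-- The vector of `T_x M` whose vertical lift is the given vertical vector at `p = (x, ξ)`. -/
def vertical (p : TangentBundle (𝓡 2) M) (Z : TangentSpace (𝓡 2).tangent p) : Plane :=
  (show Plane × Plane from Z).2

/-- The first form `ω₁` of the canonical coframing `(ω₁, ω₂, ω₃)`, dual to `(X, H, V)`. -/
def omega1 (p : TangentBundle (𝓡 2) M) (Z : TangentSpace (𝓡 2).tangent p) : ℝ :=
  F.g p (base p Z) (p.snd : Plane) / F.toFun p ^ 2

/-- The second form `ω₂` of the canonical coframing. -/
def omega2 (p : TangentBundle (𝓡 2) M) (Z : TangentSpace (𝓡 2).tangent p) : ℝ :=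
  F.g p (base p Z) (F.rot p) / F.toFun p ^ 2

/-- The third form `ω₃` of the canonical coframing: the component along `V = (0, iξ)` of the
vertical vector `Z - ω₁(Z) X - ω₂(Z) H`. -/
def omega3 (p : TangentBundle (𝓡 2) M) (Z : TangentSpace (𝓡 2).tangent p) : ℝ :=
  F.g p (vertical p (Z - F.omega1 p Z • F.fieldX p - F.omega2 p Z • F.fieldH p)) (F.rot p)
    / F.toFun p ^ 2

/-- The main scalar `I`: the `H`-component in `[H, V] = X + I H + J V`. -/
def mainScalar (p : TangentBundle (𝓡 2) M) : ℝ :=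
  F.omega2 p (VectorField.mlieBracket (𝓡 2).tangent F.fieldH F.fieldV p)

/-- The scalar `J`: the `V`-component in `[H, V] = X + I H + J V`. -/
def scalarJ (p : TangentBundle (𝓡 2) M) : ℝ :=
  F.omega3 p (VectorField.mlieBracket (𝓡 2).tangent F.fieldH F.fieldV p)

/-- The curvature `K`: the `V`-component in `[X, H] = K V`. -/
def curvature (p : TangentBundle (𝓡 2) M) : ℝ :=
  F.omega3 p (VectorField.mlieBracket (𝓡 2).tangent F.fieldX F.fieldH p)

/-- The derivative `Z(f)` of a function on the tangent bundle along a vector field. -/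
def derivAlong (Z : (p : TangentBundle (𝓡 2) M) → TangentSpace (𝓡 2).tangent p)
    (f : TangentBundle (𝓡 2) M → ℝ) (p : TangentBundle (𝓡 2) M) : ℝ :=
  mfderiv (𝓡 2).tangent 𝓘(ℝ, ℝ) f p (Z p)

variable (lam : TangentBundle (𝓡 2) M → ℝ)

/-- The generating vector field `X + λ V` of the thermostat. -/
def thermostatField (p : TangentBundle (𝓡 2) M) : TangentSpace (𝓡 2).tangent p :=
  F.fieldX p + lam p • F.fieldV p

open Classical in
/-- The thermostat flow: `t ↦ φ_t(p) = (γ_{x,ξ}(t), γ̇_{x,ξ}(t))` is the integral curve of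
`X + λ V` starting at `p = (x, ξ)`. For `p ∈ SM` this curve exists for all times and is unique
when `M` is closed and `λ` is smooth; other values of `p` play no role. -/
def flow (p : TangentBundle (𝓡 2) M) : ℝ → TangentBundle (𝓡 2) M :=
  if h : ∃ γ : ℝ → TangentBundle (𝓡 2) M,
      γ 0 = p ∧ IsMIntegralCurve (I := (𝓡 2).tangent) γ (F.thermostatField lam)
  then h.choose else fun _ => p

/-- The exponential map `exp_x(t ξ) = γ_{x,ξ}(t)`, `t ≥ 0`, `ξ ∈ S_x M`, as a map on `T_x M`;
its value at the zero vector is `x`. -/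
def expMap (x : M) (w : Plane) : M :=
  (F.flow lam ⟨x, (F.toFun ⟨x, w⟩)⁻¹ • w⟩ (F.toFun ⟨x, w⟩)).proj

/-- The thermostat has no conjugate points: every exponential map is a local diffeomorphism
(of class `C¹`) from `T_x M` to `M`. -/
def NoConjugatePoints : Prop :=
  ∀ x : M, IsLocalDiffeomorph 𝓘(ℝ, Plane) (𝓡 2) 1 (F.expMap lam x)

/-- The coefficient `λ I + V(λ)`. -/
def dampingCoeff (p : TangentBundle (𝓡 2) M) : ℝ :=
  lam p * F.mainScalar p + derivAlong F.fieldV lam p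

/-- The function `K_λ = K - H(λ) - λ J + λ² + λ I V(λ) - 𝐅(λ I)`, where `𝐅 = X + λ V`. -/
def thermostatCurvature (p : TangentBundle (𝓡 2) M) : ℝ :=
  F.curvature p - derivAlong F.fieldH lam p - lam p * F.scalarJ p + lam p ^ 2
    + lam p * F.mainScalar p * derivAlong F.fieldV lam p
    - derivAlong (F.thermostatField lam) (fun q => lam q * F.mainScalar q) p

/-- `r` solves the Riccati equation `ṙ + r² + K_λ - (λ I + V(λ)) r = 0` along the orbit of `p` for
all times in the open set `s`. -/
def IsRiccatiSolution (p : TangentBundle (𝓡 2) M) (s : Set ℝ) (r : ℝ → ℝ) : Prop :=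
  ∀ t ∈ s, HasDerivAt r (-(r t ^ 2 + F.thermostatCurvature lam (F.flow lam p t)
    - F.dampingCoeff lam (F.flow lam p t) * r t)) t

end FinslerMetric

end

/-! ### Linear second order equations and the Riccati equation on the line -/

namespace JacobiODE

/-! The equation (R) is the logarithmic form, r = y'/y, of the linear equation y'' = d y' - k y,
where d = λI + V(λ) and k = K_λ are evaluated along an orbit. That linear equation is the linearized
thermostat flow. If a variation of the orbit is written as a 𝐅 + y H + (w - λ I y) V, the structure
equations H = [V, X], [H, V] = X + I H + J V and [X, H] = K V turn invariance under the flow into a'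
= λ y, y' = w, w' = d w - k y (`hasDerivAt_linearized`).

Turning the initial vector ξ inside S_xM produces the variation with a(0) = y(0) = 0 and y'(0) = 1.
If y(t) = 0 for some t > 0, the differential of the exponential map at tξ sends t iξ to a(t) γ̇(t)
and ξ to γ̇(t). Then t iξ and a(t) ξ have the same image, which contradicts injectivity. By the flow
property any point of the orbit may serve as the initial one, so no nontrivial y vanishes twice
(`jacobi_ne_zero`, `noConj_flow`).

The rest is Hopf's argument on the line (`exists_plus_family`). The solution y vanishing at -R with
slope 1 is positive afterwards, and r_R^+ = y'/y has the pole and lives on (-R, ∞). Wronskians keep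
their sign, so r_R^+(t) decreases with R and stays above the Riccati solution with a pole at t + 1.
The limit therefore exists. It is again a solution because the linear solution normalized at 0
depends affinely on its initial slope. Time reversal gives r^-. A solution with a given pole is
unique, so moving the initial point along the orbit only shifts R, and the limits are functions on
SM that solve (R) along the flow.

For the bound, let m be the positive root of m² = A m + A². Where r > m one has r' ≤ -(r - m)², so r
blows up in finite backward time, which a solution on all of ℝ cannot do (`IsRiccati.le_bound`).

The geometric definitions are made at each point in its own preferred chart. To use them, the spray
and the rotation are characterized by conditions that survive oriented coordinate changes; in every
chart the fields and structure functions are then given by the same formulas in the energy.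
Conservation of F and compactness of SM make the flow complete and the coefficients bounded. -/

theorem eq_zero_of_hasDerivAt_mul {s : Set ℝ} (hs : s.OrdConnected) {c f : ℝ → ℝ}
    (hc : ContinuousOn c s) (hf : ∀ t ∈ s, HasDerivAt f (c t * f t) t) {t₀ : ℝ} (ht₀ : t₀ ∈ s)
    (h₀ : f t₀ = 0) : ∀ t ∈ s, f t = 0 := by
  have key : ∀ {s : Set ℝ} (_ : s.OrdConnected) {c f : ℝ → ℝ}
      (_ : ContinuousOn c s) (_ : ∀ t ∈ s, HasDerivAt f (c t * f t) t) {t₀ : ℝ} (_ : t₀ ∈ s)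
      (_ : f t₀ = 0), ∀ t ∈ s, t₀ ≤ t → f t = 0 := by
    intro s hs c f hc hf t₀ ht₀ h₀ t ht hle
    have hsub : Icc t₀ t ⊆ s := hs.out ht₀ ht
    obtain ⟨K, hK⟩ := isCompact_Icc.exists_bound_of_continuousOn (hc.mono hsub)
    refine eq_zero_of_abs_deriv_le_mul_abs_self_of_eq_zero_right (a := t₀) (b := t) (K := K)
      (f' := fun x => c x * f x)
      (fun x hx => (hf x (hsub hx)).continuousAt.continuousWithinAt)
      (fun x hx => (hf x (hsub (Ico_subset_Icc_self hx))).hasDerivWithinAt) h₀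
      (fun x hx => ?_) t ⟨hle, le_rfl⟩
    rw [norm_mul]
    exact mul_le_mul_of_nonneg_right (hK x (Ico_subset_Icc_self hx)) (norm_nonneg _)
  intro t ht
  rcases le_total t₀ t with h | h
  · exact key hs hc hf ht₀ h₀ t ht h
  · have hs' : (Neg.neg ⁻¹' s : Set ℝ).OrdConnected :=
      ⟨fun x hx y hy z hz => hs.out hy hx ⟨neg_le_neg hz.2, neg_le_neg hz.1⟩⟩
    have := key (s := Neg.neg ⁻¹' s) hs' (c := fun u => -c (-u)) (f := fun u => f (-u))
      (hc.comp continuous_neg.continuousOn (fun x hx => hx)).neg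
      (fun u hu => by
        have := (hf (-u) hu).comp u (hasDerivAt_neg u)
        convert! this using 1; ring) (t₀ := -t₀) (by simpa using ht₀) (by simpa using h₀) (-t)
        (by simpa using ht) (by linarith)
    simpa using this

/-- `y'' = d y' - k y`, written as a first order system for `(y, w) = (y, y')`. -/
def IsJacobi (d k y w : ℝ → ℝ) : Prop :=
  ∀ t, HasDerivAt y (w t) t ∧ HasDerivAt w (d t * w t - k t * y t) t

/-- The equation has continuous and bounded coefficients. -/
structure IsCoeff (d k : ℝ → ℝ) : Prop where
  cont_d : Continuous d
  cont_k : Continuous k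
  bdd : ∃ C : ℝ, 0 ≤ C ∧ ∀ t, |d t| ≤ C ∧ |k t| ≤ C

/-- The right hand side of the first order system. -/
def rhs (d k : ℝ → ℝ) (t : ℝ) (p : ℝ × ℝ) : ℝ × ℝ := (p.2, d t * p.2 - k t * p.1)

theorem IsJacobi.hasDerivAt {d k y w : ℝ → ℝ} (h : IsJacobi d k y w) (t : ℝ) :
    HasDerivAt (fun s => (y s, w s)) (rhs d k t (y t, w t)) t :=
  (h t).1.prodMk (h t).2

/-- The right hand side is linear, so the growth bound with constant 1 + 2C, uniform in time, is
also a Lipschitz bound. -/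
theorem IsCoeff.norm_rhs_sub_le {d k : ℝ → ℝ} (h : IsCoeff d k) :
    ∃ K : NNReal, 0 < K ∧ (∀ t, LipschitzWith K (rhs d k t)) ∧ ∀ t p, ‖rhs d k t p‖ ≤ K * ‖p‖ := by
  obtain ⟨C, hC, hb⟩ := h.bdd
  have hn : ∀ t p, ‖rhs d k t p‖ ≤ (1 + 2 * C) * ‖p‖ := by
    intro t p
    have h1 := norm_fst_le p
    have h2 := norm_snd_le p
    have h0 := norm_nonneg p
    rw [Prod.norm_def]
    refine max_le ?_ ?_
    · simp only [rhs]; nlinarith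
    · simp only [rhs]
      refine (norm_sub_le _ _).trans ?_
      rw [norm_mul, norm_mul]
      have := mul_le_mul (hb t).1 h2 (norm_nonneg _) hC
      have := mul_le_mul (hb t).2 h1 (norm_nonneg _) hC
      simp only [Real.norm_eq_abs] at *
      nlinarith
  refine ⟨.mk (1 + 2 * C) (by positivity), ?_, fun t => ?_, hn⟩
  · rw [← NNReal.coe_pos, NNReal.coe_mk]; positivity
  · refine LipschitzWith.of_dist_le_mul fun p q => ?_
    rw [dist_eq_norm, dist_eq_norm]
    have : rhs d k t p - rhs d k t q = rhs d k t (p - q) := by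
      ext <;> simp [rhs]; ring
    rw [this]; exact hn t _

theorem IsJacobi.unique {d k y w y' w' : ℝ → ℝ} (hc : IsCoeff d k) (h : IsJacobi d k y w)
    (h' : IsJacobi d k y' w') {t₀ : ℝ} (hy : y t₀ = y' t₀) (hw : w t₀ = w' t₀) :
    y = y' ∧ w = w' := by
  obtain ⟨K, -, hK, -⟩ := hc.norm_rhs_sub_le
  have := ODE_solution_unique_univ (v := rhs d k) (s := fun _ => univ) (K := K) (t₀ := t₀)
    (fun t => (hK t).lipschitzOnWith) (fun t => ⟨h.hasDerivAt t, trivial⟩)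
    (fun t => ⟨h'.hasDerivAt t, trivial⟩) (by simp [hy, hw])
  exact ⟨funext fun t => congrArg Prod.fst (congrFun this t),
    funext fun t => congrArg Prod.snd (congrFun this t)⟩

/-- Truncation of both coordinates to `[-N, N]`. -/
noncomputable def clamp (N : ℝ) (p : ℝ × ℝ) : ℝ × ℝ :=
  (max (-N) (min N p.1), max (-N) (min N p.2))

theorem abs_trunc_sub_le (N a b : ℝ) :
    |max (-N) (min N a) - max (-N) (min N b)| ≤ |a - b| := by
  refine (abs_max_sub_max_le_max _ _ _ _).trans ?_
  simp only [sub_self, abs_zero]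
  refine max_le (abs_nonneg _) ((abs_min_sub_min_le_max _ _ _ _).trans ?_)
  simp

theorem abs_trunc_le_abs {N : ℝ} (hN : 0 ≤ N) (a : ℝ) : |max (-N) (min N a)| ≤ |a| := by
  have := abs_trunc_sub_le N a 0
  simpa [hN] using this

theorem abs_trunc_le {N : ℝ} (hN : 0 ≤ N) (a : ℝ) : |max (-N) (min N a)| ≤ N := by
  rw [abs_le]
  exact ⟨le_max_left _ _, max_le (by linarith) (min_le_left _ _)⟩

theorem clamp_lipschitz (N : ℝ) : LipschitzWith 1 (clamp N) := by
  refine LipschitzWith.of_dist_le_mul fun p q => ?_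
  simp only [NNReal.coe_one, one_mul, dist_eq_norm]
  exact max_le ((abs_trunc_sub_le N _ _).trans (norm_fst_le (p - q)))
    ((abs_trunc_sub_le N _ _).trans (norm_snd_le (p - q)))

theorem norm_clamp_le {N : ℝ} (hN : 0 ≤ N) (p : ℝ × ℝ) : ‖clamp N p‖ ≤ N :=
  max_le (abs_trunc_le hN _) (abs_trunc_le hN _)

theorem norm_clamp_le_norm {N : ℝ} (hN : 0 ≤ N) (p : ℝ × ℝ) : ‖clamp N p‖ ≤ ‖p‖ :=
  max_le ((abs_trunc_le_abs hN _).trans (norm_fst_le p))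
    ((abs_trunc_le_abs hN _).trans (norm_snd_le p))

theorem clamp_eq_self {N : ℝ} {p : ℝ × ℝ} (hp : ‖p‖ ≤ N) : clamp N p = p := by
  have h1 := abs_le.1 ((norm_fst_le p).trans hp)
  have h2 := abs_le.1 ((norm_snd_le p).trans hp)
  ext <;> simp [clamp, h1, h2]

/-- Picard–Lindelöf needs a bounded field, so the unknown is truncated. Truncation does not increase
norms, hence Grönwall bounds the solution by ‖x₀‖ exp(KT). Truncating at exactly this level changes
nothing along the solution. -/
theorem exists_solution_Icc {d k : ℝ → ℝ} (hc : IsCoeff d k) (x₀ : ℝ × ℝ) {T : ℝ} (hT : 0 < T) :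
    ∃ α : ℝ → ℝ × ℝ, α 0 = x₀ ∧ ∀ t ∈ Ioo (-T) T, HasDerivAt α (rhs d k t (α t)) t := by
  obtain ⟨K, hK0, hK, hKn⟩ := hc.norm_rhs_sub_le
  set N : NNReal := .mk (‖x₀‖ * Real.exp (K * T)) (by positivity) with hN
  have hN0 : (0 : ℝ) ≤ N := N.2
  let TT : NNReal := .mk T hT.le
  -- The ball has radius speed bound `K * N` times `T`, so no solution from x₀ can leave it before
  -- time T.
  have hpl : IsPicardLindelof (fun t p => rhs d k t (clamp N p)) (tmin := -T) (tmax := T)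
      ⟨0, by constructor <;> linarith⟩ x₀ (K * N * TT) 0 (K * N) K := by
    refine ⟨fun t _ => ?_, fun x _ => ?_, fun t _ x _ => ?_, ?_⟩
    · have := ((hK t).comp (clamp_lipschitz N))
      rw [mul_one] at this
      exact this.lipschitzOnWith
    · have h1 := hc.cont_d
      have h2 := hc.cont_k
      simp only [rhs]
      fun_prop
    · refine (hKn _ _).trans ?_
      push_cast
      exact mul_le_mul_of_nonneg_left (norm_clamp_le hN0 _) K.2
    · simp [TT]
  obtain ⟨α, h0, hα⟩ := hpl.exists_eq_forall_mem_Icc_hasDerivWithinAt₀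
  have h0' : α 0 = x₀ := h0
  have hder : ∀ t ∈ Ioo (-T) T, HasDerivAt α (rhs d k t (clamp N (α t))) t := fun t ht =>
    (hα t (Ioo_subset_Icc_self ht)).hasDerivAt (Icc_mem_nhds ht.1 ht.2)
  have hb : ∀ t p, ‖rhs d k t (clamp N p)‖ ≤ K * ‖p‖ + 0 := fun t p => by
    rw [add_zero]
    exact (hKn _ _).trans (mul_le_mul_of_nonneg_left (norm_clamp_le_norm hN0 _) K.2)
  have hbound : ∀ t ∈ Ioo (-T) T, ‖α t‖ ≤ N := by
    intro t ht
    have hexp : ∀ s, s ≤ T → gronwallBound ‖x₀‖ K 0 (s - 0) ≤ N := fun s hs => by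
      rw [gronwallBound_ε0, sub_zero]
      exact mul_le_mul_of_nonneg_left (Real.exp_le_exp.2 (mul_le_mul_of_nonneg_left hs K.2))
        (norm_nonneg _)
    rcases le_total 0 t with h | h
    · have hsub : ∀ x ∈ Icc 0 t, x ∈ Ioo (-T) T := fun x hx =>
        ⟨by linarith [hx.1], by linarith [hx.2, ht.2]⟩
      exact (norm_le_gronwallBound_of_norm_deriv_right_le (a := 0) (b := t)
        (f' := fun x => rhs d k x (clamp N (α x)))
        (fun x hx => (hder x (hsub x hx)).continuousAt.continuousWithinAt)
        (fun x hx => (hder x (hsub x (Ico_subset_Icc_self hx))).hasDerivWithinAt)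
        (by rw [h0']) (fun x _ => hb x _) t ⟨h, le_rfl⟩).trans (hexp t ht.2.le)
    · have hsub : ∀ x ∈ Icc 0 (-t), -x ∈ Ioo (-T) T := fun x hx =>
        ⟨by linarith [hx.2, ht.1], by linarith [hx.1]⟩
      have hd : ∀ x ∈ Icc 0 (-t), HasDerivAt (fun u => α (-u))
          (-(rhs d k (-x) (clamp N (α (-x))))) x := fun x hx => by
        simpa using! (hder (-x) (hsub x hx)).scomp x (hasDerivAt_neg x)
      have := (norm_le_gronwallBound_of_norm_deriv_right_le (a := 0) (b := -t)
        (f := fun u => α (-u)) (δ := ‖x₀‖) (ε := 0) (K := K)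
        (f' := fun x => -(rhs d k (-x) (clamp N (α (-x)))))
        (fun x hx => (hd x hx).continuousAt.continuousWithinAt)
        (fun x hx => (hd x (Ico_subset_Icc_self hx)).hasDerivWithinAt)
        (by simp [h0']) (fun x _ => by rw [norm_neg]; exact hb _ _) (-t)
        ⟨by linarith, le_rfl⟩).trans (hexp (-t) (by linarith [ht.1]))
      simpa using this
  refine ⟨α, h0', fun t ht => ?_⟩
  have := hder t ht
  rwa [clamp_eq_self (hbound t ht)] at this

theorem exists_solution {d k : ℝ → ℝ} (hc : IsCoeff d k) (x₀ : ℝ × ℝ) :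
    ∃ α : ℝ → ℝ × ℝ, α 0 = x₀ ∧ ∀ t, HasDerivAt α (rhs d k t (α t)) t := by
  obtain ⟨K, -, hK, -⟩ := hc.norm_rhs_sub_le
  choose α h0 hα using fun n : ℕ => exists_solution_Icc hc x₀ (T := n + 1) (by positivity)
  have heq : ∀ m n : ℕ, m ≤ n → ∀ t ∈ Ioo (-(m + 1 : ℝ)) (m + 1), α n t = α m t := by
    intro m n hmn t ht
    have hmn' : (m : ℝ) ≤ n := by exact_mod_cast hmn
    refine ODE_solution_unique_of_mem_Ioo (v := rhs d k) (s := fun _ => univ) (K := K) (t₀ := 0)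
      (a := -(m + 1 : ℝ)) (b := m + 1)
      (fun t _ => (hK t).lipschitzOnWith) (by constructor <;> nlinarith [(Nat.cast_nonneg m : (0:ℝ) ≤ m)])
      (fun t ht => ⟨hα n t ⟨by linarith [ht.1], by linarith [ht.2]⟩, trivial⟩)
      (fun t ht => ⟨hα m t ht, trivial⟩) (by rw [h0, h0]) ht
  -- The n-th solution lives on |t| < n + 1, which holds strictly for n = ⌈|t|⌉₊. For s within
  -- distance 1 of t the index exceeds ⌈|t|⌉₊ by at most one, so the solution of index ⌈|t|⌉₊ + 1
  -- represents the glued curve near t.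
  refine ⟨fun t => α ⌈|t|⌉₊ t, by simp [h0], fun t => ?_⟩
  have hev : (fun s => α ⌈|s|⌉₊ s) =ᶠ[𝓝 t] α (⌈|t|⌉₊ + 1) := by
    have : Ioo (t - 1) (t + 1) ∈ 𝓝 t := Ioo_mem_nhds (by linarith) (by linarith)
    filter_upwards [this] with s hs
    have h1 : |s| ≤ |t| + 1 := by
      rw [abs_le]; constructor <;> linarith [hs.1, hs.2, neg_abs_le t, le_abs_self t]
    have h2 : ⌈|s|⌉₊ ≤ ⌈|t|⌉₊ + 1 := by
      rw [Nat.ceil_le]; push_cast; linarith [Nat.le_ceil |t|]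
    refine (heq _ _ h2 s ?_).symm
    have := Nat.le_ceil |s|
    constructor <;> linarith [neg_abs_le s, le_abs_self s]
  refine HasDerivAt.congr_of_eventuallyEq ?_ hev
  change HasDerivAt _ (rhs d k t (α ⌈|t|⌉₊ t)) t
  rw [show α ⌈|t|⌉₊ t = α (⌈|t|⌉₊ + 1) t from hev.self_of_nhds]
  refine hα _ t ?_
  have := Nat.le_ceil |t|
  push_cast
  constructor <;> linarith [neg_abs_le t, le_abs_self t]

theorem IsCoeff.shift {d k : ℝ → ℝ} (hc : IsCoeff d k) (a : ℝ) :
    IsCoeff (fun t => d (t + a)) (fun t => k (t + a)) := by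
  obtain ⟨C, hC, hb⟩ := hc.bdd
  exact ⟨hc.cont_d.comp (by fun_prop), hc.cont_k.comp (by fun_prop), C, hC, fun t => hb _⟩

theorem IsCoeff.reflect {d k : ℝ → ℝ} (hc : IsCoeff d k) :
    IsCoeff (fun t => -d (-t)) (fun t => k (-t)) := by
  obtain ⟨C, hC, hb⟩ := hc.bdd
  exact ⟨(hc.cont_d.comp (by fun_prop)).neg, hc.cont_k.comp (by fun_prop), C, hC,
    fun t => by simpa using hb (-t)⟩

theorem exists_isJacobi {d k : ℝ → ℝ} (hc : IsCoeff d k) (t₀ a b : ℝ) :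
    ∃ y w, IsJacobi d k y w ∧ y t₀ = a ∧ w t₀ = b := by
  obtain ⟨α, h0, hα⟩ := exists_solution (hc.shift t₀) (a, b)
  refine ⟨fun t => (α (t - t₀)).1, fun t => (α (t - t₀)).2, fun t => ?_, by simp [h0], by simp [h0]⟩
  have h := (hα (t - t₀)).comp_sub_const t t₀
  have h1 := h.fst
  have h2 := h.snd
  simp only [rhs, sub_add_cancel] at h1 h2
  exact ⟨h1, h2⟩

theorem IsJacobi.comb {d k y w y' w' : ℝ → ℝ} (h : IsJacobi d k y w) (h' : IsJacobi d k y' w')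
    (a b : ℝ) : IsJacobi d k (fun t => a * y t + b * y' t) (fun t => a * w t + b * w' t) := by
  intro t
  refine ⟨((h t).1.const_mul a).add ((h' t).1.const_mul b), ?_⟩
  convert! ((h t).2.const_mul a).add ((h' t).2.const_mul b) using 1
  ring

theorem isJacobi_zero (d k : ℝ → ℝ) : IsJacobi d k (fun _ => 0) (fun _ => 0) := by
  intro t
  simpa using hasDerivAt_const t (0 : ℝ)

/-- The Wronskian solves W' = d W, so it cannot reach zero. This is the comparison principle for
Riccati solutions: divided by the product of two positive solutions, it orders their logarithmic
derivatives. -/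
theorem IsJacobi.wronskian_pos {d k y w y' w' : ℝ → ℝ} (hc : IsCoeff d k) (h : IsJacobi d k y w)
    (h' : IsJacobi d k y' w') {t₀ : ℝ} (h₀ : 0 < w t₀ * y' t₀ - y t₀ * w' t₀) (t : ℝ) :
    0 < w t * y' t - y t * w' t := by
  have hd : ∀ s, HasDerivAt (fun s => w s * y' s - y s * w' s)
      (d s * (w s * y' s - y s * w' s)) s := fun s => by
    convert! ((h s).2.mul (h' s).1).sub ((h s).1.mul (h' s).2) using 1; ring
  by_contra hneg
  have hcont : Continuous (fun s => w s * y' s - y s * w' s) :=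
    continuous_iff_continuousAt.2 fun s => (hd s).continuousAt
  obtain ⟨s, hs⟩ := mem_range_of_exists_le_of_exists_ge hcont ⟨t, not_lt.1 hneg⟩ ⟨t₀, h₀.le⟩
  have := eq_zero_of_hasDerivAt_mul ordConnected_univ hc.cont_d.continuousOn
    (fun s _ => hd s) (mem_univ s) hs t₀ trivial
  exact h₀.ne' this

/-- No nontrivial solution vanishes twice. -/
def NoConj (d k : ℝ → ℝ) : Prop :=
  ∀ y w, IsJacobi d k y w → ∀ s t, s < t → y s = 0 → w s = 1 → y t ≠ 0

/-- Scaling removes the normalization of the slope. If the second zero t lies before s, its slope is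
nonzero by uniqueness, and the roles of s and t are exchanged. -/
theorem NoConj.ne_zero {d k : ℝ → ℝ} (hc : IsCoeff d k) (hn : NoConj d k) {y w : ℝ → ℝ}
    (h : IsJacobi d k y w) {s t : ℝ} (hst : s ≠ t) (hs : y s = 0) (hw : w s ≠ 0) : y t ≠ 0 := by
  have key : ∀ {y w : ℝ → ℝ} (_ : IsJacobi d k y w) {s t : ℝ} (_ : s < t) (_ : y s = 0)
      (_ : w s ≠ 0), y t ≠ 0 := by
    intro y w h s t hst hs hw
    have := hn _ _ (h.comb (isJacobi_zero d k) (w s)⁻¹ 0) s t hst (by simp [hs]) (by simp [hw])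
    intro h0
    apply this
    simp [h0]
  rcases lt_or_gt_of_ne hst with h1 | h1
  · exact key h h1 hs hw
  · intro h0
    by_cases hwt : w t = 0
    · have := h.unique hc (isJacobi_zero d k) (t₀ := t) h0 hwt
      exact hw (congrFun this.2 s)
    · exact key h h1 h0 hwt hs

theorem IsJacobi.reflect {d k y w : ℝ → ℝ} (h : IsJacobi d k y w) :
    IsJacobi (fun t => -d (-t)) (fun t => k (-t)) (fun t => y (-t)) (fun t => -w (-t)) := by
  intro t
  have h1 := (h (-t)).1.comp t (hasDerivAt_neg t)
  have h2 := ((h (-t)).2.comp t (hasDerivAt_neg t)).neg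
  refine ⟨by simpa using! h1, ?_⟩
  convert! h2 using 1
  ring

theorem NoConj.reflect {d k : ℝ → ℝ} (hc : IsCoeff d k) (hn : NoConj d k) :
    NoConj (fun t => -d (-t)) (fun t => k (-t)) := by
  intro y w h s t hst hs hw
  have h' : IsJacobi d k (fun t => y (-t)) (fun t => -w (-t)) := by
    simpa using h.reflect
  have := hn.ne_zero hc h' (s := -s) (t := -t) (by simpa using hst.ne) (by simpa using hs)
    (by simp [hw])
  simpa using this

/-- `r` solves `r' + r² + k - d r = 0` on `s`. -/
def IsRiccati (d k : ℝ → ℝ) (s : Set ℝ) (r : ℝ → ℝ) : Prop :=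
  ∀ t ∈ s, HasDerivAt r (-(r t ^ 2 + k t - d t * r t)) t

theorem IsJacobi.isRiccati {d k y w : ℝ → ℝ} (h : IsJacobi d k y w) {s : Set ℝ}
    (hs : ∀ t ∈ s, y t ≠ 0) : IsRiccati d k s (fun t => w t / y t) := by
  intro t ht
  have h0 := hs t ht
  convert! (h t).2.div (h t).1 h0 using 1
  field_simp
  ring

/-- The defect w - r y solves f' = (d - r) f, and once it vanishes y solves y' = r y. Solutions of
such scalar linear equations vanish identically or never. -/
theorem IsRiccati.linearize {d k r y w : ℝ → ℝ} (hc : IsCoeff d k) {s : Set ℝ}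
    (hs : s.OrdConnected) (hr : IsRiccati d k s r) (h : IsJacobi d k y w) {t₀ : ℝ} (ht₀ : t₀ ∈ s)
    (h₀ : w t₀ = r t₀ * y t₀) (hy : y t₀ ≠ 0) : ∀ t ∈ s, y t ≠ 0 ∧ w t = r t * y t := by
  have hcr : ContinuousOn r s := fun t ht => (hr t ht).continuousAt.continuousWithinAt
  have h1 : ∀ t ∈ s, w t - r t * y t = 0 := by
    refine eq_zero_of_hasDerivAt_mul hs (c := fun t => d t - r t)
      (f := fun t => w t - r t * y t) (hc.cont_d.continuousOn.sub hcr) (fun t ht => ?_) ht₀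
      (by rw [h₀, sub_self])
    convert! (h t).2.sub ((hr t ht).mul (h t).1) using 1
    ring
  intro t ht
  refine ⟨fun h0 => hy ?_, sub_eq_zero.1 (h1 t ht)⟩
  refine eq_zero_of_hasDerivAt_mul hs hcr (fun u hu => ?_) ht h0 t₀ ht₀
  rw [← sub_eq_zero.1 (h1 u hu)]
  exact (h u).1

end JacobiODE

/-! ### Riccati solutions with a prescribed pole, their limits and the a priori bound -/

namespace JacobiODE

theorem IsJacobi.continuous_fst {d k y w : ℝ → ℝ} (h : IsJacobi d k y w) : Continuous y :=
  continuous_iff_continuousAt.2 fun t => (h t).1.continuousAt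

theorem IsJacobi.continuous_snd {d k y w : ℝ → ℝ} (h : IsJacobi d k y w) : Continuous w :=
  continuous_iff_continuousAt.2 fun t => (h t).2.continuousAt

/-- The slope 1 makes y positive just after a, and a later change of sign would create a second
zero. -/
theorem NoConj.pos {d k : ℝ → ℝ} (hn : NoConj d k) {y w : ℝ → ℝ}
    (h : IsJacobi d k y w) {a t : ℝ} (ha : y a = 0) (hw : w a = 1) (hat : a < t) : 0 < y t := by
  have hs : ∀ᶠ s in 𝓝[>] a, 0 < y s := by
    have h1 := (h a).1.hasDerivWithinAt (s := Ioi a)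
    rw [hasDerivWithinAt_iff_tendsto_slope' (by simp), hw] at h1
    filter_upwards [h1.eventually_const_lt zero_lt_one, self_mem_nhdsWithin] with s hs hsa
    rw [slope_def_field, ha, sub_zero] at hs
    have hsa' : 0 < s - a := sub_pos.2 hsa
    exact (div_pos_iff_of_pos_right hsa').1 hs
  obtain ⟨s, hs0, has, hst⟩ := (hs.and (Ioo_mem_nhdsGT hat)).exists
  by_contra hneg
  obtain ⟨u, hu, hu0⟩ := intermediate_value_Icc' hst.le h.continuous_fst.continuousOn
    (show (0 : ℝ) ∈ Icc (y t) (y s) from ⟨not_lt.1 hneg, hs0.le⟩)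
  exact hn y w h a u (has.trans_le hu.1) ha hw hu0

theorem NoConj.tendsto_pole {d k : ℝ → ℝ} (hn : NoConj d k) {y w : ℝ → ℝ}
    (h : IsJacobi d k y w) {a : ℝ} (ha : y a = 0) (hw : w a = 1) :
    Tendsto (fun t => w t / y t) (𝓝[>] a) atTop := by
  have h1 : Tendsto w (𝓝[>] a) (𝓝 1) := hw ▸ (h.continuous_snd.tendsto a).mono_left inf_le_left
  have h2 : Tendsto y (𝓝[>] a) (𝓝[>] 0) := by
    refine tendsto_nhdsWithin_iff.2 ⟨ha ▸ (h.continuous_fst.tendsto a).mono_left inf_le_left, ?_⟩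
    filter_upwards [self_mem_nhdsWithin] with t ht using hn.pos h ha hw ht
  simpa only [div_eq_mul_inv] using!
    h1.pos_mul_atTop zero_lt_one (tendsto_inv_nhdsGT_zero.comp h2)

/-- Uniqueness of the solution with a pole at a. Write s = u'/u with u a linear solution; since s
tends to infinity, u = u'/s tends to 0 at a. So u is a multiple of y, and the ratio does not see the
multiple. -/
theorem NoConj.eqOn_pole {d k : ℝ → ℝ} (hc : IsCoeff d k) {y w : ℝ → ℝ}
    (h : IsJacobi d k y w) {a T : ℝ} (ha : y a = 0) (hw : w a = 1) (haT : a < T) {s : ℝ → ℝ}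
    (hs : IsRiccati d k (Ioo a T) s) (hlim : Tendsto s (𝓝[>] a) atTop) :
    EqOn s (fun t => w t / y t) (Ioo a T) := by
  obtain ⟨t₀, ht₀⟩ : (Ioo a T).Nonempty := nonempty_Ioo.2 haT
  obtain ⟨u, v, huv, hu, hv⟩ := exists_isJacobi hc t₀ 1 (s t₀)
  have hlin := hs.linearize hc ordConnected_Ioo huv ht₀ (by rw [hu, hv, mul_one])
    (by rw [hu]; exact one_ne_zero)
  have hua : u a = 0 := by
    have h1 : Tendsto u (𝓝[>] a) (𝓝 (u a)) := (huv.continuous_fst.tendsto a).mono_left inf_le_left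
    have h2 : Tendsto v (𝓝[>] a) (𝓝 (v a)) := (huv.continuous_snd.tendsto a).mono_left inf_le_left
    have h3 := h2.mul (tendsto_inv_atTop_zero.comp hlim)
    rw [mul_zero] at h3
    refine tendsto_nhds_unique h1 (h3.congr' ?_)
    filter_upwards [Ioo_mem_nhdsGT haT, hlim.eventually_gt_atTop 0] with t ht hst
    rw [Function.comp, (hlin t ht).2]
    field_simp
  have hcomb := (h.comb (isJacobi_zero d k) (v a) 0).unique hc huv (t₀ := a)
    (by simp [ha, hua]) (by simp [hw])
  intro t ht
  obtain ⟨h0, h1⟩ := hlin t ht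
  have e1 := congrFun hcomb.1 t
  have e2 := congrFun hcomb.2 t
  simp only [mul_zero, add_zero] at e1 e2
  have hva : v a ≠ 0 := fun hva => h0 (by rw [← e1, hva, zero_mul])
  have hy : y t ≠ 0 := fun hy => h0 (by rw [← e1, hy, mul_zero])
  rw [← e1, ← e2] at h1
  change s t = w t / y t
  field_simp
  apply mul_left_cancel₀ hva
  rw [h1]; ring

theorem exists_plus_family {d k : ℝ → ℝ} (hc : IsCoeff d k) (hn : NoConj d k) :
    ∃ (r : ℝ → ℝ → ℝ) (ρ : ℝ → ℝ),
      (∀ R, IsRiccati d k (Ioi (-R)) (r R) ∧ Tendsto (r R) (𝓝[>] (-R)) atTop ∧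
        ∀ T, -R < T → ∀ s, IsRiccati d k (Ioo (-R) T) s → Tendsto s (𝓝[>] (-R)) atTop →
          EqOn s (r R) (Ioo (-R) T)) ∧
      (∀ t, Tendsto (fun R => r R t) atTop (𝓝 (ρ t))) ∧ IsRiccati d k univ ρ := by
  choose Y W hYW hY hW using fun a => exists_isJacobi hc a 0 1
  have hpos : ∀ a t, a < t → 0 < Y a t := fun a t h => hn.pos (hYW a) (hY a) (hW a) h
  set r : ℝ → ℝ → ℝ := fun R t => W (-R) t / Y (-R) t with hr
  have hric : ∀ R, IsRiccati d k (Ioi (-R)) (r R) := fun R =>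
    (hYW (-R)).isRiccati fun t ht => (hpos _ _ ht).ne'
  -- At -R the Wronskian of the solutions vanishing at -R and at -R' is the value of the second one
  -- there, which is positive because -R' < -R.
  have hmono : ∀ t R R', -t < R → R ≤ R' → r R' t ≤ r R t := by
    intro t R R' hR hRR'
    rcases hRR'.eq_or_lt with rfl | hlt
    · exact le_rfl
    have h1 := (hYW (-R)).wronskian_pos hc (hYW (-R')) (t₀ := -R)
      (by rw [hY, hW, one_mul, zero_mul, sub_zero]; exact hpos _ _ (by linarith)) t
    simp only [hr]
    rw [div_le_div_iff₀ (hpos _ _ (by linarith)) (hpos _ _ (by linarith))]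
    linarith
  -- The lower barrier is the logarithmic derivative of the solution that vanishes at t + 1 with
  -- slope -1. It is positive before t + 1 and does not depend on R.
  have hbdd : ∀ t, ∃ m, ∀ R, -t < R → m ≤ r R t := by
    intro t
    obtain ⟨u, v, huv, hu, hv⟩ := exists_isJacobi hc (t + 1) 0 (-1)
    have hut : 0 < u t := by
      have := (hn.reflect hc).pos huv.reflect (a := -(t + 1)) (t := -t) (by simpa using hu)
        (by simp [hv]) (by linarith)
      simpa using this
    refine ⟨v t / u t, fun R hR => ?_⟩
    have hp := hpos (-R) (t + 1) (by linarith)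
    have h1 := (hYW (-R)).wronskian_pos hc huv (t₀ := t + 1) (by rw [hu, hv]; linarith) t
    simp only [hr]
    rw [div_le_div_iff₀ hut (hpos _ _ (by linarith))]
    linarith
  have hlim : ∀ t, ∃ l, Tendsto (fun R => r R t) atTop (𝓝 l) := by
    intro t
    obtain ⟨m, hm⟩ := hbdd t
    -- Replacing R by max(R, 1 - t) makes the family monotone for all real R and changes nothing for
    -- large R.
    have hanti : Antitone (fun R => r (max R (1 - t)) t) := fun R R' h =>
      hmono t _ _ (by have := le_max_right R (1 - t); linarith) (max_le_max_right _ h)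
    have hb : BddBelow (range fun R => r (max R (1 - t)) t) := by
      refine ⟨m, ?_⟩
      rintro _ ⟨R, rfl⟩
      exact hm _ (by have := le_max_right R (1 - t); linarith)
    refine ⟨_, (tendsto_atTop_ciInf hanti hb).congr' ?_⟩
    filter_upwards [eventually_ge_atTop (1 - t)] with R hR
    rw [max_eq_left hR]
  choose ρ hρ using hlim
  refine ⟨r, ρ, fun R => ⟨hric R, hn.tendsto_pole (hYW _) (hY _) (hW _), fun T hT s hs hl =>
    NoConj.eqOn_pole hc (hYW _) (hY _) (hW _) hT hs hl⟩, hρ, ?_⟩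
  obtain ⟨c, c', hcc, hc0, hc1⟩ := exists_isJacobi hc 0 1 0
  obtain ⟨s, s', hss, hs0, hs1⟩ := exists_isJacobi hc 0 0 1
  -- The linear solution with value 1 and slope r_R(0) at time 0 is c + r_R(0) s. It is affine in
  -- r_R(0), so the relation w = r y passes to the limit pointwise, with no uniform convergence in
  -- t.
  have hJ := hcc.comb hss 1 (ρ 0)
  have hrel : ∀ t, 1 * c' t + ρ 0 * s' t = ρ t * (1 * c t + ρ 0 * s t) := by
    intro t
    have hl : Tendsto (fun R => 1 * c' t + r R 0 * s' t) atTop (𝓝 (1 * c' t + ρ 0 * s' t)) :=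
      ((hρ 0).mul_const _).const_add _
    have hl' : Tendsto (fun R => r R t * (1 * c t + r R 0 * s t)) atTop
        (𝓝 (ρ t * (1 * c t + ρ 0 * s t))) :=
      (hρ t).mul (((hρ 0).mul_const _).const_add _)
    refine tendsto_nhds_unique (hl.congr' ?_) hl'
    filter_upwards [eventually_gt_atTop 0, eventually_gt_atTop (-t)] with R hR hRt
    exact ((hric R).linearize hc ordConnected_Ioi (hcc.comb hss 1 (r R 0)) (t₀ := 0)
      (by simpa using hR) (by simp [hc0, hc1, hs0, hs1]) (by simp [hc0, hs0]) t
      (by rw [mem_Ioi]; linarith)).2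
  -- A zero of the limiting solution would be a zero of its derivative too, forcing it to vanish
  -- identically, although its value at 0 is 1.
  have hne : ∀ t, 1 * c t + ρ 0 * s t ≠ 0 := by
    intro t h0
    have h1 := hrel t
    rw [h0, mul_zero] at h1
    have := (hJ.unique hc (isJacobi_zero d k) (t₀ := t) h0 h1).1
    have := congrFun this 0
    simp [hc0, hs0] at this
  have := hJ.isRiccati (s := univ) (fun t _ => hne t)
  convert! this using 2 with t
  rw [hrel t, mul_div_cancel_right₀ _ (hne t)]

/-- Time reversal sends y(t) to y(-t), hence r to -r(-t); it changes the sign of the damping and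
keeps that of k. -/
theorem IsRiccati.reflect {d k r : ℝ → ℝ} {s : Set ℝ}
    (h : IsRiccati (fun t => -d (-t)) (fun t => k (-t)) s r) :
    IsRiccati d k (Neg.neg ⁻¹' s) (fun t => -r (-t)) := by
  intro t ht
  have := ((h (-t) ht).comp t (hasDerivAt_neg t)).neg
  convert! this using 1
  simp only [neg_neg]
  ring

theorem IsRiccati.reflect' {d k r : ℝ → ℝ} {s : Set ℝ} (h : IsRiccati d k s r) :
    IsRiccati (fun t => -d (-t)) (fun t => k (-t)) (Neg.neg ⁻¹' s) (fun t => -r (-t)) := by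
  intro t ht
  have := ((h (-t) ht).comp t (hasDerivAt_neg t)).neg
  convert! this using 1
  ring

theorem exists_minus_family {d k : ℝ → ℝ} (hc : IsCoeff d k) (hn : NoConj d k) :
    ∃ (r : ℝ → ℝ → ℝ) (ρ : ℝ → ℝ),
      (∀ R, IsRiccati d k (Iio R) (r R) ∧ Tendsto (r R) (𝓝[<] R) atBot ∧
        ∀ T, T < R → ∀ s, IsRiccati d k (Ioo T R) s → Tendsto s (𝓝[<] R) atBot →
          EqOn s (r R) (Ioo T R)) ∧
      (∀ t, Tendsto (fun R => r R t) atTop (𝓝 (ρ t))) ∧ IsRiccati d k univ ρ := by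
  obtain ⟨r, ρ, h1, h2, h3⟩ := exists_plus_family hc.reflect (hn.reflect hc)
  refine ⟨fun R t => -r R (-t), fun t => -ρ (-t), fun R => ⟨?_, ?_, ?_⟩, fun t => (h2 (-t)).neg, ?_⟩
  · have := (h1 R).1.reflect
    simpa using this
  · exact tendsto_neg_atTop_atBot.comp ((h1 R).2.1.comp (tendsto_neg_nhdsLT))
  · intro T hT s hs hl
    have e := (h1 R).2.2 (-T) (by linarith) (fun t => -s (-t))
      (by simpa using hs.reflect')
      (tendsto_neg_atBot_atTop.comp (hl.comp (by simpa using tendsto_neg_nhdsGT (a := -R))))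
    intro t ht
    have := e (x := -t) ⟨by linarith [ht.2], by linarith [ht.1]⟩
    simp only [neg_neg] at this
    simp [← this]
  · simpa using h3.reflect

/-- The bound m is the positive root of m² = A m + A², which gives r' ≤ -(r - m)² wherever r > m. If
r(t) > m, then backwards in time r stays at least r(t), and 1/(r - m) decreases at unit rate or
faster. It would reach zero in finite time, while r is defined on the whole line. -/
theorem IsRiccati.le_bound {d k r : ℝ → ℝ} (h : IsRiccati d k univ r) {A : ℝ} (hA : 0 ≤ A)
    (hd : ∀ t, |d t| ≤ A) (hk : ∀ t, |k t| ≤ A ^ 2) (t : ℝ) :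
    r t ≤ A / 2 * (1 + Real.sqrt 5) := by
  have h5 : Real.sqrt 5 ^ 2 = 5 := Real.sq_sqrt (by norm_num)
  have h50 : 1 ≤ Real.sqrt 5 := Real.one_le_sqrt.2 (by norm_num)
  set m := A / 2 * (1 + Real.sqrt 5) with hm
  by_contra hlt
  rw [not_le] at hlt
  have hm0 : 0 ≤ m := by positivity
  have hder : ∀ u, m < r u → -(r u ^ 2 + k u - d u * r u) ≤ -(r u - m) ^ 2 := by
    intro u hu
    have e1 := (abs_le.1 (hk u)).1
    have e2 := (abs_le.1 (hd u)).2
    have hr0 : 0 < r u := hm0.trans_lt hu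
    have e3 : d u * r u ≤ A * r u := mul_le_mul_of_nonneg_right e2 hr0.le
    have e4 : m ^ 2 = A * m + A ^ 2 := by rw [hm]; linear_combination (A ^ 2 / 4) * h5
    have e5 : A ≤ m := by rw [hm]; nlinarith
    nlinarith [mul_nonneg (sub_nonneg.2 e5) (sub_pos.2 hu).le, mul_nonneg hm0 (sub_pos.2 hu).le]
  have hback : ∀ u, 0 ≤ u → r t ≤ r (t - u) := by
    intro u hu
    have hd' : ∀ x, HasDerivAt (fun x => -r (t - x))
        (-(r (t - x) ^ 2 + k (t - x) - d (t - x) * r (t - x))) x := fun x => by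
      have := ((h (t - x) trivial).comp_const_sub t x).neg
      rwa [neg_neg] at this
    have := image_le_of_deriv_right_lt_deriv_boundary' (f := fun x => -r (t - x))
      (f' := fun x => -(r (t - x) ^ 2 + k (t - x) - d (t - x) * r (t - x))) (a := 0) (b := u)
      (fun x _ => (hd' x).continuousAt.continuousWithinAt) (fun x _ => (hd' x).hasDerivWithinAt)
      (B := fun _ => -r t) (B' := fun _ => 0) (by simp) continuousOn_const
      (fun x _ => (hasDerivAt_const x _).hasDerivWithinAt) (fun x _ hx => by
        have hx' : r (t - x) = r t := by simpa using hx
        have := hder (t - x) (by rw [hx']; exact hlt)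
        have hp : 0 < (r (t - x) - m) ^ 2 := by rw [hx']; exact pow_pos (sub_pos.2 hlt) 2
        linarith) (x := u) ⟨hu, le_rfl⟩
    simpa using this
  have hinv : ∀ u, 0 ≤ u → u ≤ (r t - m)⁻¹ - (r (t - u) - m)⁻¹ := by
    intro u hu
    have hg : ∀ x, 0 ≤ x → HasDerivAt (fun x => -(r (t - x) - m)⁻¹ - x)
        (-(-(-(-(r (t - x) ^ 2 + k (t - x) - d (t - x) * r (t - x)))) / (r (t - x) - m) ^ 2) - 1)
        x := fun x hx => by
      have hp : r (t - x) - m ≠ 0 := (sub_pos.2 (hlt.trans_le (hback x hx))).ne'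
      exact (((((h (t - x) trivial).comp_const_sub t x).sub_const m).inv hp).neg).sub
        (hasDerivAt_id x)
    have hmono : MonotoneOn (fun x => -(r (t - x) - m)⁻¹ - x) (Ici 0) := by
      refine monotoneOn_of_deriv_nonneg (convex_Ici 0)
        (fun x hx => (hg x hx).continuousAt.continuousWithinAt)
        (fun x hx => (hg x (interior_subset hx)).differentiableAt.differentiableWithinAt)
        (fun x hx => ?_)
      have hx0 : 0 ≤ x := interior_subset hx
      have hp : 0 < r (t - x) - m := sub_pos.2 (hlt.trans_le (hback x hx0))
      rw [(hg x hx0).deriv, sub_nonneg, ← neg_div, le_div_iff₀ (by positivity)]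
      have := hder (t - x) (sub_pos.1 hp)
      linarith
    have := hmono (mem_Ici.2 le_rfl) (mem_Ici.2 hu) hu
    simp only [sub_zero] at this
    linarith
  have hp0 : 0 < r t - m := sub_pos.2 hlt
  -- Going back by exactly 1/(r(t) - m) leaves no room for the positive number 1/(r - m) at the
  -- earlier time.
  have h1 := hinv (r t - m)⁻¹ (by positivity)
  have hp : 0 < r (t - (r t - m)⁻¹) - m := sub_pos.2 (hlt.trans_le (hback _ (by positivity)))
  have := inv_pos.2 hp
  linarith

theorem IsRiccati.abs_le_bound {d k r : ℝ → ℝ} (h : IsRiccati d k univ r) {A : ℝ} (hA : 0 ≤ A)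
    (hd : ∀ t, |d t| ≤ A) (hk : ∀ t, |k t| ≤ A ^ 2) (t : ℝ) :
    |r t| ≤ A / 2 * (1 + Real.sqrt 5) := by
  refine abs_le'.2 ⟨h.le_bound hA hd hk t, ?_⟩
  have := (h.reflect').le_bound hA (fun t => by simpa using hd (-t)) (fun t => hk (-t)) (-t)
  simpa using this

end JacobiODE

/-! ### Finsler geometry in coordinates -/

namespace FlatFinsler

open FinslerMetric (basisVec)

/-- The fundamental tensor of a Lagrangian `L` in coordinates. -/
noncomputable def flatG (L : Plane × Plane → ℝ) (z : Plane × Plane) (u w : Plane) : ℝ :=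
  fderiv ℝ (fderiv ℝ L) z (0, w) (0, u)

/-- The matrix of the fundamental tensor. -/
noncomputable def gMat (L : Plane × Plane → ℝ) (z : Plane × Plane) : Matrix (Fin 2) (Fin 2) ℝ :=
  Matrix.of fun i j => flatG L z (basisVec i) (basisVec j)

/-- The acceleration of the Euler-Lagrange equation of `L`. -/
noncomputable def accel (L : Plane × Plane → ℝ) (z : Plane × Plane) : Plane :=
  WithLp.toLp 2 ((gMat L z)⁻¹ *ᵥ fun l =>
    fderiv ℝ L z (basisVec l, 0) - fderiv ℝ (fderiv ℝ L) z (z.2, 0) (0, basisVec l))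

/-- Rotation of the velocity by `π/2` with respect to the fundamental tensor. -/
noncomputable def rotate (L : Plane × Plane → ℝ) (z : Plane × Plane) : Plane :=
  (Real.sqrt (gMat L z).det)⁻¹ • !₂[-flatG L z z.2 (basisVec 1), flatG L z z.2 (basisVec 0)]

/-- The determinant of two vectors of the plane. -/
def area (u v : Plane) : ℝ := u 0 * v 1 - u 1 * v 0

/-- `L` is half the square of a Finsler norm on `U`. -/
structure IsEnergy (L : Plane × Plane → ℝ) (U : Set (Plane × Plane)) : Prop where
  isOpen : IsOpen U
  smooth : ContDiffOn ℝ ∞ L U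
  ne_zero : ∀ z ∈ U, z.2 ≠ 0
  convex : ∀ z ∈ U, ∀ u : Plane, u ≠ 0 → 0 < flatG L z u u
  euler : ∀ z ∈ U, fderiv ℝ L z (0, z.2) = 2 * L z

theorem minSmoothness_two_le : minSmoothness ℝ 2 ≤ (∞ : ℕ∞ω) := by
  simpa using (WithTop.coe_le_coe.2 le_top : ((2 : ℕ∞) : ℕ∞ω) ≤ ∞)

theorem plane_eq (u : Plane) : u = u 0 • basisVec 0 + u 1 • basisVec 1 := by
  ext i; fin_cases i <;> simp [basisVec]

@[simp] theorem basisVec_zero_zero : (basisVec 0 : Plane) 0 = 1 := by simp [basisVec]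
@[simp] theorem basisVec_zero_one : (basisVec 0 : Plane) 1 = 0 := by simp [basisVec]
@[simp] theorem basisVec_one_zero : (basisVec 1 : Plane) 0 = 0 := by simp [basisVec]
@[simp] theorem basisVec_one_one : (basisVec 1 : Plane) 1 = 1 := by simp [basisVec]

theorem flatG_add_left (L : Plane × Plane → ℝ) (z : Plane × Plane) (u u' w : Plane) :
    flatG L z (u + u') w = flatG L z u w + flatG L z u' w := by
  simp only [flatG]
  rw [← map_add]; simp

theorem flatG_smul_left (L : Plane × Plane → ℝ) (z : Plane × Plane) (c : ℝ) (u w : Plane) :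
    flatG L z (c • u) w = c * flatG L z u w := by
  simp only [flatG]
  rw [← smul_eq_mul, ← map_smul]; simp

theorem flatG_add_right (L : Plane × Plane → ℝ) (z : Plane × Plane) (u w w' : Plane) :
    flatG L z u (w + w') = flatG L z u w + flatG L z u w' := by
  simp only [flatG]
  rw [← add_apply, ← map_add]; simp

theorem flatG_smul_right (L : Plane × Plane → ℝ) (z : Plane × Plane) (c : ℝ) (u w : Plane) :
    flatG L z u (c • w) = c * flatG L z u w := by
  simp only [flatG]
  rw [← smul_eq_mul, ← smul_apply, ← map_smul]; simp

theorem area_ne_zero_decomp {u v : Plane} (h : area u v ≠ 0) (w : Plane) :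
    w = (area w v / area u v) • u + (area u w / area u v) • v := by
  ext i
  fin_cases i <;> simp <;> field_simp <;> simp only [area] <;> ring

namespace IsEnergy

variable {L : Plane × Plane → ℝ} {U : Set (Plane × Plane)} {z : Plane × Plane}

theorem contDiffOn_fderiv (h : IsEnergy L U) : ContDiffOn ℝ ∞ (fderiv ℝ L) U :=
  h.smooth.fderiv_of_isOpen h.isOpen (by simp)

theorem contDiffOn_fderiv_fderiv (h : IsEnergy L U) :
    ContDiffOn ℝ ∞ (fderiv ℝ (fderiv ℝ L)) U :=
  h.contDiffOn_fderiv.fderiv_of_isOpen h.isOpen (by simp)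

theorem mem_nhds (h : IsEnergy L U) (hz : z ∈ U) : U ∈ 𝓝 z := h.isOpen.mem_nhds hz

theorem differentiableAt (h : IsEnergy L U) (hz : z ∈ U) : DifferentiableAt ℝ L z :=
  (h.smooth.contDiffAt (h.mem_nhds hz)).differentiableAt (by simp)

theorem differentiableAt_fderiv (h : IsEnergy L U) (hz : z ∈ U) :
    DifferentiableAt ℝ (fderiv ℝ L) z :=
  (h.contDiffOn_fderiv.contDiffAt (h.mem_nhds hz)).differentiableAt (by simp)

theorem differentiableAt_fderiv_fderiv (h : IsEnergy L U) (hz : z ∈ U) :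
    DifferentiableAt ℝ (fderiv ℝ (fderiv ℝ L)) z :=
  (h.contDiffOn_fderiv_fderiv.contDiffAt (h.mem_nhds hz)).differentiableAt (by simp)

theorem symm (h : IsEnergy L U) (hz : z ∈ U) (u v : Plane × Plane) :
    fderiv ℝ (fderiv ℝ L) z u v = fderiv ℝ (fderiv ℝ L) z v u :=
  ((h.smooth.contDiffAt (h.mem_nhds hz)).isSymmSndFDerivAt minSmoothness_two_le) u v

theorem flatG_symm (h : IsEnergy L U) (hz : z ∈ U) (u v : Plane) :
    flatG L z u v = flatG L z v u := h.symm hz _ _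

/-- Identities that hold on all of U are differentiated by this product rule together with
`fderiv_congr`; the relations among derivatives of L in the structure equations arise in this way.
-/
theorem fderiv_apply_one (h : IsEnergy L U) (hz : z ∈ U) {p : Plane × Plane → Plane × Plane}
    (hp : DifferentiableAt ℝ p z) (v : Plane × Plane) :
    fderiv ℝ (fun q => fderiv ℝ L q (p q)) z v
      = fderiv ℝ (fderiv ℝ L) z v (p z) + fderiv ℝ L z (fderiv ℝ p z v) := by
  rw [((h.differentiableAt_fderiv hz).hasFDerivAt.clm_apply hp.hasFDerivAt).fderiv]
  simp [add_comm]

theorem fderiv_apply_two (h : IsEnergy L U) (hz : z ∈ U) {p p' : Plane × Plane → Plane × Plane}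
    (hp : DifferentiableAt ℝ p z) (hp' : DifferentiableAt ℝ p' z) (v : Plane × Plane) :
    fderiv ℝ (fun q => fderiv ℝ (fderiv ℝ L) q (p q) (p' q)) z v
      = fderiv ℝ (fderiv ℝ (fderiv ℝ L)) z v (p z) (p' z)
        + fderiv ℝ (fderiv ℝ L) z (fderiv ℝ p z v) (p' z)
        + fderiv ℝ (fderiv ℝ L) z (p z) (fderiv ℝ p' z v) := by
  rw [(((h.differentiableAt_fderiv_fderiv hz).hasFDerivAt.clm_apply hp.hasFDerivAt).clm_apply
    hp'.hasFDerivAt).fderiv]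
  simp only [add_apply, ContinuousLinearMap.comp_apply,
    ContinuousLinearMap.flip_apply]
  ring

theorem symm_third_left (h : IsEnergy L U) (hz : z ∈ U) (u v w : Plane × Plane) :
    fderiv ℝ (fderiv ℝ (fderiv ℝ L)) z u v w = fderiv ℝ (fderiv ℝ (fderiv ℝ L)) z v u w := by
  have := ((h.contDiffOn_fderiv.contDiffAt (h.mem_nhds hz)).isSymmSndFDerivAt minSmoothness_two_le) u v
  rw [this]

theorem fderiv_congr (h : IsEnergy L U) (hz : z ∈ U) {f g : Plane × Plane → ℝ}
    (hfg : ∀ q ∈ U, f q = g q) (v : Plane × Plane) : fderiv ℝ f z v = fderiv ℝ g z v := by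
  rw [Filter.EventuallyEq.fderiv_eq]
  filter_upwards [h.mem_nhds hz] with q hq using hfg q hq

/-- This is the derivative of Euler's relation in the direction v. -/
theorem hess_vertical (h : IsEnergy L U) (hz : z ∈ U) (v : Plane × Plane) :
    fderiv ℝ (fderiv ℝ L) z v (0, z.2) + fderiv ℝ L z (0, v.2) = 2 * fderiv ℝ L z v := by
  have h1 := h.fderiv_congr hz h.euler v
  have hp : HasFDerivAt (fun q : Plane × Plane => ((0 : Plane), q.2))
    ((0 : Plane × Plane →L[ℝ] Plane).prod (ContinuousLinearMap.snd ℝ Plane Plane)) z :=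
    (hasFDerivAt_const 0 z).prodMk hasFDerivAt_snd
  rw [h.fderiv_apply_one hz hp.differentiableAt, hp.fderiv,
    fderiv_const_mul (h.differentiableAt hz)] at h1
  simpa using h1

theorem flatG_velocity (h : IsEnergy L U) (hz : z ∈ U) (w : Plane) :
    flatG L z z.2 w = fderiv ℝ L z (0, w) := by
  have := h.hess_vertical hz (0, w)
  simp only [flatG]; linarith

theorem flatG_velocity_velocity (h : IsEnergy L U) (hz : z ∈ U) :
    flatG L z z.2 z.2 = 2 * L z := by
  rw [h.flatG_velocity hz, h.euler z hz]

theorem energy_pos (h : IsEnergy L U) (hz : z ∈ U) : 0 < L z := by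
  have := h.convex z hz z.2 (h.ne_zero z hz)
  rw [h.flatG_velocity_velocity hz] at this
  linarith

theorem flatG_expand (L : Plane × Plane → ℝ) (z : Plane × Plane) (u w : Plane) :
    flatG L z u w = u 0 * (w 0 * gMat L z 0 0 + w 1 * gMat L z 0 1)
      + u 1 * (w 0 * gMat L z 1 0 + w 1 * gMat L z 1 1) := by
  conv_lhs => rw [plane_eq u, plane_eq w]
  simp only [flatG_add_left, flatG_add_right, flatG_smul_left, flatG_smul_right, gMat,
    Matrix.of_apply]
  ring

theorem gMat_symm (h : IsEnergy L U) (hz : z ∈ U) : gMat L z 1 0 = gMat L z 0 1 :=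
  h.flatG_symm hz _ _

/-- Convexity at the vector (-g₀₁, g₀₀) reads g₀₀ · det > 0, and convexity at the first basis vector
gives g₀₀ > 0. -/
theorem det_pos (h : IsEnergy L U) (hz : z ∈ U) : 0 < (gMat L z).det := by
  rw [Matrix.det_fin_two, h.gMat_symm hz]
  have h0 : 0 < gMat L z 0 0 := by
    refine h.convex z hz (basisVec 0) fun h0 => ?_
    have := congrFun (congrArg WithLp.ofLp h0) 0
    simp at this
  set u : Plane := !₂[-gMat L z 0 1, gMat L z 0 0] with hu
  have h1 := h.convex z hz u fun h0' => by
    have := congrFun (congrArg WithLp.ofLp h0') 1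
    simp [hu] at this
    exact h0.ne' this
  rw [flatG_expand, h.gMat_symm hz] at h1
  simp only [hu, PiLp.toLp_apply, Matrix.cons_val_zero, Matrix.cons_val_one] at h1
  have : 0 < gMat L z 0 0 * (gMat L z 0 0 * gMat L z 1 1 - gMat L z 0 1 * gMat L z 0 1) := by
    linarith
  exact (mul_pos_iff_of_pos_left h0).1 this

theorem eq_of_flatG (h : IsEnergy L U) (hz : z ∈ U) {a b : Plane}
    (hab : ∀ w, flatG L z a w = flatG L z b w) : a = b := by
  by_contra hne
  have h1 := h.convex z hz (a - b) (sub_ne_zero.2 hne)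
  rw [sub_eq_add_neg, ← neg_one_smul ℝ b, flatG_add_left, flatG_smul_left, hab] at h1
  linarith

/-- The Euler-Lagrange equation. -/
theorem eulerLagrange (h : IsEnergy L U) (hz : z ∈ U) (w : Plane) :
    fderiv ℝ (fderiv ℝ L) z (z.2, accel L z) (0, w) = fderiv ℝ L z (w, 0) := by
  have hdet : IsUnit (gMat L z).det := (h.det_pos hz).ne'.isUnit
  set b : Fin 2 → ℝ := fun l =>
    fderiv ℝ L z (basisVec l, 0) - fderiv ℝ (fderiv ℝ L) z (z.2, 0) (0, basisVec l) with hb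
  have hmul : gMat L z *ᵥ (accel L z : Fin 2 → ℝ) = b := by
    change gMat L z *ᵥ ((gMat L z)⁻¹ *ᵥ b) = b
    rw [Matrix.mulVec_mulVec, Matrix.mul_nonsing_inv _ hdet, Matrix.one_mulVec]
  have hl : ∀ l, flatG L z (basisVec l) (accel L z) = b l := by
    intro l
    rw [← hmul]
    fin_cases l <;> rw [flatG_expand] <;> simp [Matrix.mulVec, dotProduct] <;> ring
  have key : ∀ w, flatG L z w (accel L z) = fderiv ℝ L z (w, 0)
      - fderiv ℝ (fderiv ℝ L) z (z.2, 0) (0, w) := by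
    intro w
    have e1 : ((w, 0) : Plane × Plane) = w 0 • (basisVec 0, 0) + w 1 • (basisVec 1, 0) := by
      ext1
      · simpa using plane_eq w
      · simp
    have e2 : ((0, w) : Plane × Plane) = w 0 • (0, basisVec 0) + w 1 • (0, basisVec 1) := by
      ext1
      · simp
      · simpa using plane_eq w
    rw [e1, e2]
    conv_lhs => rw [plane_eq w]
    rw [flatG_add_left, flatG_smul_left, flatG_smul_left, hl, hl]
    simp only [map_add, map_smul, smul_eq_mul, hb]
    ring
  have hsplit : ((z.2, accel L z) : Plane × Plane) = (z.2, 0) + (0, accel L z) := by simp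
  rw [hsplit, map_add, add_apply]
  have := key w
  simp only [flatG] at this
  linarith

/-- Since the fundamental tensor is nondegenerate, the Euler–Lagrange equation determines the
acceleration. Covariance of the spray thus reduces to covariance of this equation. -/
theorem accel_unique (h : IsEnergy L U) (hz : z ∈ U) {a : Plane}
    (ha : ∀ w, fderiv ℝ (fderiv ℝ L) z (z.2, a) (0, w) = fderiv ℝ L z (w, 0)) :
    a = accel L z := by
  refine h.eq_of_flatG hz fun w => ?_
  have h1 := ha w
  have h2 := h.eulerLagrange hz w
  have hsplit : ∀ a : Plane, ((z.2, a) : Plane × Plane) = (z.2, 0) + (0, a) := fun a => by simp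
  rw [hsplit, map_add, add_apply] at h1 h2
  rw [h.flatG_symm hz a, h.flatG_symm hz (accel L z)]
  simp only [flatG]
  linarith

theorem area_velocity_rotate (h : IsEnergy L U) (hz : z ∈ U) :
    area z.2 (rotate L z) = (Real.sqrt (gMat L z).det)⁻¹ * (2 * L z) := by
  rw [← h.flatG_velocity_velocity hz]
  simp only [rotate, area, PiLp.smul_apply, smul_eq_mul, Matrix.cons_val_zero,
    Matrix.cons_val_one]
  conv_rhs => rw [plane_eq z.2]
  rw [flatG_add_right, flatG_smul_right, flatG_smul_right, ← plane_eq z.2]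
  ring

theorem area_pos (h : IsEnergy L U) (hz : z ∈ U) : 0 < area z.2 (rotate L z) := by
  rw [h.area_velocity_rotate hz]
  have := h.energy_pos hz
  have := Real.sqrt_pos.2 (h.det_pos hz)
  positivity

theorem flatG_velocity_rotate (L : Plane × Plane → ℝ) (z : Plane × Plane) :
    flatG L z z.2 (rotate L z) = 0 := by
  have : rotate L z = (Real.sqrt (gMat L z).det)⁻¹ •
      ((-flatG L z z.2 (basisVec 1)) • basisVec 0 + flatG L z z.2 (basisVec 0) • basisVec 1) := by
    rw [rotate]
    congr 1
    ext i; fin_cases i <;> simp [basisVec]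
  rw [this, flatG_smul_right, flatG_add_right, flatG_smul_right, flatG_smul_right]
  ring

theorem flatG_rotate_rotate (h : IsEnergy L U) (hz : z ∈ U) :
    flatG L z (rotate L z) (rotate L z) = 2 * L z := by
  have hs := Real.sqrt_pos.2 (h.det_pos hz)
  have hsq : Real.sqrt (gMat L z).det ^ 2 = (gMat L z).det := Real.sq_sqrt (h.det_pos hz).le
  rw [Matrix.det_fin_two, h.gMat_symm hz] at hsq
  rw [← h.flatG_velocity_velocity hz, flatG_expand, flatG_expand L z z.2]
  have e0 : flatG L z z.2 (basisVec 0) = z.2 0 * gMat L z 0 0 + z.2 1 * gMat L z 0 1 := by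
    rw [flatG_expand, h.gMat_symm hz]; simp
  have e1 : flatG L z z.2 (basisVec 1) = z.2 0 * gMat L z 0 1 + z.2 1 * gMat L z 1 1 := by
    rw [flatG_expand]; simp
  simp only [rotate, PiLp.smul_apply, smul_eq_mul, Matrix.cons_val_zero,
    Matrix.cons_val_one, e0, e1, h.gMat_symm hz]
  rw [Matrix.det_fin_two, h.gMat_symm hz] at hs ⊢
  set s := Real.sqrt (gMat L z 0 0 * gMat L z 1 1 - gMat L z 0 1 * gMat L z 0 1)
  field_simp
  rw [hsq]
  ring

/-- Orthogonal decomposition with respect to velocity and its rotation. -/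
theorem decomp (h : IsEnergy L U) (hz : z ∈ U) (u : Plane) :
    u = (flatG L z u z.2 / (2 * L z)) • z.2
      + (flatG L z u (rotate L z) / (2 * L z)) • rotate L z := by
  have hL := (h.energy_pos hz).ne'
  obtain ⟨α, β, hu⟩ : ∃ α β : ℝ, u = α • z.2 + β • rotate L z :=
    ⟨_, _, area_ne_zero_decomp (h.area_pos hz).ne' u⟩
  have h1 : flatG L z u z.2 = α * (2 * L z) := by
    rw [hu, flatG_add_left, flatG_smul_left, flatG_smul_left, h.flatG_velocity_velocity hz,
      h.flatG_symm hz (rotate L z), flatG_velocity_rotate]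
    ring
  have h2 : flatG L z u (rotate L z) = β * (2 * L z) := by
    rw [hu, flatG_add_left, flatG_smul_left, flatG_smul_left, h.flatG_rotate_rotate hz,
      flatG_velocity_rotate]
    ring
  rw [h1, h2, mul_div_cancel_right₀ _ (by positivity), mul_div_cancel_right₀ _ (by positivity)]
  exact hu

/-- Orthogonality leaves a multiple β iξ, the norm gives β² = 1, and the orientation gives β > 0.
All three conditions survive an oriented change of coordinates. -/
theorem rotate_unique (h : IsEnergy L U) (hz : z ∈ U) {r : Plane} (h1 : flatG L z z.2 r = 0)
    (h2 : flatG L z r r = 2 * L z) (h3 : 0 < area z.2 r) : r = rotate L z := by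
  have hL := h.energy_pos hz
  have hd := h.decomp hz r
  rw [h.flatG_symm hz r, h1, zero_div, zero_smul, zero_add] at hd
  set β := flatG L z r (rotate L z) / (2 * L z)
  rw [hd, flatG_smul_left, flatG_smul_right, h.flatG_rotate_rotate hz] at h2
  have ha := h.area_pos hz
  have h3' : 0 < β * area z.2 (rotate L z) := by
    rw [hd] at h3
    simp only [area, PiLp.smul_apply, smul_eq_mul] at h3 ⊢
    linarith
  have hβ : 0 < β := (mul_pos_iff_of_pos_right ha).1 h3'
  have hβ1 : β = 1 := by
    have : (β - 1) * (β + 1) * (2 * L z) = 0 := by linear_combination h2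
    simpa [hL.ne', (by linarith : β + 1 ≠ 0), sub_eq_zero] using this
  rw [hd, hβ1, one_smul]

end IsEnergy

end FlatFinsler

/-! ### The frame X, H, V in coordinates and its structure equations -/

namespace FlatFinsler

open FinslerMetric (basisVec)
open VectorField (lieBracket)

/-- The spray of `L`. -/
noncomputable def spray (L : Plane × Plane → ℝ) (z : Plane × Plane) : Plane × Plane :=
  (z.2, accel L z)

/-- The vertical rotation field. -/
noncomputable def vert (L : Plane × Plane → ℝ) (z : Plane × Plane) : Plane × Plane :=
  (0, rotate L z)

/-- The horizontal field. -/
noncomputable def horiz (L : Plane × Plane → ℝ) : Plane × Plane → Plane × Plane :=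
  lieBracket ℝ (vert L) (spray L)

/-- The component of a vector along the spray. -/
noncomputable def coeff1 (L : Plane × Plane → ℝ) (z Z : Plane × Plane) : ℝ :=
  flatG L z Z.1 z.2 / (2 * L z)

/-- The component of a vector along the horizontal field. -/
noncomputable def coeff2 (L : Plane × Plane → ℝ) (z Z : Plane × Plane) : ℝ :=
  flatG L z Z.1 (rotate L z) / (2 * L z)

/-- The component of a vector along the vertical field. -/
noncomputable def coeff3 (L : Plane × Plane → ℝ) (z Z : Plane × Plane) : ℝ :=
  flatG L z (Z - coeff1 L z Z • spray L z - coeff2 L z Z • horiz L z).2 (rotate L z) / (2 * L z)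

namespace IsEnergy

variable {L : Plane × Plane → ℝ} {U : Set (Plane × Plane)} {z : Plane × Plane}

theorem contDiffOn_flatG (h : IsEnergy L U) {p q : Plane × Plane → Plane}
    (hp : ContDiffOn ℝ ∞ p U) (hq : ContDiffOn ℝ ∞ q U) :
    ContDiffOn ℝ ∞ (fun z => flatG L z (p z) (q z)) U :=
  (h.contDiffOn_fderiv_fderiv.clm_apply (contDiffOn_const.prodMk hq)).clm_apply
    (contDiffOn_const.prodMk hp)

theorem contDiffOn_gMat (h : IsEnergy L U) (i j : Fin 2) :
    ContDiffOn ℝ ∞ (fun z => gMat L z i j) U :=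
  h.contDiffOn_flatG contDiffOn_const contDiffOn_const

theorem contDiffOn_det (h : IsEnergy L U) : ContDiffOn ℝ ∞ (fun z => (gMat L z).det) U := by
  simp only [Matrix.det_fin_two]
  exact ((h.contDiffOn_gMat 0 0).mul (h.contDiffOn_gMat 1 1)).sub
    ((h.contDiffOn_gMat 0 1).mul (h.contDiffOn_gMat 1 0))

theorem contDiffOn_accel (h : IsEnergy L U) : ContDiffOn ℝ ∞ (accel L) U := by
  have hinv : ∀ i j, ContDiffOn ℝ ∞ (fun z => (gMat L z)⁻¹ i j) U := by
    intro i j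
    simp only [Matrix.inv_def, Ring.inverse_eq_inv', Matrix.smul_apply, smul_eq_mul]
    refine (h.contDiffOn_det.inv fun z hz => (h.det_pos hz).ne').mul ?_
    simp only [Matrix.adjugate_fin_two]
    fin_cases i <;> fin_cases j
    · exact h.contDiffOn_gMat 1 1
    · exact (h.contDiffOn_gMat 0 1).neg
    · exact (h.contDiffOn_gMat 1 0).neg
    · exact h.contDiffOn_gMat 0 0
  have hb : ∀ l, ContDiffOn ℝ ∞ (fun z => fderiv ℝ L z (basisVec l, 0)
      - fderiv ℝ (fderiv ℝ L) z (z.2, 0) (0, basisVec l)) U := fun l =>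
    (h.contDiffOn_fderiv.clm_apply contDiffOn_const).sub
      ((h.contDiffOn_fderiv_fderiv.clm_apply
        (contDiff_snd.contDiffOn.prodMk contDiffOn_const)).clm_apply contDiffOn_const)
  rw [contDiffOn_euclidean]
  intro i
  simp only [accel, Matrix.mulVec, dotProduct, Fin.sum_univ_two]
  exact ((hinv i 0).mul (hb 0)).add ((hinv i 1).mul (hb 1))

theorem contDiffOn_rotate (h : IsEnergy L U) : ContDiffOn ℝ ∞ (rotate L) U := by
  refine ContDiffOn.smul ((h.contDiffOn_det.sqrt fun _ hz => (h.det_pos hz).ne').inv fun z hz =>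
    (Real.sqrt_pos.2 (h.det_pos hz)).ne') ?_
  rw [contDiffOn_euclidean]
  intro i
  fin_cases i
  · exact (h.contDiffOn_flatG contDiff_snd.contDiffOn contDiffOn_const).neg
  · exact h.contDiffOn_flatG contDiff_snd.contDiffOn contDiffOn_const

theorem contDiffOn_spray (h : IsEnergy L U) : ContDiffOn ℝ ∞ (spray L) U :=
  contDiff_snd.contDiffOn.prodMk h.contDiffOn_accel

theorem contDiffOn_vert (h : IsEnergy L U) : ContDiffOn ℝ ∞ (vert L) U :=
  contDiffOn_const.prodMk h.contDiffOn_rotate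

theorem contDiffOn_lieBracket (h : IsEnergy L U) {Y Z : Plane × Plane → Plane × Plane}
    (hY : ContDiffOn ℝ ∞ Y U) (hZ : ContDiffOn ℝ ∞ Z U) :
    ContDiffOn ℝ ∞ (lieBracket ℝ Y Z) U :=
  ((hZ.fderiv_of_isOpen h.isOpen (by simp)).clm_apply hY).sub
    ((hY.fderiv_of_isOpen h.isOpen (by simp)).clm_apply hZ)

theorem contDiffOn_horiz (h : IsEnergy L U) : ContDiffOn ℝ ∞ (horiz L) U :=
  h.contDiffOn_lieBracket h.contDiffOn_vert h.contDiffOn_spray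

theorem contDiffOn_coeff2 (h : IsEnergy L U) {Z : Plane × Plane → Plane × Plane}
    (hZ : ContDiffOn ℝ ∞ Z U) : ContDiffOn ℝ ∞ (fun z => coeff2 L z (Z z)) U :=
  (h.contDiffOn_flatG (contDiff_fst.comp_contDiffOn hZ) h.contDiffOn_rotate).div
    (contDiffOn_const.mul h.smooth) fun _ hz => (mul_pos two_pos (h.energy_pos hz)).ne'

theorem contDiffOn_coeff3 (h : IsEnergy L U) {Z : Plane × Plane → Plane × Plane}
    (hZ : ContDiffOn ℝ ∞ Z U) : ContDiffOn ℝ ∞ (fun z => coeff3 L z (Z z)) U := by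
  have h1 : ContDiffOn ℝ ∞ (fun z => coeff1 L z (Z z)) U :=
    (h.contDiffOn_flatG (contDiff_fst.comp_contDiffOn hZ) contDiff_snd.contDiffOn).div
      (contDiffOn_const.mul h.smooth) fun _ hz => (mul_pos two_pos (h.energy_pos hz)).ne'
  exact (h.contDiffOn_flatG (contDiff_snd.comp_contDiffOn ((hZ.sub
    (h1.smul h.contDiffOn_spray)).sub ((h.contDiffOn_coeff2 hZ).smul h.contDiffOn_horiz)))
    h.contDiffOn_rotate).div
    (contDiffOn_const.mul h.smooth) fun _ hz => (mul_pos two_pos (h.energy_pos hz)).ne'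

theorem diffAt (h : IsEnergy L U) (hz : z ∈ U) {F : Type*} [NormedAddCommGroup F]
    [NormedSpace ℝ F] {f : Plane × Plane → F} (hf : ContDiffOn ℝ ∞ f U) :
    DifferentiableAt ℝ f z :=
  (hf.contDiffAt (h.mem_nhds hz)).differentiableAt (by simp)

theorem energy_vert (h : IsEnergy L U) (hz : z ∈ U) : fderiv ℝ L z (vert L z) = 0 := by
  rw [vert, ← h.flatG_velocity hz, flatG_velocity_rotate]

theorem energy_spray (h : IsEnergy L U) (hz : z ∈ U) : fderiv ℝ L z (spray L z) = 0 := by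
  have h1 := h.eulerLagrange hz z.2
  have h2 := h.hess_vertical hz (spray L z)
  simp only [spray] at *
  have hsplit : ((z.2, accel L z) : Plane × Plane) = (z.2, 0) + (0, accel L z) := by simp
  rw [h1] at h2
  rw [hsplit, map_add] at h2 ⊢
  linarith

/-- Differentiate dL(Y) = 0 along Z and dL(Z) = 0 along Y; in the difference the Hessian terms
cancel by symmetry. So brackets of the frame stay tangent to the energy levels and can be expanded
in the frame. -/
theorem energy_lieBracket (h : IsEnergy L U) (hz : z ∈ U) {Y Z : Plane × Plane → Plane × Plane}
    (hY : ContDiffOn ℝ ∞ Y U) (hZ : ContDiffOn ℝ ∞ Z U)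
    (hY0 : ∀ q ∈ U, fderiv ℝ L q (Y q) = 0) (hZ0 : ∀ q ∈ U, fderiv ℝ L q (Z q) = 0) :
    fderiv ℝ L z (lieBracket ℝ Y Z z) = 0 := by
  have h1 := h.fderiv_congr hz (g := fun _ => 0) hY0 (Z z)
  have h2 := h.fderiv_congr hz (g := fun _ => 0) hZ0 (Y z)
  rw [h.fderiv_apply_one hz (h.diffAt hz hY)] at h1
  rw [h.fderiv_apply_one hz (h.diffAt hz hZ), h.symm hz] at h2
  simp only [fderiv_fun_const, Pi.zero_apply, zero_apply] at h1 h2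
  rw [lieBracket, map_sub]
  linarith

theorem energy_horiz (h : IsEnergy L U) (hz : z ∈ U) : fderiv ℝ L z (horiz L z) = 0 :=
  h.energy_lieBracket hz h.contDiffOn_vert h.contDiffOn_spray (fun _ hq => h.energy_vert hq)
    fun _ hq => h.energy_spray hq

theorem fderiv_spray (h : IsEnergy L U) (hz : z ∈ U) (v : Plane × Plane) :
    fderiv ℝ (spray L) z v = (v.2, fderiv ℝ (accel L) z v) := by
  have := (hasFDerivAt_snd (𝕜 := ℝ) (p := z)).prodMk (h.diffAt hz h.contDiffOn_accel).hasFDerivAt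
  change fderiv ℝ (fun z => (z.2, accel L z)) z v = _
  rw [this.fderiv]; rfl

theorem fderiv_vert (h : IsEnergy L U) (hz : z ∈ U) (v : Plane × Plane) :
    fderiv ℝ (vert L) z v = (0, fderiv ℝ (rotate L) z v) := by
  have := (hasFDerivAt_const (𝕜 := ℝ) (0 : Plane) z).prodMk
    (h.diffAt hz h.contDiffOn_rotate).hasFDerivAt
  change fderiv ℝ (fun z => ((0 : Plane), rotate L z)) z v = _
  rw [this.fderiv]; rfl

theorem horiz_eq (h : IsEnergy L U) (hz : z ∈ U) :
    horiz L z = (rotate L z,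
      fderiv ℝ (accel L) z (vert L z) - fderiv ℝ (rotate L) z (spray L z)) := by
  rw [horiz, lieBracket, h.fderiv_spray hz, h.fderiv_vert hz]
  ext1 <;> simp [vert]

/-- Vectors tangent to the energy levels are combinations of the frame. -/
theorem frame_decomp (h : IsEnergy L U) (hz : z ∈ U) {Z : Plane × Plane}
    (hZ : fderiv ℝ L z Z = 0) :
    Z = coeff1 L z Z • spray L z + coeff2 L z Z • horiz L z + coeff3 L z Z • vert L z := by
  set R := Z - coeff1 L z Z • spray L z - coeff2 L z Z • horiz L z with hR
  have hR1 : R.1 = 0 := by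
    have := h.decomp hz Z.1
    rw [hR, h.horiz_eq hz]
    simp only [Prod.fst_sub, Prod.smul_fst, spray, coeff1, coeff2]
    rw [sub_sub, ← this, sub_self]
  have hR0 : fderiv ℝ L z R = 0 := by
    rw [hR, map_sub, map_sub, map_smul, map_smul, hZ, h.energy_spray hz, h.energy_horiz hz]
    simp
  have hRe : R = (0, R.2) := by ext1 <;> simp [hR1]
  have hR2 : R.2 = coeff3 L z Z • rotate L z := by
    have := h.decomp hz R.2
    rw [hRe, ← h.flatG_velocity hz] at hR0
    simp only [h.flatG_symm hz R.2 z.2] at this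
    rw [hR0, zero_div, zero_smul, zero_add] at this
    exact this
  have : R = coeff3 L z Z • vert L z := by
    rw [hRe, hR2]
    ext1 <;> simp [vert]
  rw [← this, hR]
  abel

theorem hess_spray (h : IsEnergy L U) (hz : z ∈ U) (w : Plane) :
    fderiv ℝ (fderiv ℝ L) z (spray L z) (0, w) = fderiv ℝ L z (w, 0) := h.eulerLagrange hz w

theorem fderiv_fst_lieBracket (h : IsEnergy L U) (hz : z ∈ U)
    {Y Z : Plane × Plane → Plane × Plane} {y w : Plane × Plane → Plane}
    (hY : DifferentiableAt ℝ Y z) (hZ : DifferentiableAt ℝ Z z)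
    (hy : ∀ q ∈ U, (Y q).1 = y q) (hw : ∀ q ∈ U, (Z q).1 = w q) :
    (lieBracket ℝ Y Z z).1 = fderiv ℝ w z (Y z) - fderiv ℝ y z (Z z) := by
  have e1 : fderiv ℝ y z = (ContinuousLinearMap.fst ℝ Plane Plane).comp (fderiv ℝ Y z) := by
    rw [← (hasFDerivAt_fst.comp z hY.hasFDerivAt).fderiv]
    refine Filter.EventuallyEq.fderiv_eq ?_
    filter_upwards [h.mem_nhds hz] with q hq using (hy q hq).symm
  have e2 : fderiv ℝ w z = (ContinuousLinearMap.fst ℝ Plane Plane).comp (fderiv ℝ Z z) := by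
    rw [← (hasFDerivAt_fst.comp z hZ.hasFDerivAt).fderiv]
    refine Filter.EventuallyEq.fderiv_eq ?_
    filter_upwards [h.mem_nhds hz] with q hq using (hw q hq).symm
  rw [e1, e2, lieBracket]
  simp

theorem fst_horiz_vert (h : IsEnergy L U) (hz : z ∈ U) :
    (lieBracket ℝ (horiz L) (vert L) z).1 = -fderiv ℝ (rotate L) z (vert L z) := by
  rw [h.fderiv_fst_lieBracket hz (h.diffAt hz h.contDiffOn_horiz) (h.diffAt hz h.contDiffOn_vert)
    (y := rotate L) (w := fun _ => 0) (fun q hq => by rw [h.horiz_eq hq]) (fun _ _ => rfl)]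
  simp

theorem fst_spray_horiz (h : IsEnergy L U) (hz : z ∈ U) :
    (lieBracket ℝ (spray L) (horiz L) z).1
      = (2 : ℝ) • fderiv ℝ (rotate L) z (spray L z) - fderiv ℝ (accel L) z (vert L z) := by
  rw [h.fderiv_fst_lieBracket hz (h.diffAt hz h.contDiffOn_spray) (h.diffAt hz h.contDiffOn_horiz)
    (y := fun q => q.2) (w := rotate L) (fun _ _ => rfl) (fun q hq => by rw [h.horiz_eq hq]),
    hasFDerivAt_snd.fderiv, h.horiz_eq hz]
  simp only [ContinuousLinearMap.coe_snd']
  module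

theorem momentum_fderiv_rotate (h : IsEnergy L U) (hz : z ∈ U) (v : Plane × Plane) :
    fderiv ℝ L z (0, fderiv ℝ (rotate L) z v) = -fderiv ℝ (fderiv ℝ L) z v (vert L z) := by
  have h1 := h.fderiv_congr hz (g := fun _ => 0) (fun q hq => h.energy_vert hq) v
  rw [h.fderiv_apply_one hz (h.diffAt hz h.contDiffOn_vert), h.fderiv_vert hz] at h1
  simp only [fderiv_fun_const, Pi.zero_apply, zero_apply] at h1
  linarith

/-- The base part of [H, V] is -D_V(iξ). Differentiating dL(V) = 0 along V turns its pairing with ξ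
into g(iξ, iξ) = 2L. -/
theorem coeff1_horiz_vert (h : IsEnergy L U) (hz : z ∈ U) :
    coeff1 L z (lieBracket ℝ (horiz L) (vert L) z) = 1 := by
  have hL := h.energy_pos hz
  have h1 := h.momentum_fderiv_rotate hz (vert L z)
  have h2 := h.flatG_rotate_rotate hz
  simp only [flatG] at h2
  rw [coeff1, h.fst_horiz_vert hz, h.flatG_symm hz, ← neg_one_smul ℝ, flatG_smul_right,
    h.flatG_velocity hz, h1, div_eq_one_iff_eq (by positivity)]
  simp only [vert]
  linarith

/-- Differentiate dL(V) = 0 along X and dL(X) = 0 along V. The Euler–Lagrange equation evaluates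
both Hessian terms as dL(iξ, 0), and the contributions cancel. -/
theorem coeff1_spray_horiz (h : IsEnergy L U) (hz : z ∈ U) :
    coeff1 L z (lieBracket ℝ (spray L) (horiz L) z) = 0 := by
  have h1 := h.momentum_fderiv_rotate hz (spray L z)
  have h2 := h.fderiv_congr hz (g := fun _ => 0) (fun q hq => h.energy_spray hq) (vert L z)
  rw [h.fderiv_apply_one hz (h.diffAt hz h.contDiffOn_spray), h.fderiv_spray hz] at h2
  have h3 : fderiv ℝ (fderiv ℝ L) z (vert L z) (spray L z) = fderiv ℝ L z (rotate L z, 0) := by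
    rw [h.symm hz]; exact h.hess_spray hz _
  have h4 : fderiv ℝ (fderiv ℝ L) z (spray L z) (vert L z) = fderiv ℝ L z (rotate L z, 0) :=
    h.hess_spray hz _
  have hsplit : (((vert L z).2, fderiv ℝ (accel L) z (vert L z)) : Plane × Plane)
      = (rotate L z, 0) + (0, fderiv ℝ (accel L) z (vert L z)) := by simp [vert]
  rw [h3, hsplit, map_add] at h2
  rw [h4] at h1
  simp only [fderiv_fun_const, Pi.zero_apply, zero_apply] at h2
  rw [coeff1, h.fst_spray_horiz hz, h.flatG_symm hz, sub_eq_add_neg, ← neg_one_smul ℝ (fderiv ℝ (accel L) z _),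
    flatG_add_right, flatG_smul_right, flatG_smul_right, h.flatG_velocity hz, h.flatG_velocity hz,
    h1, div_eq_zero_iff]
  left
  linarith

/-- Two identities are differentiated: g(iξ, iξ) = 2L along X, and, along V, the Euler–Lagrange
equation tested on the vector iξ frozen at z. Their third derivatives of L agree by symmetry and
drop out. -/
theorem coeff2_spray_horiz (h : IsEnergy L U) (hz : z ∈ U) :
    coeff2 L z (lieBracket ℝ (spray L) (horiz L) z) = 0 := by
  have h1 := h.fderiv_congr hz (fun q hq => h.flatG_rotate_rotate hq) (spray L z)
  have hv := h.diffAt hz h.contDiffOn_vert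
  change fderiv ℝ (fun q => fderiv ℝ (fderiv ℝ L) q (vert L q) (vert L q)) z _ = _ at h1
  rw [h.fderiv_apply_two hz hv hv, h.fderiv_vert hz, fderiv_const_mul (h.differentiableAt hz),
    smul_apply, h.energy_spray hz] at h1
  have h2 := h.fderiv_congr hz (fun q hq => h.hess_spray hq (rotate L z)) (vert L z)
  rw [h.fderiv_apply_two hz (h.diffAt hz h.contDiffOn_spray) (differentiableAt_const _),
    h.fderiv_apply_one hz (differentiableAt_const _), h.fderiv_spray hz,
    h.symm_third_left hz] at h2
  have hsplit : (((vert L z).2, fderiv ℝ (accel L) z (vert L z)) : Plane × Plane)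
      = (rotate L z, 0) + (0, fderiv ℝ (accel L) z (vert L z)) := by simp [vert]
  simp only [hsplit, map_add, add_apply, fderiv_fun_const, Pi.zero_apply, zero_apply, map_zero,
    add_zero] at h2
  have h3 := h.symm hz (rotate L z, 0) (vert L z)
  have h4 := h.symm hz (vert L z) (0, fderiv ℝ (rotate L) z (spray L z))
  rw [coeff2, h.fst_spray_horiz hz, sub_eq_add_neg,
    ← neg_one_smul ℝ (fderiv ℝ (accel L) z _), flatG_add_left, flatG_smul_left, flatG_smul_left,
    h.flatG_symm hz, h.flatG_symm hz (fderiv ℝ (accel L) z _), div_eq_zero_iff]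
  left
  simp only [flatG]
  simp only [vert, smul_zero] at *
  linarith

/-- The structure equation `[H, V] = X + I H + J V`. -/
theorem lieBracket_horiz_vert (h : IsEnergy L U) (hz : z ∈ U) :
    lieBracket ℝ (horiz L) (vert L) z = spray L z
      + coeff2 L z (lieBracket ℝ (horiz L) (vert L) z) • horiz L z
      + coeff3 L z (lieBracket ℝ (horiz L) (vert L) z) • vert L z := by
  have := h.frame_decomp hz (h.energy_lieBracket hz h.contDiffOn_horiz h.contDiffOn_vert
    (fun _ hq => h.energy_horiz hq) (fun _ hq => h.energy_vert hq))
  rwa [h.coeff1_horiz_vert hz, one_smul] at this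

/-- The structure equation `[X, H] = K V`. -/
theorem lieBracket_spray_horiz (h : IsEnergy L U) (hz : z ∈ U) :
    lieBracket ℝ (spray L) (horiz L) z
      = coeff3 L z (lieBracket ℝ (spray L) (horiz L) z) • vert L z := by
  have := h.frame_decomp hz (h.energy_lieBracket hz h.contDiffOn_spray h.contDiffOn_horiz
    (fun _ hq => h.energy_spray hq) (fun _ hq => h.energy_horiz hq))
  rwa [h.coeff1_spray_horiz hz, h.coeff2_spray_horiz hz, zero_smul, zero_smul, zero_add,
    zero_add] at this

end IsEnergy

/-! ### Change of coordinates -/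

/-- The change of coordinates of the tangent bundle induced by `φ`. -/
noncomputable def tangentLift (φ : Plane → Plane) (z : Plane × Plane) : Plane × Plane :=
  (φ z.1, fderiv ℝ φ z.1 z.2)

theorem area_map (A : Plane →L[ℝ] Plane) (u v : Plane) : area (A u) (A v) = A.det * area u v := by
  have hdet : A.det = area (A (basisVec 0)) (A (basisVec 1)) := by
    rw [ContinuousLinearMap.det,
      ← LinearMap.det_toMatrix (EuclideanSpace.basisFun (Fin 2) ℝ).toBasis, Matrix.det_fin_two]
    simp [LinearMap.toMatrix_apply, basisVec, area]
    ring
  have e1 : A u = u 0 • A (basisVec 0) + u 1 • A (basisVec 1) := by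
    conv_lhs => rw [plane_eq u]
    simp
  have e2 : A v = v 0 • A (basisVec 0) + v 1 • A (basisVec 1) := by
    conv_lhs => rw [plane_eq v]
    simp
  rw [hdet, e1, e2]
  simp only [area, PiLp.add_apply, PiLp.smul_apply, smul_eq_mul]
  ring

section Covariance

variable {φ : Plane → Plane} {z : Plane × Plane}

theorem hasFDerivAt_tangentLift (hφ : ContDiffAt ℝ 2 φ z.1) :
    HasFDerivAt (tangentLift φ) (((fderiv ℝ φ z.1).comp (ContinuousLinearMap.fst ℝ Plane Plane)).prod
      (((fderiv ℝ φ z.1).comp (ContinuousLinearMap.snd ℝ Plane Plane)) +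
        ((fderiv ℝ (fderiv ℝ φ) z.1).comp (ContinuousLinearMap.fst ℝ Plane Plane)).flip z.2)) z := by
  have h1 : HasFDerivAt (fun q : Plane × Plane => φ q.1)
      ((fderiv ℝ φ z.1).comp (ContinuousLinearMap.fst ℝ Plane Plane)) z :=
    ((hφ.differentiableAt (by simp)).hasFDerivAt).comp z hasFDerivAt_fst
  have h2 : HasFDerivAt (fun q : Plane × Plane => fderiv ℝ φ q.1)
      ((fderiv ℝ (fderiv ℝ φ) z.1).comp (ContinuousLinearMap.fst ℝ Plane Plane)) z :=
    (((hφ.fderiv_right (m := 1) (by norm_num)).differentiableAt (by simp)).hasFDerivAt).comp z hasFDerivAt_fst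
  exact h1.prodMk (h2.clm_apply hasFDerivAt_snd)

theorem fderiv_tangentLift (hφ : ContDiffAt ℝ 2 φ z.1) (v : Plane × Plane) :
    fderiv ℝ (tangentLift φ) z v
      = (fderiv ℝ φ z.1 v.1, fderiv ℝ φ z.1 v.2 + fderiv ℝ (fderiv ℝ φ) z.1 v.1 z.2) := by
  rw [(hasFDerivAt_tangentLift hφ).fderiv]
  rfl

variable {L L' : Plane × Plane → ℝ} {U U' : Set (Plane × Plane)}

theorem fderiv_comp_tangentLift (h' : IsEnergy L' U') (hz' : tangentLift φ z ∈ U')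
    (hφ : ContDiffAt ℝ 2 φ z.1) (hL : L =ᶠ[𝓝 z] fun q => L' (tangentLift φ q))
    (v : Plane × Plane) :
    fderiv ℝ L z v = fderiv ℝ L' (tangentLift φ z) (fderiv ℝ (tangentLift φ) z v) := by
  rw [hL.fderiv_eq]
  exact congrFun (congrArg DFunLike.coe ((h'.differentiableAt hz').hasFDerivAt.comp z
    (hasFDerivAt_tangentLift hφ).differentiableAt.hasFDerivAt).fderiv) v

/-- With a vertical second slot the only correction is dL' on a vertical vector built from D²φ. It
vanishes when v is vertical too, so g is a tensor; in the Euler–Lagrange equation it cancels against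
the correction of dL, because D²φ is symmetric. -/
theorem hess_comp_tangentLift (h : IsEnergy L U) (hz : z ∈ U) (h' : IsEnergy L' U')
    (hz' : tangentLift φ z ∈ U')
    (hφ : ContDiffAt ℝ 2 φ z.1) (hL : L =ᶠ[𝓝 z] fun q => L' (tangentLift φ q))
    (v : Plane × Plane) (w : Plane) :
    fderiv ℝ (fderiv ℝ L) z v (0, w)
      = fderiv ℝ (fderiv ℝ L') (tangentLift φ z) (fderiv ℝ (tangentLift φ) z v)
          (0, fderiv ℝ φ z.1 w)
        + fderiv ℝ L' (tangentLift φ z) (0, fderiv ℝ (fderiv ℝ φ) z.1 v.1 w) := by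
  have hlift := (hasFDerivAt_tangentLift hφ).differentiableAt
  have hev : (fun q => fderiv ℝ L q (0, w)) =ᶠ[𝓝 z]
      fun q => fderiv ℝ L' (tangentLift φ q) (0, fderiv ℝ φ q.1 w) := by
    have h1 : ∀ᶠ q : Plane × Plane in 𝓝 z, ContDiffAt ℝ 2 φ q.1 :=
      continuous_fst.continuousAt.eventually (hφ.eventually (by simp))
    have h2 : ∀ᶠ q in 𝓝 z, tangentLift φ q ∈ U' :=
      hlift.continuousAt.preimage_mem_nhds (h'.mem_nhds hz')
    filter_upwards [h1, h2, hL.eventually_nhds] with q hq1 hq2 hq3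
    rw [fderiv_comp_tangentLift h' hq2 hq1 hq3, fderiv_tangentLift hq1]
    simp
  have e1 : fderiv ℝ (fderiv ℝ L) z v (0, w) = fderiv ℝ (fun q => fderiv ℝ L q (0, w)) z v := by
    rw [h.fderiv_apply_one hz (differentiableAt_const _)]
    simp
  have h3 : HasFDerivAt (fun q : Plane × Plane => fderiv ℝ φ q.1)
      ((fderiv ℝ (fderiv ℝ φ) z.1).comp (ContinuousLinearMap.fst ℝ Plane Plane)) z :=
    (((hφ.fderiv_right (m := 1) (by norm_num)).differentiableAt (by simp)).hasFDerivAt).comp z hasFDerivAt_fst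
  have h4 := (hasFDerivAt_const (𝕜 := ℝ) (0 : Plane) z).prodMk
    (h3.clm_apply (hasFDerivAt_const w z))
  have h5 := ((h'.differentiableAt_fderiv hz').hasFDerivAt.comp z hlift.hasFDerivAt).clm_apply h4
  rw [e1, hev.fderiv_eq]
  refine (congrFun (congrArg DFunLike.coe h5.fderiv) v).trans ?_
  simp [add_comm]

theorem flatG_comp_tangentLift (h : IsEnergy L U) (hz : z ∈ U) (h' : IsEnergy L' U')
    (hz' : tangentLift φ z ∈ U')
    (hφ : ContDiffAt ℝ 2 φ z.1) (hL : L =ᶠ[𝓝 z] fun q => L' (tangentLift φ q))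
    (u w : Plane) :
    flatG L' (tangentLift φ z) (fderiv ℝ φ z.1 u) (fderiv ℝ φ z.1 w) = flatG L z u w := by
  simp only [flatG]
  rw [hess_comp_tangentLift h hz h' hz' hφ hL, fderiv_tangentLift hφ]
  simp only [map_zero, zero_apply, add_zero, Prod.mk_zero_zero]

/-- The spray does not depend on the coordinates. -/
theorem fderiv_tangentLift_spray (h : IsEnergy L U) (hz : z ∈ U) (h' : IsEnergy L' U')
    (hz' : tangentLift φ z ∈ U')
    (hφ : ContDiffAt ℝ 2 φ z.1) (hL : L =ᶠ[𝓝 z] fun q => L' (tangentLift φ q))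
    (hdet : 0 < (fderiv ℝ φ z.1).det) :
    fderiv ℝ (tangentLift φ) z (spray L z) = spray L' (tangentLift φ z) := by
  have hsurj : Function.Surjective (fderiv ℝ φ z.1) := by
    have hu : IsUnit (LinearMap.det (fderiv ℝ φ z.1 : Plane →ₗ[ℝ] Plane)) := hdet.ne'.isUnit
    exact (LinearEquiv.ofIsUnitDet (v := (EuclideanSpace.basisFun (Fin 2) ℝ).toBasis)
      (v' := (EuclideanSpace.basisFun (Fin 2) ℝ).toBasis)
      (by rwa [LinearMap.det_toMatrix])).surjective
  rw [fderiv_tangentLift hφ]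
  refine Prod.ext rfl (h'.accel_unique hz' fun w' => ?_)
  obtain ⟨w, rfl⟩ := hsurj w'
  have h1 := h.eulerLagrange hz w
  rw [hess_comp_tangentLift h hz h' hz' hφ hL, fderiv_tangentLift hφ,
    fderiv_comp_tangentLift h' hz' hφ hL, fderiv_tangentLift hφ] at h1
  have hs : fderiv ℝ (fderiv ℝ φ) z.1 z.2 w = fderiv ℝ (fderiv ℝ φ) z.1 w z.2 :=
    (hφ.isSymmSndFDerivAt (by simp)) _ _
  simp only [map_zero, zero_add] at h1
  have hsplit : ((fderiv ℝ φ z.1 w, fderiv ℝ (fderiv ℝ φ) z.1 w z.2) : Plane × Plane)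
      = (fderiv ℝ φ z.1 w, 0) + (0, fderiv ℝ (fderiv ℝ φ) z.1 w z.2) := by simp
  rw [hsplit, map_add, hs] at h1
  exact add_right_cancel h1

/-- The rotation does not depend on oriented coordinates. -/
theorem fderiv_rotate (h : IsEnergy L U) (hz : z ∈ U) (h' : IsEnergy L' U')
    (hz' : tangentLift φ z ∈ U')
    (hφ : ContDiffAt ℝ 2 φ z.1) (hL : L =ᶠ[𝓝 z] fun q => L' (tangentLift φ q))
    (hdet : 0 < (fderiv ℝ φ z.1).det) :
    fderiv ℝ φ z.1 (rotate L z) = rotate L' (tangentLift φ z) := by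
  refine h'.rotate_unique hz' ?_ ?_ ?_
  · change flatG L' (tangentLift φ z) (fderiv ℝ φ z.1 z.2) _ = 0
    rw [flatG_comp_tangentLift h hz h' hz' hφ hL, IsEnergy.flatG_velocity_rotate]
  · rw [flatG_comp_tangentLift h hz h' hz' hφ hL, h.flatG_rotate_rotate hz, hL.eq_of_nhds]
  · change 0 < area (fderiv ℝ φ z.1 z.2) _
    rw [area_map]
    exact mul_pos hdet (h.area_pos hz)

theorem fderiv_tangentLift_vert (h : IsEnergy L U) (hz : z ∈ U) (h' : IsEnergy L' U')
    (hz' : tangentLift φ z ∈ U')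
    (hφ : ContDiffAt ℝ 2 φ z.1) (hL : L =ᶠ[𝓝 z] fun q => L' (tangentLift φ q))
    (hdet : 0 < (fderiv ℝ φ z.1).det) :
    fderiv ℝ (tangentLift φ) z (vert L z) = vert L' (tangentLift φ z) := by
  rw [fderiv_tangentLift hφ]
  simp only [vert, map_zero, zero_apply, add_zero]
  rw [fderiv_rotate h hz h' hz' hφ hL hdet]

end Covariance

end FlatFinsler

/-! ### Vector fields and their flows in charts -/

namespace ChartRep

open VectorField

variable {E H N : Type*} [NormedAddCommGroup E] [NormedSpace ℝ E]
  [TopologicalSpace H] {I : ModelWithCorners ℝ E H} [TopologicalSpace N] [ChartedSpace H N]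
  [IsManifold I 1 N]

/-- The vector field `Z` in the chart at `q`. -/
noncomputable def chartRep (I : ModelWithCorners ℝ E H) [IsManifold I 1 N] (q : N)
    (Z : (p : N) → TangentSpace I p) (z : E) : E :=
  tangentCoordChange I ((extChartAt I q).symm z) q ((extChartAt I q).symm z)
    (Z ((extChartAt I q).symm z))

theorem chartRep_extChartAt (q : N) (Z : (p : N) → TangentSpace I p) {p : N}
    (hp : p ∈ (extChartAt I q).source) :
    chartRep I q Z (extChartAt I q p) = tangentCoordChange I p q p (Z p) := by
  rw [chartRep, (extChartAt I q).left_inv hp]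

theorem chartRep_self (q : N) (Z : (p : N) → TangentSpace I p) :
    chartRep I q Z (extChartAt I q q) = Z q := by
  rw [chartRep_extChartAt q Z (mem_extChartAt_source q)]
  exact tangentCoordChange_self (mem_extChartAt_source q)

theorem hasMFDerivAt_extChartAt_tangentCoordChange {q p : N}
    (hp : p ∈ (extChartAt I q).source) :
    HasMFDerivAt I 𝓘(ℝ, E) (extChartAt I q) p (tangentCoordChange (E := E) I p q p) := by
  rw [extChartAt_source] at hp
  rw [← mfderiv_chartAt_eq_tangentCoordChange hp]
  exact hasMFDerivAt_extChartAt hp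

theorem contMDiffAt_of_chartRep {n : ℕ∞ω} [IsManifold I (n + 1) N] {q : N}
    {Z : (p : N) → TangentSpace I p}
    (h : ContDiffAt ℝ n (chartRep I q Z) (extChartAt I q q)) :
    ContMDiffAt I I.tangent n (fun p => (⟨p, Z p⟩ : TangentBundle I N)) q := by
  have : IsManifold I n N := IsManifold.of_le (n := n + 1) le_self_add
  refine (Bundle.contMDiffAt_section (E := fun p : N => TangentSpace I p) (F := E) q).2 ?_
  have h1 : ContMDiffAt I 𝓘(ℝ, E) n (chartRep I q Z ∘ extChartAt I q) q :=
    h.contMDiffAt.comp q contMDiffAt_extChartAt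
  refine h1.congr_of_eventuallyEq ?_
  filter_upwards [extChartAt_source_mem_nhds (I := I) q] with p hp
  rw [Function.comp, chartRep_extChartAt q Z hp]
  rfl

theorem contDiffAt_chartRep [I.Boundaryless] {q : N} {Z : (p : N) → TangentSpace I p}
    (h : ContMDiffAt I I.tangent 1 (fun p => (⟨p, Z p⟩ : TangentBundle I N)) q) :
    ContDiffAt ℝ 1 (chartRep I q Z) (extChartAt I q q) := by
  rw [contMDiffAt_iff] at h
  have h2 := h.2
  rw [I.range_eq_univ, contDiffWithinAt_univ] at h2
  exact h2.snd

variable [CompleteSpace E]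

-- The differentials of the chart and of its inverse are inverse to each other, so pulling back by
-- the inverse chart is the same as applying the coordinate change. This makes the naturality of the
-- bracket under pullback available for `chartRep`.
omit [CompleteSpace E] in
theorem mpullback_extChartAt_symm [I.Boundaryless] {q : N} (Z : (p : N) → TangentSpace I p)
    {z : E} (hz : z ∈ (extChartAt I q).target) :
    mpullback 𝓘(ℝ, E) I (extChartAt I q).symm Z z = chartRep I q Z z := by
  have hs : (extChartAt I q).symm z ∈ (extChartAt I q).source := (extChartAt I q).map_target hz
  have h1 := mfderiv_extChartAt_comp_mfderivWithin_extChartAt_symm (I := I) (x := q) hz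
  have h2 := mfderivWithin_extChartAt_symm_comp_mfderiv_extChartAt (I := I) (x := q) hz
  rw [I.range_eq_univ, mfderivWithin_univ] at h1 h2
  rw [(hasMFDerivAt_extChartAt_tangentCoordChange hs).mfderiv] at h1 h2
  rw [mpullback_apply, ContinuousLinearMap.inverse_eq h2 h1]
  rfl

/-- The Lie bracket can be computed in any chart. -/
theorem tangentCoordChange_mlieBracket [I.Boundaryless] [IsManifold I 3 N] {q p : N}
    {V W : (p : N) → TangentSpace I p} (hp : p ∈ (extChartAt I q).source)
    (hV : MDifferentiableAt I I.tangent (fun p => (⟨p, V p⟩ : TangentBundle I N)) p)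
    (hW : MDifferentiableAt I I.tangent (fun p => (⟨p, W p⟩ : TangentBundle I N)) p) :
    tangentCoordChange I p q p (mlieBracket I V W p)
      = lieBracket ℝ (chartRep I q V) (chartRep I q W) (extChartAt I q p) := by
  have hz : extChartAt I q p ∈ (extChartAt I q).target := (extChartAt I q).map_source hp
  have hpz : (extChartAt I q).symm (extChartAt I q p) = p := (extChartAt I q).left_inv hp
  have : IsManifold I (minSmoothness ℝ 3) N := by simpa using! ‹IsManifold I 3 N›
  have : IsManifold I 2 N := IsManifold.of_le (n := 3) (by norm_num)
  have hnhds : (extChartAt I q).target ∈ 𝓝 (extChartAt I q p) :=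
    (isOpen_extChartAt_target q).mem_nhds hz
  have hf : ContMDiffAt 𝓘(ℝ, E) I 2 (extChartAt I q).symm (extChartAt I q p) :=
    (contMDiffOn_extChartAt_symm q).contMDiffAt hnhds
  have hmain := mpullback_mlieBracket (I := 𝓘(ℝ, E)) (I' := I) (V := V) (W := W)
    (f := (extChartAt I q).symm) (x₀ := extChartAt I q p) (n := 2)
    (by rw [hpz]; exact hV) (by rw [hpz]; exact hW) hf (by simp)
  rw [mpullback_extChartAt_symm _ hz, chartRep_extChartAt q _ hp] at hmain
  rw [hmain, ← mlieBracketWithin_univ, mlieBracketWithin_eq_lieBracketWithin]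
  refine (congrFun lieBracketWithin_univ _).trans ?_
  refine Filter.EventuallyEq.lieBracket_vectorField_eq ?_ ?_
  · filter_upwards [hnhds] with y hy using mpullback_extChartAt_symm V hy
  · filter_upwards [hnhds] with y hy using mpullback_extChartAt_symm W hy

omit [CompleteSpace E] in
theorem hasDerivAt_of_isMIntegralCurve {γ : ℝ → N} {Z : (p : N) → TangentSpace I p}
    {q : N} {t : ℝ} (hγ : IsMIntegralCurve γ Z)
    (ht : γ t ∈ (extChartAt I q).source) :
    HasDerivAt (fun s => extChartAt I q (γ s)) (chartRep I q Z (extChartAt I q (γ t))) t := by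
  have h := (hasMFDerivAt_extChartAt_tangentCoordChange ht).comp t (hγ t)
  rw [chartRep_extChartAt q Z ht]
  have h' : HasDerivAt (fun s => extChartAt I q (γ s))
      (tangentCoordChange I (γ t) q (γ t) ((1 : ℝ) • (show E from Z (γ t)))) t :=
    HasFDerivAt.hasDerivAt (f' := (tangentCoordChange I (γ t) q (γ t)).comp
      ((1 : ℝ →L[ℝ] ℝ).smulRight (show E from Z (γ t)))) (HasMFDerivAt.hasFDerivAt h)
  rwa [one_smul] at h'

end ChartRep

/-! ### Differentiable dependence on initial values in a normed space -/

namespace ChartRep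

section Flat

variable {E : Type*} [NormedAddCommGroup E] [NormedSpace ℝ E]

theorem gronwallBound_mul (a δ K ε x : ℝ) :
    gronwallBound (a * δ) K (a * ε) x = a * gronwallBound δ K ε x := by
  unfold gronwallBound
  split_ifs <;> ring

/-- Strict differentiability gives the expansion near each point of the curve with the derivative
frozen there, and continuity of the derivative unfreezes it. Compactness of [0, σ] makes the
neighbourhood of 0 uniform in s. -/
theorem eventually_forall_norm_sub_le {f : E → E} {u : ℝ → E} {σ : ℝ}
    (hu : ∀ s ∈ Icc 0 σ, ContinuousAt u s) (hf : ∀ s ∈ Icc 0 σ, ContDiffAt ℝ 1 f (u s))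
    {η : ℝ} (hη : 0 < η) :
    ∀ᶠ h in 𝓝 (0 : E), ∀ s ∈ Icc 0 σ,
      ‖f (u s + h) - f (u s) - fderiv ℝ f (u s) h‖ ≤ η * ‖h‖ := by
  refine isCompact_Icc.eventually_forall_of_forall_eventually fun s₀ hs₀ => ?_
  have hstrict := ((hf s₀ hs₀).hasStrictFDerivAt one_ne_zero).isLittleO.def (half_pos hη)
  have hus : Tendsto (fun p : E × ℝ => u p.2) (𝓝 (0, s₀)) (𝓝 (u s₀)) :=
    (hu s₀ hs₀).tendsto.comp (continuous_snd.tendsto (0, s₀))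
  have hcont : Tendsto (fun p : E × ℝ => (u p.2 + p.1, u p.2)) (𝓝 (0, s₀))
      (𝓝 (u s₀, u s₀)) := by
    refine Tendsto.prodMk_nhds ?_ hus
    simpa using hus.add (continuous_fst.tendsto ((0 : E), s₀))
  have hD : ∀ᶠ p : E × ℝ in 𝓝 (0, s₀), ‖fderiv ℝ f (u p.2) - fderiv ℝ f (u s₀)‖ < η / 2 := by
    have h1 : Tendsto (fun p : E × ℝ => fderiv ℝ f (u p.2)) (𝓝 (0, s₀))
        (𝓝 (fderiv ℝ f (u s₀))) :=
      ((hf s₀ hs₀).continuousAt_fderiv one_ne_zero).tendsto.comp hus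
    have := h1.eventually (Metric.ball_mem_nhds _ (half_pos hη))
    simpa [dist_eq_norm] using this
  filter_upwards [hcont.eventually hstrict, hD] with p hp1 hp2
  simp only [add_sub_cancel_left] at hp1
  have e : f (u p.2 + p.1) - f (u p.2) - fderiv ℝ f (u p.2) p.1
      = (f (u p.2 + p.1) - f (u p.2) - fderiv ℝ f (u s₀) p.1)
        - (fderiv ℝ f (u p.2) - fderiv ℝ f (u s₀)) p.1 := by
    rw [sub_apply]; abel
  rw [e]
  refine (norm_sub_le _ _).trans ?_
  have h3 := (fderiv ℝ f (u p.2) - fderiv ℝ f (u s₀)).le_opNorm p.1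
  have h4 := mul_le_mul_of_nonneg_right hp2.le (norm_nonneg p.1)
  linarith

/-- Differentiable dependence on initial values along a one parameter family of solutions. -/
theorem hasDerivAt_family {f : E → E} {x : ℝ → ℝ → E} {w : ℝ → E} {σ L' : ℝ} (hσ : 0 ≤ σ)
    (hL' : 0 ≤ L')
    (hf : ∀ s ∈ Icc 0 σ, ContDiffAt ℝ 1 f (x 0 s))
    (hx : ∀ᶠ θ in 𝓝 (0 : ℝ), ∀ s ∈ Icc 0 σ, HasDerivAt (x θ) (f (x θ s)) s)
    (hlip : ∀ᶠ θ in 𝓝 (0 : ℝ), ∀ s ∈ Icc 0 σ, ‖x θ s - x 0 s‖ ≤ L' * ‖x θ 0 - x 0 0‖)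
    (hw : ∀ s ∈ Icc 0 σ, HasDerivAt w (fderiv ℝ f (x 0 s) (w s)) s)
    (h0 : HasDerivAt (fun θ => x θ 0) (w 0) 0) :
    HasDerivAt (fun θ => x θ σ) (w σ) 0 := by
  have hx0 := hx.self_of_nhds
  have hucont : ∀ s ∈ Icc 0 σ, ContinuousAt (x 0) s := fun s hs => (hx0 s hs).continuousAt
  obtain ⟨K, hK⟩ := (isCompact_Icc (a := (0 : ℝ)) (b := σ)).exists_bound_of_continuousOn
    (f := fun s => fderiv ℝ f (x 0 s))
    (fun s hs => (((hf s hs).continuousAt_fderiv one_ne_zero).comp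
      (hucont s hs)).continuousWithinAt)
  have hK0 : 0 ≤ K := (norm_nonneg _).trans (hK 0 ⟨le_rfl, hσ⟩)
  rw [hasDerivAt_iff_isLittleO, Asymptotics.isLittleO_iff]
  intro c hc
  -- The initial displacement is at most C|θ|, and G is the Grönwall constant for unit initial
  -- error. With η = c/(G + 1) the final error ηG|θ| is at most c|θ|.
  set C := ‖w 0‖ + 1 with hC
  have hC0 : 0 ≤ C := by positivity
  set G := gronwallBound 1 K (L' * C) σ with hG
  have hG0 : 0 ≤ G := by
    have := gronwallBound_mono (δ := 1) (ε := L' * C) (K := K) zero_le_one (by positivity) hK0 hσ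
    rw [gronwallBound_x0] at this
    linarith
  set η := c / (G + 1) with hη
  have hη0 : 0 < η := by positivity
  rw [hasDerivAt_iff_isLittleO, Asymptotics.isLittleO_iff] at h0
  have hunif := eventually_forall_norm_sub_le hucont hf hη0
  obtain ⟨δ, hδ, hball⟩ := Metric.eventually_nhds_iff.1 hunif
  have hsmall : ∀ᶠ θ : ℝ in 𝓝 0, L' * C * |θ| < δ := by
    have : Tendsto (fun θ : ℝ => L' * C * |θ|) (𝓝 0) (𝓝 (L' * C * |0|)) :=
      (continuous_const.mul continuous_abs).tendsto 0
    rw [abs_zero, mul_zero] at this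
    exact this.eventually_lt_const hδ
  filter_upwards [hx, hlip, h0 hη0, h0 one_pos, hsmall] with θ hθx hθl hθ0 hθ1 hθs
  simp only [sub_zero, Real.norm_eq_abs, one_mul] at hθ0 hθ1 ⊢
  have hinit : ‖x θ 0 - x 0 0‖ ≤ C * |θ| := by
    have := norm_add_le (x θ 0 - x 0 0 - θ • w 0) (θ • w 0)
    rw [sub_add_cancel, norm_smul, Real.norm_eq_abs] at this
    rw [hC]; linarith
  have hclose : ∀ s ∈ Icc 0 σ, ‖x θ s - x 0 s‖ ≤ L' * C * |θ| := fun s hs =>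
    (hθl s hs).trans (by rw [mul_assoc]; exact mul_le_mul_of_nonneg_left hinit hL')
  have hder : ∀ s ∈ Icc 0 σ, HasDerivAt (fun s => x θ s - x 0 s - θ • w s)
      (f (x θ s) - f (x 0 s) - θ • fderiv ℝ f (x 0 s) (w s)) s := fun s hs =>
    ((hθx s hs).sub (hx0 s hs)).sub ((hw s hs).const_smul θ)
  -- The error x_θ - x_0 - θw solves the linearized equation up to the first order remainder of f,
  -- which is small compared with θ.
  have hgr := norm_le_gronwallBound_of_norm_deriv_right_le (a := 0) (b := σ) (K := K)
    (δ := η * |θ| * 1) (ε := η * |θ| * (L' * C))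
    (f := fun s => x θ s - x 0 s - θ • w s)
    (fun s hs => (hder s hs).continuousAt.continuousWithinAt)
    (fun s hs => (hder s (Ico_subset_Icc_self hs)).hasDerivWithinAt)
    (by rw [mul_one]; exact hθ0) (fun s hs => by
      have hs' := Ico_subset_Icc_self hs
      have hb := hball (y := x θ s - x 0 s)
        (by rw [dist_zero_right]; exact (hclose s hs').trans_lt hθs) s hs'
      rw [add_sub_cancel] at hb
      have e : f (x θ s) - f (x 0 s) - θ • fderiv ℝ f (x 0 s) (w s)
          = fderiv ℝ f (x 0 s) (x θ s - x 0 s - θ • w s)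
            + (f (x θ s) - f (x 0 s) - fderiv ℝ f (x 0 s) (x θ s - x 0 s)) := by
        rw [map_sub (fderiv ℝ f (x 0 s)) (x θ s - x 0 s), map_smul]
        abel
      rw [e]
      refine (norm_add_le _ _).trans (add_le_add ?_ (hb.trans ?_))
      · exact ((fderiv ℝ f (x 0 s)).le_opNorm _).trans
          (mul_le_mul_of_nonneg_right (hK s hs') (norm_nonneg _))
      · calc η * ‖x θ s - x 0 s‖ ≤ η * (L' * C * |θ|) :=
              mul_le_mul_of_nonneg_left (hclose s hs') hη0.le
          _ = η * |θ| * (L' * C) := by ring) σ ⟨hσ, le_rfl⟩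
  rw [gronwallBound_mul, sub_zero] at hgr
  refine hgr.trans ?_
  have h5 : η * G ≤ c := by
    rw [hη, div_mul_eq_mul_div, div_le_iff₀ (by positivity)]
    nlinarith
  calc η * |θ| * G = η * G * |θ| := by ring
    _ ≤ c * |θ| := mul_le_mul_of_nonneg_right h5 (abs_nonneg _)

/-- Time is shortened so that the central solution stays within half the radius of a ball inside V,
and r is chosen so that the Lipschitz dependence on the initial point costs at most the other half.
-/
theorem exists_local_flow [CompleteSpace E] {f : E → E} {x₁ : E} (hf : ContDiffAt ℝ 1 f x₁)
    {V : Set E} (hV : V ∈ 𝓝 x₁) :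
    ∃ (α : E → ℝ → E) (r ε L' : ℝ), 0 < r ∧ 0 < ε ∧ 0 ≤ L' ∧
      (∀ x ∈ Metric.ball x₁ r, α x 0 = x ∧ ∀ s ∈ Ioo (-ε) ε,
        HasDerivAt (α x) (f (α x s)) s ∧ α x s ∈ V) ∧
      ∀ x ∈ Metric.ball x₁ r, ∀ y ∈ Metric.ball x₁ r, ∀ s ∈ Ioo (-ε) ε,
        ‖α x s - α y s‖ ≤ L' * ‖x - y‖ := by
  obtain ⟨ε, hε, a, r, L, K, hr, hpl⟩ := IsPicardLindelof.of_contDiffAt_one hf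
  obtain ⟨α, hα, L', hL'⟩ := (hpl 0).exists_forall_mem_closedBall_eq_hasDerivWithinAt_lipschitzOnWith
  obtain ⟨a', ha', haV⟩ := Metric.mem_nhds_iff.1 hV
  have hmem : x₁ ∈ Metric.closedBall x₁ (r : ℝ) := Metric.mem_closedBall_self r.2
  have hI : Icc (0 - ε) (0 + ε) ∈ 𝓝 (0 : ℝ) := Icc_mem_nhds (by linarith) (by linarith)
  have hc : ContinuousAt (α x₁) 0 :=
    (((hα x₁ hmem).2 0 ⟨by linarith, by linarith⟩).hasDerivAt hI).continuousAt
  have hα0 : α x₁ 0 = x₁ := (hα x₁ hmem).1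
  obtain ⟨ε₁, hε₁, hball⟩ := Metric.continuousAt_iff.1 hc (a' / 2) (half_pos ha')
  rw [hα0] at hball
  set r' : ℝ := min r (a' / 2 / (L' + 1)) with hr'
  have hL0 : (0 : ℝ) ≤ L' := L'.2
  have hr'0 : 0 < r' := lt_min hr (by positivity)
  have hsub : ∀ x ∈ Metric.ball x₁ r', x ∈ Metric.closedBall x₁ (r : ℝ) := fun x hx =>
    Metric.ball_subset_closedBall (Metric.ball_subset_ball (min_le_left _ _) hx)
  have hIoo : ∀ s ∈ Ioo (-min ε ε₁) (min ε ε₁), s ∈ Ioo (0 - ε) (0 + ε) ∧ |s| < ε₁ := by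
    intro s hs
    have h1 := min_le_left ε ε₁
    have h2 := min_le_right ε ε₁
    exact ⟨⟨by linarith [hs.1], by linarith [hs.2]⟩,
      abs_lt.2 ⟨by linarith [hs.1], by linarith [hs.2]⟩⟩
  have hlip : ∀ x ∈ Metric.ball x₁ r', ∀ y ∈ Metric.ball x₁ r',
      ∀ s ∈ Ioo (-min ε ε₁) (min ε ε₁), ‖α x s - α y s‖ ≤ L' * ‖x - y‖ := by
    intro x hx y hy s hs
    have := (hL' s (Ioo_subset_Icc_self (hIoo s hs).1)).dist_le_mul x (hsub x hx) y (hsub y hy)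
    rwa [dist_eq_norm, dist_eq_norm] at this
  refine ⟨α, r', min ε ε₁, L', hr'0, lt_min hε hε₁, hL0, fun x hx => ⟨(hα x (hsub x hx)).1,
    fun s hs => ⟨?_, haV ?_⟩⟩, hlip⟩
  · exact ((hα x (hsub x hx)).2 s (Ioo_subset_Icc_self (hIoo s hs).1)).hasDerivAt
      (Icc_mem_nhds (hIoo s hs).1.1 (hIoo s hs).1.2)
  · have h1 := hlip x hx x₁ (Metric.mem_ball_self hr'0) s hs
    have h2 := hball (x := s) (by simpa using (hIoo s hs).2)
    rw [Metric.mem_ball, dist_eq_norm] at hx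
    rw [dist_eq_norm] at h2
    rw [Metric.mem_ball, dist_eq_norm]
    have h3 : L' * ‖x - x₁‖ < a' / 2 := by
      have h4 : ‖x - x₁‖ < a' / 2 / (L' + 1) := hx.trans_le (min_le_right _ _)
      rw [lt_div_iff₀ (by positivity)] at h4
      nlinarith [norm_nonneg (x - x₁)]
    have := norm_add_le (α x s - α x₁ s) (α x₁ s - x₁)
    rw [sub_add_sub_cancel] at this
    linarith

end Flat

/-- Forward propagation along an interval from local forward propagation. -/
theorem forward_induction {P : ℝ → Prop}
    (hP : ∀ t₁, ∃ ε > 0, ∀ t ∈ Ioo (t₁ - ε) (t₁ + ε), ∀ t' ∈ Ioo (t₁ - ε) (t₁ + ε),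
      t ≤ t' → P t → P t') {a b : ℝ} (hab : a ≤ b) (ha : P a) : P b := by
  have hclosed : Icc a b ⊆ {t | ∀ s ∈ Icc a t, P s} := by
    refine IsClosed.Icc_subset_of_forall_mem_nhdsWithin ?_ ?_ ?_
    · refine isClosed_of_closure_subset fun t ht => ?_
      have htI : t ∈ Icc a b := closure_minimal inter_subset_right isClosed_Icc ht
      refine ⟨fun s hs => ?_, htI⟩
      obtain ⟨ε, hε, hstep⟩ := hP t
      obtain ⟨t', ⟨ht', ht'I⟩, hd⟩ := Metric.mem_closure_iff.1 ht ε hε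
      rw [Real.dist_eq, abs_lt] at hd
      rcases le_or_gt s t' with h | h
      · exact ht' s ⟨hs.1, h⟩
      · exact hstep t' ⟨by linarith, by linarith⟩ s ⟨by linarith, by linarith [hs.2]⟩ h.le
          (ht' t' ⟨ht'I.1, le_rfl⟩)
    · intro s hs
      rwa [le_antisymm hs.2 hs.1]
    · rintro t ⟨ht, htI⟩
      obtain ⟨ε, hε, hstep⟩ := hP t
      filter_upwards [Ioo_mem_nhdsGT (show t < t + ε by linarith)] with t' ht' s hs
      rcases le_or_gt s t with h | h
      · exact ht s ⟨hs.1, h⟩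
      · exact hstep t ⟨by linarith, by linarith⟩ s ⟨by linarith, by linarith [hs.2, ht'.2]⟩ h.le
          (ht t ⟨htI.1, le_rfl⟩)
  exact hclosed ⟨hab, le_rfl⟩ b ⟨hab, le_rfl⟩

end ChartRep

/-! ### Propagating derivatives of families of integral curves on a manifold -/

namespace ChartRep

variable {E H N : Type*} [NormedAddCommGroup E] [NormedSpace ℝ E]
  [TopologicalSpace H] {I : ModelWithCorners ℝ E H} [TopologicalSpace N] [ChartedSpace H N]
  [IsManifold I 1 N]

theorem hasMFDerivAt_curve {γ : ℝ → N} {t : ℝ} {v : E} {q : N}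
    (h : HasMFDerivAt 𝓘(ℝ, ℝ) I γ t ((1 : ℝ →L[ℝ] ℝ).smulRight v :  ℝ →L[ℝ] E))
    (ht : γ t ∈ (extChartAt I q).source) :
    HasDerivAt (fun s => extChartAt I q (γ s)) (tangentCoordChange I (γ t) q (γ t) v) t := by
  have h1 := (hasMFDerivAt_extChartAt_tangentCoordChange ht).comp t h
  have h' : HasDerivAt (fun s => extChartAt I q (γ s))
      (tangentCoordChange I (γ t) q (γ t) ((1 : ℝ) • (show E from v))) t :=
    HasFDerivAt.hasDerivAt (f' := (tangentCoordChange I (γ t) q (γ t)).comp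
      ((1 : ℝ →L[ℝ] ℝ).smulRight (show E from v))) (HasMFDerivAt.hasFDerivAt h1)
  rwa [one_smul] at h'

theorem hasMFDerivAt_of_chart [I.Boundaryless] {γ : ℝ → N} {t : ℝ} {v : E} {q : N}
    (hc : ContinuousAt γ t) (ht : γ t ∈ (extChartAt I q).source)
    (h : HasDerivAt (fun s => extChartAt I q (γ s)) (tangentCoordChange I (γ t) q (γ t) v) t) :
    HasMFDerivAt 𝓘(ℝ, ℝ) I γ t ((1 : ℝ →L[ℝ] ℝ).smulRight v :  ℝ →L[ℝ] E) := by
  suffices hv : HasDerivAt (fun s => extChartAt I (γ t) (γ s)) v t by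
    refine ⟨hc, ?_⟩
    have h2 : HasFDerivWithinAt (fun s => extChartAt I (γ t) (γ s))
        ((1 : ℝ →L[ℝ] ℝ).smulRight v) (range 𝓘(ℝ, ℝ)) t := by
      have h3 := hv.hasFDerivAt.hasFDerivWithinAt (s := range 𝓘(ℝ, ℝ))
      convert! h3 using 1
    exact h2
  have hself : γ t ∈ (extChartAt I (γ t)).source := mem_extChartAt_source _
  have hv : v = tangentCoordChange I q (γ t) (γ t) (tangentCoordChange I (γ t) q (γ t) v) := by
    rw [tangentCoordChange_comp ⟨⟨hself, ht⟩, hself⟩, tangentCoordChange_self hself]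
  rw [hv]
  have h1 := hasFDerivWithinAt_tangentCoordChange (I := I) (x := q) (y := γ t) (z := γ t) ⟨ht, hself⟩
  rw [I.range_eq_univ, hasFDerivWithinAt_univ] at h1
  refine (h1.comp_hasDerivAt t h).congr_of_eventuallyEq ?_
  filter_upwards [hc.preimage_mem_nhds ((isOpen_extChartAt_source q).mem_nhds ht)] with s hs
  simp only [Function.comp]
  rw [(extChartAt I q).left_inv hs]

variable [CompleteSpace E] [I.Boundaryless] [T2Space N]

omit [CompleteSpace E] [T2Space N] in
theorem isMIntegralCurveOn_symm_comp {Y : (p : N) → TangentSpace I p} {q : N} {β : ℝ → E} {ε : ℝ}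
    (hβ : ∀ s ∈ Ioo (-ε) ε, HasDerivAt β (chartRep I q Y (β s)) s ∧ β s ∈ (extChartAt I q).target) :
    IsMIntegralCurveOn ((extChartAt I q).symm ∘ β) Y (Ioo (-ε) ε) := by
  intro s hs
  obtain ⟨hd, hm⟩ := hβ s hs
  refine HasMFDerivAt.hasMFDerivWithinAt ?_
  refine hasMFDerivAt_of_chart (q := q)
    (((contMDiffOn_extChartAt_symm (I := I) (n := 1) q).continuousOn.continuousAt
      ((isOpen_extChartAt_target q).mem_nhds hm)).comp hd.continuousAt)
    ((extChartAt I q).map_target hm) ?_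
  refine (hd.congr_deriv rfl).congr_of_eventuallyEq ?_
  filter_upwards [hd.continuousAt.preimage_mem_nhds
    ((isOpen_extChartAt_target q).mem_nhds hm)] with u hu
  exact (extChartAt I q).right_inv hu

omit [CompleteSpace E] in
theorem eqOn_chart_solution {Y : (p : N) → TangentSpace I p}
    (hY : ContMDiff I I.tangent 1 (fun p => (⟨p, Y p⟩ : TangentBundle I N)))
    {γ : ℝ → N} (hγ : IsMIntegralCurve γ Y) {q : N} {β : ℝ → E} {ε : ℝ} (hε : 0 < ε)
    (hβ : ∀ s ∈ Ioo (-ε) ε, HasDerivAt β (chartRep I q Y (β s)) s ∧ β s ∈ (extChartAt I q).target)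
    {t : ℝ} (h0 : (extChartAt I q).symm (β 0) = γ t) :
    ∀ s ∈ Ioo (-ε) ε, γ (s + t) = (extChartAt I q).symm (β s) := by
  have h1 := isMIntegralCurveOn_symm_comp hβ
  have h2 : IsMIntegralCurveOn (γ ∘ (· + t)) Y (Ioo (-ε) ε) :=
    (hγ.comp_add t).isMIntegralCurveOn _
  have h3 := isMIntegralCurveOn_Ioo_eqOn_of_contMDiff_boundaryless (t₀ := 0)
    ⟨by linarith, hε⟩ hY h2 h1
    (show γ (0 + t) = (extChartAt I q).symm (β 0) by rw [zero_add, h0])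
  exact fun s hs => h3 hs

/-- A field along an integral curve that solves the linearized equation in charts propagates the
derivative of a one parameter family of integral curves. -/
theorem hasMFDerivAt_family {Y : (p : N) → TangentSpace I p}
    (hY : ContMDiff I I.tangent 1 (fun p => (⟨p, Y p⟩ : TangentBundle I N)))
    {Φ : ℝ → ℝ → N} (hΦ : ∀ θ, IsMIntegralCurve (Φ θ) Y) {W : ℝ → E}
    (hW : ∀ t₁, ∀ᶠ t in 𝓝 t₁,
      HasDerivAt (fun s => tangentCoordChange I (Φ 0 s) (Φ 0 t₁) (Φ 0 s) (W s))
        (fderiv ℝ (chartRep I (Φ 0 t₁) Y) (extChartAt I (Φ 0 t₁) (Φ 0 t))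
          (tangentCoordChange I (Φ 0 t) (Φ 0 t₁) (Φ 0 t) (W t))) t)
    {a b : ℝ} (hab : a ≤ b)
    (h0 : HasMFDerivAt 𝓘(ℝ, ℝ) I (fun θ => Φ θ a) 0 ((1 : ℝ →L[ℝ] ℝ).smulRight (W a) :  ℝ →L[ℝ] E)) :
    HasMFDerivAt 𝓘(ℝ, ℝ) I (fun θ => Φ θ b) 0
      ((1 : ℝ →L[ℝ] ℝ).smulRight (W b) :  ℝ →L[ℝ] E) := by
  refine forward_induction (P := fun t => HasMFDerivAt 𝓘(ℝ, ℝ) I (fun θ => Φ θ t) 0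
    ((1 : ℝ →L[ℝ] ℝ).smulRight (W t) :  ℝ →L[ℝ] E)) (fun t₁ => ?_) hab h0
  -- Near t₁ everything is read in the chart at q. By uniqueness the curves Φ θ coincide there with
  -- a local flow of the coordinate field, to which the statement in the normed space applies.
  set q := Φ 0 t₁ with hq
  have hfq : ContDiffAt ℝ 1 (chartRep I q Y) (extChartAt I q q) := contDiffAt_chartRep (hY q)
  obtain ⟨α, r, ε, L', hr, hε, hL', hα, hlip⟩ := exists_local_flow hfq
    (Filter.inter_mem (extChartAt_target_mem_nhds (I := I) q) (hfq.eventually (by simp)))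
  have hcont : ContinuousAt (Φ 0) t₁ := (hΦ 0).continuous.continuousAt
  have hnear : ∀ᶠ t in 𝓝 t₁, Φ 0 t ∈ (extChartAt I q).source ∧
      extChartAt I q (Φ 0 t) ∈ Metric.ball (extChartAt I q q) r ∧
      HasDerivAt (fun s => tangentCoordChange I (Φ 0 s) q (Φ 0 s) (W s))
        (fderiv ℝ (chartRep I q Y) (extChartAt I q (Φ 0 t))
          (tangentCoordChange I (Φ 0 t) q (Φ 0 t) (W t))) t := by
    refine Filter.Eventually.and (hcont.preimage_mem_nhds (extChartAt_source_mem_nhds (I := I) q))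
      (Filter.Eventually.and ?_ (hW t₁))
    exact ((continuousAt_extChartAt (I := I) q).comp hcont).preimage_mem_nhds
      (Metric.ball_mem_nhds _ hr)
  obtain ⟨δ, hδ, hball⟩ := Metric.eventually_nhds_iff.1 hnear
  -- The bound ε/2 ensures t' - t < ε, so one use of the local flow covers the step.
  refine ⟨min δ (ε / 2), lt_min hδ (half_pos hε), fun t ht t' ht' htt' hD => ?_⟩
  have hm1 := min_le_left δ (ε / 2)
  have hm2 := min_le_right δ (ε / 2)
  have hballs : ∀ s ∈ Icc 0 (t' - t), dist (s + t) t₁ < δ := fun s hs => by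
    rw [Real.dist_eq, abs_lt]
    exact ⟨by linarith [hs.1, ht.1], by linarith [hs.2, ht'.2]⟩
  have hσ : t' - t < ε := by linarith [ht.1, ht'.2]
  have hIoo : ∀ s ∈ Icc 0 (t' - t), s ∈ Ioo (-ε) ε := fun s hs =>
    ⟨by linarith [hs.1], by linarith [hs.2]⟩
  obtain ⟨hts, htb, -⟩ := hball (y := t) (by simpa using hballs 0 ⟨le_rfl, by linarith⟩)
  have hcD : ContinuousAt (fun θ => Φ θ t) 0 := hD.continuousAt
  set x : ℝ → E := fun θ => extChartAt I q (Φ θ t) with hx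
  have hxd : HasDerivAt x (tangentCoordChange I (Φ 0 t) q (Φ 0 t) (W t)) 0 :=
    hasMFDerivAt_curve hD hts
  have hev : ∀ᶠ θ in 𝓝 (0 : ℝ), Φ θ t ∈ (extChartAt I q).source ∧
      x θ ∈ Metric.ball (extChartAt I q q) r :=
    Filter.Eventually.and (hcD.preimage_mem_nhds ((isOpen_extChartAt_source q).mem_nhds hts))
      (hxd.continuousAt.preimage_mem_nhds (Metric.isOpen_ball.mem_nhds htb))
  have hsol : ∀ θ, Φ θ t ∈ (extChartAt I q).source → x θ ∈ Metric.ball (extChartAt I q q) r →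
      ∀ s ∈ Ioo (-ε) ε, Φ θ (s + t) = (extChartAt I q).symm (α (x θ) s) := by
    intro θ h1 h2
    refine eqOn_chart_solution hY (hΦ θ) hε (fun s hs => ?_) ?_
    · exact ⟨((hα _ h2).2 s hs).1, ((hα _ h2).2 s hs).2.1⟩
    · rw [(hα _ h2).1, hx]
      exact (extChartAt I q).left_inv h1
  have hsolx : ∀ θ, Φ θ t ∈ (extChartAt I q).source → x θ ∈ Metric.ball (extChartAt I q q) r →
      ∀ s ∈ Ioo (-ε) ε, extChartAt I q (Φ θ (s + t)) = α (x θ) s := by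
    intro θ h1 h2 s hs
    rw [hsol θ h1 h2 s hs, (extChartAt I q).right_inv ((hα _ h2).2 s hs).2.1]
  have hmain := hasDerivAt_family (f := chartRep I q Y) (x := fun θ => α (x θ))
    (w := fun s => tangentCoordChange I (Φ 0 (s + t)) q (Φ 0 (s + t)) (W (s + t)))
    (σ := t' - t) (L' := L') (by linarith) hL'
    (fun s hs => ((hα _ htb).2 s (hIoo s hs)).2.2)
    (hev.mono fun θ hθ s hs => ((hα _ hθ.2).2 s (hIoo s hs)).1)
    (hev.mono fun θ hθ s hs => by
      have e0 : α (x 0) 0 = x 0 := (hα _ htb).1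
      simp only [(hα _ hθ.2).1, e0]
      exact hlip _ hθ.2 _ htb s (hIoo s hs))
    (fun s hs => by
      have h1 := (hball (hballs s hs)).2.2
      rw [hsolx 0 hts htb s (hIoo s hs)] at h1
      exact h1.comp_add_const s t)
    (by
      simp only [zero_add]
      refine hxd.congr_of_eventuallyEq ?_
      filter_upwards [hev] with θ hθ using (hα _ hθ.2).1)
  rw [sub_add_cancel] at hmain
  have hσI : t' - t ∈ Ioo (-ε) ε := hIoo _ ⟨by linarith, le_rfl⟩
  have hmem : α (x 0) (t' - t) ∈ (extChartAt I q).target := ((hα _ htb).2 _ hσI).2.1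
  have hΦt' : Φ 0 t' = (extChartAt I q).symm (α (x 0) (t' - t)) := by
    have := hsol 0 hts htb _ hσI
    rwa [sub_add_cancel] at this
  refine hasMFDerivAt_of_chart (q := q) ?_ ?_ ?_
  · have h1 : ContinuousAt (fun θ => (extChartAt I q).symm (α (x θ) (t' - t))) 0 :=
      ContinuousAt.comp (f := fun θ => α (x θ) (t' - t))
        ((contMDiffOn_extChartAt_symm (I := I) (n := 1) q).continuousOn.continuousAt
          ((isOpen_extChartAt_target q).mem_nhds hmem)) hmain.continuousAt
    refine h1.congr ?_
    filter_upwards [hev] with θ hθ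
    have := hsol θ hθ.1 hθ.2 _ hσI
    rw [sub_add_cancel] at this
    exact this.symm
  · rw [hΦt']
    exact (extChartAt I q).map_target hmem
  · refine hmain.congr_of_eventuallyEq ?_
    filter_upwards [hev] with θ hθ
    have := hsolx θ hθ.1 hθ.2 _ hσI
    rwa [sub_add_cancel] at this

end ChartRep

/-! ### Charts of the tangent bundle of a surface -/

namespace TangentChart

variable {M : Type*} [TopologicalSpace M] [ChartedSpace Plane M]

/-- The transition map between the preferred charts at `x` and `y`. -/
noncomputable def transition (x y : M) (u : Plane) : Plane :=
  extChartAt (𝓡 2) y ((extChartAt (𝓡 2) x).symm u)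

variable [IsManifold (𝓡 2) ∞ M]

theorem extChartAt_apply (p p' : TangentBundle (𝓡 2) M) :
    extChartAt (𝓡 2).tangent p p' = (extChartAt (𝓡 2) p.proj p'.proj,
      tangentCoordChange (𝓡 2) p'.proj p.proj p'.proj p'.snd) := by
  rfl

theorem extChartAt_source (p : TangentBundle (𝓡 2) M) :
    (extChartAt (𝓡 2).tangent p).source = {p' | p'.proj ∈ (extChartAt (𝓡 2) p.proj).source} := by
  ext p'
  rw [_root_.extChartAt_source, _root_.extChartAt_source]
  exact TangentBundle.mem_chart_source_iff p' p

theorem extChartAt_target (p : TangentBundle (𝓡 2) M) :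
    (extChartAt (𝓡 2).tangent p).target = (extChartAt (𝓡 2) p.proj).target ×ˢ univ := by
  have := FiberBundle.extChartAt_target (IB := 𝓡 2) (F := Plane)
    (E := fun x : M => TangentSpace (𝓡 2) x) p
  have hsub : (extChartAt (𝓡 2) p.proj).target ⊆ (extChartAt (𝓡 2) p.proj).symm ⁻¹'
      (trivializationAt Plane (fun x : M => TangentSpace (𝓡 2) x) p.proj).baseSet := fun z hz => by
    have h := (extChartAt (𝓡 2) p.proj).map_target hz
    rwa [_root_.extChartAt_source] at h
  rw [inter_eq_left.2 hsub] at this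
  exact this

theorem extChartAt_symm_apply (p : TangentBundle (𝓡 2) M) {z : Plane × Plane}
    (hz : z.1 ∈ (extChartAt (𝓡 2) p.proj).target) :
    (extChartAt (𝓡 2).tangent p).symm z = ⟨(extChartAt (𝓡 2) p.proj).symm z.1,
      tangentCoordChange (𝓡 2) p.proj ((extChartAt (𝓡 2) p.proj).symm z.1)
        ((extChartAt (𝓡 2) p.proj).symm z.1) z.2⟩ := by
  have hs := (extChartAt (𝓡 2) p.proj).map_target hz
  refine (extChartAt (𝓡 2).tangent p).injOn ?_ ?_ ?_
  · exact (extChartAt (𝓡 2).tangent p).map_target (by rw [extChartAt_target]; exact ⟨hz, trivial⟩)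
  · rw [extChartAt_source]; exact hs
  · rw [(extChartAt (𝓡 2).tangent p).right_inv (by rw [extChartAt_target]; exact ⟨hz, trivial⟩),
      extChartAt_apply]
    refine Prod.ext ((extChartAt (𝓡 2) p.proj).right_inv hz).symm ?_
    simp only
    rw [tangentCoordChange_comp ⟨⟨hs, mem_extChartAt_source _⟩, hs⟩, tangentCoordChange_self hs]

theorem contDiffAt_transition {x y : M} {u : Plane} (hu : u ∈ (extChartAt (𝓡 2) x).target)
    (hy : (extChartAt (𝓡 2) x).symm u ∈ (extChartAt (𝓡 2) y).source) :
    ContDiffAt ℝ ∞ (transition x y) u := by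
  have h1 : ContMDiffAt 𝓘(ℝ, Plane) (𝓡 2) ∞ (extChartAt (𝓡 2) x).symm u :=
    (contMDiffOn_extChartAt_symm x).contMDiffAt ((isOpen_extChartAt_target x).mem_nhds hu)
  have h2 : ContMDiffAt (𝓡 2) 𝓘(ℝ, Plane) ∞ (extChartAt (𝓡 2) y) ((extChartAt (𝓡 2) x).symm u) :=
    contMDiffAt_extChartAt' (by rwa [← _root_.extChartAt_source (𝓡 2)])
  exact (h2.comp u h1).contDiffAt

theorem tangentCoordChange_eq_fderiv {x y : M} {u : Plane} 
    (hu : u ∈ (extChartAt (𝓡 2) x).target) :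
    tangentCoordChange (𝓡 2) x y ((extChartAt (𝓡 2) x).symm u) = fderiv ℝ (transition x y) u := by
  rw [tangentCoordChange_def, (extChartAt (𝓡 2) x).right_inv hu,
    (𝓡 2).range_eq_univ, fderivWithin_univ]
  rfl

omit [IsManifold (𝓡 2) ∞ M] in
theorem det_fderiv_transition_pos [OrientedAtlas M] {x y : M} {u : Plane} 
    (hu : u ∈ (extChartAt (𝓡 2) x).target)
    (hy : (extChartAt (𝓡 2) x).symm u ∈ (extChartAt (𝓡 2) y).source) :
    0 < (fderiv ℝ (transition x y) u).det := by
  have hs := (extChartAt (𝓡 2) x).map_target hu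
  have h := OrientedAtlas.det_pos (chartAt Plane x) (chart_mem_atlas _ x) (chartAt Plane y)
    (chart_mem_atlas _ y) ((extChartAt (𝓡 2) x).symm u)
    ⟨by rwa [← _root_.extChartAt_source (𝓡 2)], by rwa [← _root_.extChartAt_source (𝓡 2)]⟩
  have e : chartAt Plane x ((extChartAt (𝓡 2) x).symm u) = u := (extChartAt (𝓡 2) x).right_inv hu
  rw [e] at h
  exact h

/-- Through this formula, covariance under `tangentLift` becomes independence of the chart of the
tangent bundle. -/
theorem extChartAt_comp_symm {p q : TangentBundle (𝓡 2) M} {z : Plane × Plane}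
    (hz : z.1 ∈ (extChartAt (𝓡 2) p.proj).target)
    (hq : (extChartAt (𝓡 2) p.proj).symm z.1 ∈ (extChartAt (𝓡 2) q.proj).source) :
    extChartAt (𝓡 2).tangent q ((extChartAt (𝓡 2).tangent p).symm z)
      = FlatFinsler.tangentLift (transition p.proj q.proj) z := by
  have hs := (extChartAt (𝓡 2) p.proj).map_target hz
  rw [extChartAt_symm_apply p hz, extChartAt_apply]
  refine Prod.ext rfl ?_
  simp only [FlatFinsler.tangentLift]
  rw [tangentCoordChange_comp ⟨⟨hs, mem_extChartAt_source _⟩, hq⟩, tangentCoordChange_eq_fderiv hz]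

omit [IsManifold (𝓡 2) ∞ M] in
theorem eventually_mem_overlap {x y : M} {z : Plane × Plane}
    (hz : z.1 ∈ (extChartAt (𝓡 2) x).target)
    (hq : (extChartAt (𝓡 2) x).symm z.1 ∈ (extChartAt (𝓡 2) y).source) :
    ∀ᶠ z' : Plane × Plane in 𝓝 z, z'.1 ∈ (extChartAt (𝓡 2) x).target ∧
      (extChartAt (𝓡 2) x).symm z'.1 ∈ (extChartAt (𝓡 2) y).source := by
  have h1 : ∀ᶠ u in 𝓝 z.1, u ∈ (extChartAt (𝓡 2) x).target :=
    (isOpen_extChartAt_target x).mem_nhds hz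
  have h2 : ∀ᶠ u in 𝓝 z.1, (extChartAt (𝓡 2) x).symm u ∈ (extChartAt (𝓡 2) y).source :=
    ((continuousOn_extChartAt_symm x).continuousAt ((isOpen_extChartAt_target x).mem_nhds hz))
      ((isOpen_extChartAt_source y).mem_nhds hq)
  exact continuousAt_fst (h1.and h2)

theorem tangentCoordChange_tangent {p q : TangentBundle (𝓡 2) M} {z : Plane × Plane}
    (hz : z.1 ∈ (extChartAt (𝓡 2) p.proj).target)
    (hq : (extChartAt (𝓡 2) p.proj).symm z.1 ∈ (extChartAt (𝓡 2) q.proj).source) :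
    tangentCoordChange (𝓡 2).tangent p q ((extChartAt (𝓡 2).tangent p).symm z)
      = fderiv ℝ (FlatFinsler.tangentLift (transition p.proj q.proj)) z := by
  have hz' : z ∈ (extChartAt (𝓡 2).tangent p).target := by
    rw [extChartAt_target]; exact ⟨hz, trivial⟩
  rw [tangentCoordChange_def, (extChartAt (𝓡 2).tangent p).right_inv hz',
    (𝓡 2).tangent.range_eq_univ, fderivWithin_univ]
  refine Filter.EventuallyEq.fderiv_eq ?_
  filter_upwards [eventually_mem_overlap hz hq] with z' h using extChartAt_comp_symm h.1 h.2

theorem tangentCoordChange_injective {x y z : M} (hx : z ∈ (extChartAt (𝓡 2) x).source)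
    (hy : z ∈ (extChartAt (𝓡 2) y).source) :
    Function.Injective (tangentCoordChange (𝓡 2) x y z) := by
  intro u v huv
  have := congrArg (tangentCoordChange (𝓡 2) y x z) huv
  rwa [tangentCoordChange_comp ⟨⟨hx, hy⟩, hx⟩, tangentCoordChange_comp ⟨⟨hx, hy⟩, hx⟩,
    tangentCoordChange_self hx, tangentCoordChange_self hx] at this

theorem extChartAt_self (p : TangentBundle (𝓡 2) M) :
    extChartAt (𝓡 2).tangent p p = (extChartAt (𝓡 2) p.proj p.proj, (p.snd : Plane)) :=
  Prod.ext rfl (tangentCoordChange_self (I := 𝓡 2) (v := (p.snd : Plane)) (mem_extChartAt_source p.proj))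

theorem extChartAt_symm_fiber (p : TangentBundle (𝓡 2) M) (ζ : Plane) :
    (extChartAt (𝓡 2).tangent p).symm (extChartAt (𝓡 2) p.proj p.proj, ζ) = ⟨p.proj, ζ⟩ := by
  refine (extChartAt (𝓡 2).tangent p).injOn ?_ ?_ ?_
  · exact (extChartAt (𝓡 2).tangent p).map_target
      (by rw [extChartAt_target]; exact ⟨mem_extChartAt_target _, trivial⟩)
  · rw [extChartAt_source]; exact mem_extChartAt_source p.proj
  · rw [(extChartAt (𝓡 2).tangent p).right_inv
      (by rw [extChartAt_target]; exact ⟨mem_extChartAt_target _, trivial⟩), extChartAt_apply,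
      tangentCoordChange_self (mem_extChartAt_source p.proj)]

/-- The image of the slit tangent bundle in the chart at `p`. -/
def slitTarget (p : TangentBundle (𝓡 2) M) : Set (Plane × Plane) :=
  {z | z.1 ∈ (extChartAt (𝓡 2) p.proj).target ∧ z.2 ≠ 0}

omit [IsManifold (𝓡 2) ∞ M] in
theorem isOpen_slitTarget (p : TangentBundle (𝓡 2) M) : IsOpen (slitTarget p) :=
  ((isOpen_extChartAt_target p.proj).preimage continuous_fst).inter
    (isOpen_compl_singleton.preimage continuous_snd)

theorem slitTarget_subset (p : TangentBundle (𝓡 2) M) :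
    slitTarget p ⊆ (extChartAt (𝓡 2).tangent p).target := fun z hz => by
  rw [extChartAt_target]; exact ⟨hz.1, trivial⟩

theorem extChartAt_symm_mem_slitBundle {p : TangentBundle (𝓡 2) M} {z : Plane × Plane}
    (hz : z ∈ slitTarget p) : (extChartAt (𝓡 2).tangent p).symm z ∈ slitBundle M := by
  have hs := (extChartAt (𝓡 2) p.proj).map_target hz.1
  rw [extChartAt_symm_apply p hz.1]
  intro h
  exact hz.2 (tangentCoordChange_injective hs (mem_extChartAt_source _)
    (h.trans (map_zero (tangentCoordChange (𝓡 2) _ _ _)).symm))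

theorem extChartAt_mem_slitTarget {p p' : TangentBundle (𝓡 2) M}
    (hp' : p' ∈ (extChartAt (𝓡 2).tangent p).source) (h : p' ∈ slitBundle M) :
    extChartAt (𝓡 2).tangent p p' ∈ slitTarget p := by
  rw [extChartAt_source] at hp'
  rw [extChartAt_apply]
  refine ⟨(extChartAt (𝓡 2) p.proj).map_source hp', fun h0 => h ?_⟩
  exact tangentCoordChange_injective (mem_extChartAt_source _) hp'
    (h0.trans (map_zero (tangentCoordChange (𝓡 2) _ _ _)).symm)

theorem isOpen_slitBundle : IsOpen (slitBundle M) := by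
  rw [isOpen_iff_mem_nhds]
  intro p hp
  have h1 : ∀ᶠ p' in 𝓝 p, extChartAt (𝓡 2).tangent p p' ∈ slitTarget p :=
    (continuousAt_extChartAt p).preimage_mem_nhds ((isOpen_slitTarget p).mem_nhds
      (extChartAt_mem_slitTarget (mem_extChartAt_source p) hp))
  filter_upwards [h1, extChartAt_source_mem_nhds (I := (𝓡 2).tangent) p] with p' h2 h3
  have := extChartAt_symm_mem_slitBundle h2
  rwa [(extChartAt (𝓡 2).tangent p).left_inv h3] at this

end TangentChart

/-! ### The Finsler energy in charts of the tangent bundle -/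

namespace FlatFinsler

theorem two_le_infty : (2 : ℕ∞ω) ≤ ∞ := WithTop.coe_le_coe.2 (le_top : (2 : ℕ∞) ≤ ⊤)

/-- The fundamental tensor of the metric differentiates within one fibre, while `flatG` takes the
full second derivative. The chain rule along ζ ↦ (x, ζ) identifies them on vertical directions. -/
theorem flatG_eq_fiber {L : Plane × Plane → ℝ} {U : Set (Plane × Plane)} (hU : IsOpen U)
    (hL : ContDiffOn ℝ ∞ L U) {z : Plane × Plane} (hz : z ∈ U) (u w : Plane) :
    fderiv ℝ (fun η : Plane => fderiv ℝ (fun ζ : Plane => L (z.1, ζ)) η u) z.2 w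
      = flatG L z u w := by
  have hpair : ∀ η : Plane, HasFDerivAt (fun ζ : Plane => (z.1, ζ))
      ((0 : Plane →L[ℝ] Plane).prod (ContinuousLinearMap.id ℝ Plane)) η := fun η =>
    (hasFDerivAt_const z.1 η).prodMk (hasFDerivAt_id η)
  have hev : (fun η : Plane => fderiv ℝ (fun ζ : Plane => L (z.1, ζ)) η u)
      =ᶠ[𝓝 z.2] fun η => fderiv ℝ L (z.1, η) (0, u) := by
    have h1 : ∀ᶠ η in 𝓝 z.2, (z.1, η) ∈ U :=
      (hpair z.2).continuousAt.preimage_mem_nhds (hU.mem_nhds hz)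
    filter_upwards [h1] with η hη
    have h2 : HasFDerivAt L (fderiv ℝ L (z.1, η)) (z.1, η) :=
      ((hL.contDiffAt (hU.mem_nhds hη)).differentiableAt (by simp)).hasFDerivAt
    have h3 : HasFDerivAt (fun ζ => L (z.1, ζ)) _ η := h2.comp η (hpair η)
    rw [h3.fderiv]
    simp
  rw [hev.fderiv_eq, flatG]
  have h3 : HasFDerivAt (fderiv ℝ L) (fderiv ℝ (fderiv ℝ L) z) (z.1, z.2) :=
    (((hL.fderiv_of_isOpen hU (m := ∞) (by simp)).contDiffAt (hU.mem_nhds hz)).differentiableAt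
      (by simp)).hasFDerivAt
  have h4 := (h3.comp z.2 (hpair z.2)).clm_apply (hasFDerivAt_const ((0, u) : Plane × Plane) z.2)
  have h5 : HasFDerivAt (fun η => fderiv ℝ L (z.1, η) (0, u)) _ z.2 := h4
  rw [h5.fderiv]
  simp

/-- The convexity axiom at x uses the preferred chart at x, whereas the chart at p identifies T_xM
with ℝ² differently. The two identifications differ by a linear map A. -/
theorem fderiv_fderiv_comp_clm {f : Plane → ℝ} {S : Set Plane} (hS : IsOpen S)
    (hf : ContDiffOn ℝ ∞ f S) (A : Plane →L[ℝ] Plane) {v : Plane} (hv : A v ∈ S) (u w : Plane) :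
    fderiv ℝ (fun η : Plane => fderiv ℝ (fun ζ : Plane => f (A ζ)) η u) v w
      = fderiv ℝ (fun η : Plane => fderiv ℝ f η (A u)) (A v) (A w) := by
  have hev : (fun η : Plane => fderiv ℝ (fun ζ : Plane => f (A ζ)) η u)
      =ᶠ[𝓝 v] fun η => fderiv ℝ f (A η) (A u) := by
    have h1 : ∀ᶠ η in 𝓝 v, A η ∈ S := A.continuous.continuousAt.preimage_mem_nhds (hS.mem_nhds hv)
    filter_upwards [h1] with η hη
    have h2 : HasFDerivAt f (fderiv ℝ f (A η)) (A η) :=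
      ((hf.contDiffAt (hS.mem_nhds hη)).differentiableAt (by simp)).hasFDerivAt
    have h3 : HasFDerivAt (fun ζ => f (A ζ)) _ η := h2.comp η A.hasFDerivAt
    rw [h3.fderiv]
    simp
  rw [hev.fderiv_eq]
  have h3 : DifferentiableAt ℝ (fun η => fderiv ℝ f η (A u)) (A v) :=
    (((hf.fderiv_of_isOpen hS (m := ∞) (by simp)).contDiffAt (hS.mem_nhds hv)).differentiableAt
      (by simp)).clm_apply (differentiableAt_const _)
  have h4 : HasFDerivAt (fun η => fderiv ℝ f (A η) (A u)) _ v :=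
    HasFDerivAt.comp (g := fun η => fderiv ℝ f η (A u)) v h3.hasFDerivAt A.hasFDerivAt
  rw [h4.fderiv]
  simp

end FlatFinsler

/-! ### The metric and the fields X, V, H in charts of the tangent bundle -/

namespace FinslerMetric

open FlatFinsler TangentChart ChartRep VectorField

variable {M : Type*} [TopologicalSpace M] [ChartedSpace Plane M] [IsManifold (𝓡 2) ∞ M]

theorem contDiffOn_comp_extChartAt_symm {f : TangentBundle (𝓡 2) M → ℝ}
    (hf : ContMDiffOn (𝓡 2).tangent 𝓘(ℝ, ℝ) ∞ f (slitBundle M)) (p : TangentBundle (𝓡 2) M) :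
    ContDiffOn ℝ ∞ (fun z => f ((extChartAt (𝓡 2).tangent p).symm z)) (slitTarget p) := by
  have h1 : ContMDiffOn 𝓘(ℝ, Plane × Plane) (𝓡 2).tangent ∞ (extChartAt (𝓡 2).tangent p).symm
      (slitTarget p) := (contMDiffOn_extChartAt_symm p).mono (slitTarget_subset p)
  exact (hf.comp h1 fun z hz => extChartAt_symm_mem_slitBundle hz).contDiffOn

variable (F : FinslerMetric M)

theorem contDiffOn_energyInChart (p : TangentBundle (𝓡 2) M) :
    ContDiffOn ℝ ∞ (F.energyInChart p) (slitTarget p) :=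
  ((contDiffOn_comp_extChartAt_symm F.smooth p).pow 2).div_const 2

theorem energyInChart_fiber (p : TangentBundle (𝓡 2) M) (ζ : Plane) :
    F.energyInChart p (extChartAt (𝓡 2) p.proj p.proj, ζ) = F.toFun ⟨p.proj, ζ⟩ ^ 2 / 2 := by
  rw [energyInChart, extChartAt_symm_fiber]

theorem extChartAt_self_mem_slitTarget {p : TangentBundle (𝓡 2) M} (hp : p ∈ slitBundle M) :
    extChartAt (𝓡 2).tangent p p ∈ slitTarget p :=
  extChartAt_mem_slitTarget (mem_extChartAt_source p) hp

theorem g_eq_flatG {p : TangentBundle (𝓡 2) M} (hp : p ∈ slitBundle M) (u w : Plane) :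
    F.g p u w = flatG (F.energyInChart p) (extChartAt (𝓡 2).tangent p p) u w := by
  rw [← flatG_eq_fiber (isOpen_slitTarget p) (F.contDiffOn_energyInChart p)
    (extChartAt_self_mem_slitTarget hp)]
  rw [extChartAt_self]
  simp only [energyInChart_fiber]
  rfl

theorem contDiffOn_fiber (x : M) :
    ContDiffOn ℝ ∞ (fun ζ : Plane => F.toFun ⟨x, ζ⟩ ^ 2 / 2) {ζ | ζ ≠ 0} := by
  have h := (F.contDiffOn_energyInChart ⟨x, 0⟩).comp
    (t := slitTarget ⟨x, (0 : Plane)⟩) (s := {ζ : Plane | ζ ≠ 0})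
    (g := F.energyInChart ⟨x, (0 : Plane)⟩)
    (f := fun ζ : Plane => (extChartAt (𝓡 2) x x, ζ)) (by fun_prop)
    fun ζ hζ => ⟨mem_extChartAt_target x, hζ⟩
  refine h.congr fun ζ _ => ?_
  exact (F.energyInChart_fiber ⟨x, (0 : Plane)⟩ ζ).symm

theorem energyInChart_eq (p : TangentBundle (𝓡 2) M) {z : Plane × Plane}
    (hz : z.1 ∈ (extChartAt (𝓡 2) p.proj).target) :
    F.energyInChart p z = F.toFun ⟨(extChartAt (𝓡 2) p.proj).symm z.1,
      tangentCoordChange (𝓡 2) p.proj ((extChartAt (𝓡 2) p.proj).symm z.1)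
        ((extChartAt (𝓡 2) p.proj).symm z.1) z.2⟩ ^ 2 / 2 := by
  rw [energyInChart, extChartAt_symm_apply p hz]

/-- Convexity is carried over from the preferred chart at each base point by an injective linear
map. Euler's relation is the derivative at c = 1 of the homogeneity L(x, cξ) = c² L(x, ξ). -/
theorem isEnergy (p : TangentBundle (𝓡 2) M) :
    IsEnergy (F.energyInChart p) (slitTarget p) where
  isOpen := isOpen_slitTarget p
  smooth := F.contDiffOn_energyInChart p
  ne_zero z hz := hz.2
  convex z hz u hu := by
    rw [← flatG_eq_fiber (isOpen_slitTarget p) (F.contDiffOn_energyInChart p) hz]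
    have hs := (extChartAt (𝓡 2) p.proj).map_target hz.1
    set x := (extChartAt (𝓡 2) p.proj).symm z.1 with hx
    set A : Plane →L[ℝ] Plane := tangentCoordChange (𝓡 2) p.proj x x with hA
    have hinj : ∀ v : Plane, v ≠ 0 → A v ≠ 0 := fun v hv h =>
      hv (tangentCoordChange_injective hs (mem_extChartAt_source _) (h.trans (map_zero A).symm))
    have e : (fun ζ : Plane => F.energyInChart p (z.1, ζ))
        = fun ζ => (fun ζ : Plane => F.toFun ⟨x, ζ⟩ ^ 2 / 2) (A ζ) := by
      funext ζ
      exact F.energyInChart_eq p (z := (z.1, ζ)) hz.1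
    rw [e, fderiv_fderiv_comp_clm isOpen_compl_singleton (F.contDiffOn_fiber x) A (hinj _ hz.2)]
    exact F.convex ⟨x, A z.2⟩ (hinj _ hz.2) (A u) (hinj u hu)
  euler z hz := by
    have h1 : HasFDerivAt (F.energyInChart p) (fderiv ℝ (F.energyInChart p) z) z :=
      (((F.contDiffOn_energyInChart p).contDiffAt ((isOpen_slitTarget p).mem_nhds
        hz)).differentiableAt (by simp)).hasFDerivAt
    have h2 : HasDerivAt (fun c : ℝ => (z.1, c • z.2)) ((0 : Plane), (1 : ℝ) • z.2) 1 :=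
      (hasDerivAt_const 1 z.1).prodMk ((hasDerivAt_id (1 : ℝ)).smul_const z.2)
    have h3 : HasDerivAt (fun c : ℝ => F.energyInChart p (z.1, c • z.2))
        (fderiv ℝ (F.energyInChart p) z ((0 : Plane), (1 : ℝ) • z.2)) 1 := by
      refine HasFDerivAt.comp_hasDerivAt (l := F.energyInChart p) 1 ?_ h2
      simpa using h1
    have h4 : HasDerivAt (fun c : ℝ => c ^ 2 * F.energyInChart p z)
        (2 * F.energyInChart p z) 1 := by
      simpa using ((hasDerivAt_id (1 : ℝ)).pow 2).mul_const (F.energyInChart p z)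
    rw [one_smul] at h3
    refine h3.unique (h4.congr_of_eventuallyEq ?_)
    filter_upwards [lt_mem_nhds zero_lt_one] with c hc
    rw [F.energyInChart_eq p hz.1, F.energyInChart_eq p (z := (z.1, c • z.2)) hz.1]
    simp only [map_smul]
    have := F.homogeneous ((extChartAt (𝓡 2) p.proj).symm z.1)
      (tangentCoordChange (𝓡 2) p.proj ((extChartAt (𝓡 2) p.proj).symm z.1)
        ((extChartAt (𝓡 2) p.proj).symm z.1) z.2) c hc.le
    rw [this]
    ring

theorem energyInChart_self (p : TangentBundle (𝓡 2) M) :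
    F.energyInChart p (extChartAt (𝓡 2).tangent p p) = F.toFun p ^ 2 / 2 := by
  rw [energyInChart, (extChartAt (𝓡 2).tangent p).left_inv (mem_extChartAt_source p)]

theorem gMatrix_eq {p : TangentBundle (𝓡 2) M} (hp : p ∈ slitBundle M) :
    F.gMatrix p = gMat (F.energyInChart p) (extChartAt (𝓡 2).tangent p p) := by
  ext i j
  exact F.g_eq_flatG hp _ _

theorem extChartAt_self_snd (p : TangentBundle (𝓡 2) M) :
    (extChartAt (𝓡 2).tangent p p).2 = (p.snd : Plane) := by
  rw [extChartAt_self]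

theorem rot_eq {p : TangentBundle (𝓡 2) M} (hp : p ∈ slitBundle M) :
    F.rot p = rotate (F.energyInChart p) (extChartAt (𝓡 2).tangent p p) := by
  have h (u : Plane) : F.g p (p.snd : Plane) u = _ := F.g_eq_flatG hp _ _
  rw [rot, rotate, F.gMatrix_eq hp, extChartAt_self_snd, ← h, ← h]

theorem geodesicAcceleration_eq {p : TangentBundle (𝓡 2) M} (hp : p ∈ slitBundle M) :
    F.geodesicAcceleration p = accel (F.energyInChart p) (extChartAt (𝓡 2).tangent p p) := by
  rw [geodesicAcceleration, accel, F.gMatrix_eq hp, extChartAt_self_snd]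
  congr 2
  funext l
  congr 1
  have h1 := ((F.isEnergy p).differentiableAt_fderiv (extChartAt_self_mem_slitTarget hp))
  rw [fderiv_clm_apply h1 (differentiableAt_const _)]
  simp

theorem fieldX_eq {p : TangentBundle (𝓡 2) M} (hp : p ∈ slitBundle M) :
    F.fieldX p = spray (F.energyInChart p) (extChartAt (𝓡 2).tangent p p) := by
  rw [fieldX, spray, F.geodesicAcceleration_eq hp, extChartAt_self_snd]

theorem fieldV_eq {p : TangentBundle (𝓡 2) M} (hp : p ∈ slitBundle M) :
    F.fieldV p = vert (F.energyInChart p) (extChartAt (𝓡 2).tangent p p) := by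
  rw [fieldV, vert, F.rot_eq hp]

theorem energyInChart_transition (p q : TangentBundle (𝓡 2) M) {z : Plane × Plane}
    (hz : z.1 ∈ (extChartAt (𝓡 2) p.proj).target)
    (hq : (extChartAt (𝓡 2) p.proj).symm z.1 ∈ (extChartAt (𝓡 2) q.proj).source) :
    F.energyInChart p =ᶠ[𝓝 z]
      fun z' => F.energyInChart q (tangentLift (transition p.proj q.proj) z') := by
  filter_upwards [eventually_mem_overlap hz hq] with z' h
  rw [← extChartAt_comp_symm h.1 h.2, energyInChart, energyInChart,
    (extChartAt (𝓡 2).tangent q).left_inv]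
  rw [TangentChart.extChartAt_source, extChartAt_symm_apply p h.1]
  exact h.2

section Fields

variable {F} [OrientedAtlas M] {p q : TangentBundle (𝓡 2) M}

/-- The field is defined at each point in the chart centred there. By covariance a single formula,
the spray of the energy, describes it throughout any one chart; this is what makes the pointwise
definition smooth. -/
theorem tangentCoordChange_fieldX (hp : p ∈ slitBundle M)
    (hq : p ∈ (extChartAt (𝓡 2).tangent q).source) :
    tangentCoordChange (𝓡 2).tangent p q p (F.fieldX p)
      = spray (F.energyInChart q) (extChartAt (𝓡 2).tangent q p) := by
  have hz := extChartAt_self_mem_slitTarget hp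
  have hs : (extChartAt (𝓡 2) p.proj).symm (extChartAt (𝓡 2).tangent p p).1
      ∈ (extChartAt (𝓡 2) q.proj).source := by
    rw [extChartAt_self, (extChartAt (𝓡 2) p.proj).left_inv (mem_extChartAt_source _)]
    rwa [TangentChart.extChartAt_source] at hq
  have e1 := tangentCoordChange_tangent hz.1 hs
  have e2 := extChartAt_comp_symm hz.1 hs
  rw [(extChartAt (𝓡 2).tangent p).left_inv (mem_extChartAt_source p)] at e1 e2
  rw [e1, e2, F.fieldX_eq hp]
  refine fderiv_tangentLift_spray (F.isEnergy p) hz (F.isEnergy q) ?_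
    ((contDiffAt_transition hz.1 hs).of_le two_le_infty)
    (F.energyInChart_transition p q hz.1 hs) (det_fderiv_transition_pos hz.1 hs)
  rw [← e2]
  exact extChartAt_mem_slitTarget hq hp

theorem tangentCoordChange_fieldV (hp : p ∈ slitBundle M)
    (hq : p ∈ (extChartAt (𝓡 2).tangent q).source) :
    tangentCoordChange (𝓡 2).tangent p q p (F.fieldV p)
      = vert (F.energyInChart q) (extChartAt (𝓡 2).tangent q p) := by
  have hz := extChartAt_self_mem_slitTarget hp
  have hs : (extChartAt (𝓡 2) p.proj).symm (extChartAt (𝓡 2).tangent p p).1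
      ∈ (extChartAt (𝓡 2) q.proj).source := by
    rw [extChartAt_self, (extChartAt (𝓡 2) p.proj).left_inv (mem_extChartAt_source _)]
    rwa [TangentChart.extChartAt_source] at hq
  have e1 := tangentCoordChange_tangent hz.1 hs
  have e2 := extChartAt_comp_symm hz.1 hs
  rw [(extChartAt (𝓡 2).tangent p).left_inv (mem_extChartAt_source p)] at e1 e2
  rw [e1, e2, F.fieldV_eq hp]
  refine fderiv_tangentLift_vert (F.isEnergy p) hz (F.isEnergy q) ?_
    ((contDiffAt_transition hz.1 hs).of_le two_le_infty)
    (F.energyInChart_transition p q hz.1 hs) (det_fderiv_transition_pos hz.1 hs)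
  rw [← e2]
  exact extChartAt_mem_slitTarget hq hp

omit [OrientedAtlas M] in
/-- A field is determined in a chart by its values there. -/
theorem chartRep_eq {Z : (p : TangentBundle (𝓡 2) M) → TangentSpace (𝓡 2).tangent p}
    {Z' : Plane × Plane → Plane × Plane}
    (h : ∀ p ∈ slitBundle M, p ∈ (extChartAt (𝓡 2).tangent q).source →
      tangentCoordChange (𝓡 2).tangent p q p (Z p) = Z' (extChartAt (𝓡 2).tangent q p))
    {z : Plane × Plane} (hz : z ∈ slitTarget q) : chartRep (𝓡 2).tangent q Z z = Z' z := by
  have hm := (extChartAt (𝓡 2).tangent q).map_target (slitTarget_subset q hz)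
  have := h _ (extChartAt_symm_mem_slitBundle hz) hm
  rwa [(extChartAt (𝓡 2).tangent q).right_inv (slitTarget_subset q hz)] at this

omit [OrientedAtlas M] in
theorem contMDiffAt_of_rep {Z : (p : TangentBundle (𝓡 2) M) → TangentSpace (𝓡 2).tangent p}
    {Z' : Plane × Plane → Plane × Plane} (hp : p ∈ slitBundle M)
    (h : ∀ p' ∈ slitBundle M, p' ∈ (extChartAt (𝓡 2).tangent p).source →
      tangentCoordChange (𝓡 2).tangent p' p p' (Z p') = Z' (extChartAt (𝓡 2).tangent p p'))
    (hZ' : ContDiffOn ℝ ∞ Z' (slitTarget p)) :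
    ContMDiffAt (𝓡 2).tangent (𝓡 2).tangent.tangent 1
      (fun p => (⟨p, Z p⟩ : TangentBundle (𝓡 2).tangent (TangentBundle (𝓡 2) M))) p := by
  have hmem := (isOpen_slitTarget p).mem_nhds (extChartAt_self_mem_slitTarget hp)
  have : IsManifold (𝓡 2).tangent (1 + 1) (TangentBundle (𝓡 2) M) :=
    IsManifold.of_le (n := ∞) (by rw [one_add_one_eq_two]; exact two_le_infty)
  refine contMDiffAt_of_chartRep (((hZ'.contDiffAt hmem).of_le (one_le_two.trans two_le_infty)).congr_of_eventuallyEq ?_)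
  filter_upwards [hmem] with z hz using chartRep_eq h hz

omit [OrientedAtlas M] in
theorem tangentCoordChange_mlieBracket_of_rep
    {Y Z : (p : TangentBundle (𝓡 2) M) → TangentSpace (𝓡 2).tangent p}
    {Y' Z' : TangentBundle (𝓡 2) M → Plane × Plane → Plane × Plane}
    (hY : ∀ q, ∀ p ∈ slitBundle M, p ∈ (extChartAt (𝓡 2).tangent q).source →
      tangentCoordChange (𝓡 2).tangent p q p (Y p) = Y' q (extChartAt (𝓡 2).tangent q p))
    (hY' : ∀ q, ContDiffOn ℝ ∞ (Y' q) (slitTarget q))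
    (hZ : ∀ q, ∀ p ∈ slitBundle M, p ∈ (extChartAt (𝓡 2).tangent q).source →
      tangentCoordChange (𝓡 2).tangent p q p (Z p) = Z' q (extChartAt (𝓡 2).tangent q p))
    (hZ' : ∀ q, ContDiffOn ℝ ∞ (Z' q) (slitTarget q))
    (hp : p ∈ slitBundle M) (hq : p ∈ (extChartAt (𝓡 2).tangent q).source) :
    tangentCoordChange (𝓡 2).tangent p q p (mlieBracket (𝓡 2).tangent Y Z p)
      = lieBracket ℝ (Y' q) (Z' q) (extChartAt (𝓡 2).tangent q p) := by
  have hmem := (isOpen_slitTarget q).mem_nhds (extChartAt_mem_slitTarget hq hp)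
  rw [tangentCoordChange_mlieBracket hq
    ((contMDiffAt_of_rep hp (hY p) (hY' p)).mdifferentiableAt one_ne_zero)
    ((contMDiffAt_of_rep hp (hZ p) (hZ' p)).mdifferentiableAt one_ne_zero)]
  refine Filter.EventuallyEq.lieBracket_vectorField_eq ?_ ?_
  · filter_upwards [hmem] with z hz using chartRep_eq (hY q) hz
  · filter_upwards [hmem] with z hz using chartRep_eq (hZ q) hz

theorem tangentCoordChange_fieldH (hp : p ∈ slitBundle M)
    (hq : p ∈ (extChartAt (𝓡 2).tangent q).source) :
    tangentCoordChange (𝓡 2).tangent p q p (F.fieldH p)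
      = horiz (F.energyInChart q) (extChartAt (𝓡 2).tangent q p) :=
  tangentCoordChange_mlieBracket_of_rep (Y' := fun q => vert (F.energyInChart q))
    (Z' := fun q => spray (F.energyInChart q))
    (fun _ _ => tangentCoordChange_fieldV) (fun q => (F.isEnergy q).contDiffOn_vert)
    (fun _ _ => tangentCoordChange_fieldX) (fun q => (F.isEnergy q).contDiffOn_spray) hp hq

theorem tangentCoordChange_bracket_horiz_vert (hp : p ∈ slitBundle M)
    (hq : p ∈ (extChartAt (𝓡 2).tangent q).source) :
    tangentCoordChange (𝓡 2).tangent p q p (mlieBracket (𝓡 2).tangent F.fieldH F.fieldV p)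
      = lieBracket ℝ (horiz (F.energyInChart q)) (vert (F.energyInChart q))
          (extChartAt (𝓡 2).tangent q p) :=
  tangentCoordChange_mlieBracket_of_rep (Y' := fun q => horiz (F.energyInChart q))
    (Z' := fun q => vert (F.energyInChart q))
    (fun _ _ => tangentCoordChange_fieldH) (fun q => (F.isEnergy q).contDiffOn_horiz)
    (fun _ _ => tangentCoordChange_fieldV) (fun q => (F.isEnergy q).contDiffOn_vert) hp hq

theorem tangentCoordChange_bracket_spray_horiz (hp : p ∈ slitBundle M)
    (hq : p ∈ (extChartAt (𝓡 2).tangent q).source) :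
    tangentCoordChange (𝓡 2).tangent p q p (mlieBracket (𝓡 2).tangent F.fieldX F.fieldH p)
      = lieBracket ℝ (spray (F.energyInChart q)) (horiz (F.energyInChart q))
          (extChartAt (𝓡 2).tangent q p) :=
  tangentCoordChange_mlieBracket_of_rep (Y' := fun q => spray (F.energyInChart q))
    (Z' := fun q => horiz (F.energyInChart q))
    (fun _ _ => tangentCoordChange_fieldX) (fun q => (F.isEnergy q).contDiffOn_spray)
    (fun _ _ => tangentCoordChange_fieldH) (fun q => (F.isEnergy q).contDiffOn_horiz) hp hq

end Fields

end FinslerMetric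

/-! ### The structure functions and the thermostat in charts -/

namespace FlatFinsler

open VectorField

/-- The generating field of the thermostat in coordinates. -/
noncomputable def thermo (L ℓ : Plane × Plane → ℝ) (z : Plane × Plane) : Plane × Plane :=
  spray L z + ℓ z • vert L z

/-- The structure function `I` in coordinates. -/
noncomputable def flatI (L : Plane × Plane → ℝ) (z : Plane × Plane) : ℝ :=
  coeff2 L z (lieBracket ℝ (horiz L) (vert L) z)

/-- The structure function `J` in coordinates. -/
noncomputable def flatJ (L : Plane × Plane → ℝ) (z : Plane × Plane) : ℝ :=
  coeff3 L z (lieBracket ℝ (horiz L) (vert L) z)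

/-- The structure function `K` in coordinates. -/
noncomputable def flatK (L : Plane × Plane → ℝ) (z : Plane × Plane) : ℝ :=
  coeff3 L z (lieBracket ℝ (spray L) (horiz L) z)

/-- The damping coefficient in coordinates. -/
noncomputable def flatDamping (L ℓ : Plane × Plane → ℝ) (z : Plane × Plane) : ℝ :=
  ℓ z * flatI L z + fderiv ℝ ℓ z (vert L z)

/-- The thermostat curvature in coordinates. -/
noncomputable def flatCurvature (L ℓ : Plane × Plane → ℝ) (z : Plane × Plane) : ℝ :=
  flatK L z - fderiv ℝ ℓ z (horiz L z) - ℓ z * flatJ L z + ℓ z ^ 2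
    + ℓ z * flatI L z * fderiv ℝ ℓ z (vert L z)
    - fderiv ℝ (fun q => ℓ q * flatI L q) z (thermo L ℓ z)

namespace IsEnergy

variable {L ℓ : Plane × Plane → ℝ} {U : Set (Plane × Plane)} {z : Plane × Plane}

/-- The coefficient functions are dual to the frame, so the scalars in a structure equation can be
read off in any chart. -/
theorem coeff1_frame (h : IsEnergy L U) (hz : z ∈ U) (a b c : ℝ) :
    coeff1 L z (a • spray L z + b • horiz L z + c • vert L z) = a := by
  have hL := h.energy_pos hz
  have e : (a • spray L z + b • horiz L z + c • vert L z).1 = a • z.2 + b • rotate L z := by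
    simp [spray, vert, h.horiz_eq hz]
  rw [coeff1, e, flatG_add_left, flatG_smul_left, flatG_smul_left, h.flatG_velocity_velocity hz,
    h.flatG_symm hz (rotate L z), flatG_velocity_rotate]
  field_simp
  ring

theorem coeff2_frame (h : IsEnergy L U) (hz : z ∈ U) (a b c : ℝ) :
    coeff2 L z (a • spray L z + b • horiz L z + c • vert L z) = b := by
  have hL := h.energy_pos hz
  have e : (a • spray L z + b • horiz L z + c • vert L z).1 = a • z.2 + b • rotate L z := by
    simp [spray, vert, h.horiz_eq hz]
  rw [coeff2, e, flatG_add_left, flatG_smul_left, flatG_smul_left, h.flatG_rotate_rotate hz,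
    flatG_velocity_rotate]
  field_simp
  ring

theorem coeff3_frame (h : IsEnergy L U) (hz : z ∈ U) (a b c : ℝ) :
    coeff3 L z (a • spray L z + b • horiz L z + c • vert L z) = c := by
  have hL := h.energy_pos hz
  rw [coeff3, h.coeff1_frame hz, h.coeff2_frame hz]
  have e : (a • spray L z + b • horiz L z + c • vert L z - a • spray L z - b • horiz L z).2
      = c • rotate L z := by
    simp only [vert, Prod.snd_add, Prod.snd_sub, Prod.smul_snd]
    abel
  rw [e, flatG_smul_left, h.flatG_rotate_rotate hz]
  field_simp

theorem contDiffOn_flatI (h : IsEnergy L U) : ContDiffOn ℝ ∞ (flatI L) U :=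
  h.contDiffOn_coeff2 (h.contDiffOn_lieBracket h.contDiffOn_horiz h.contDiffOn_vert)

theorem contDiffOn_flatJ (h : IsEnergy L U) : ContDiffOn ℝ ∞ (flatJ L) U :=
  h.contDiffOn_coeff3 (h.contDiffOn_lieBracket h.contDiffOn_horiz h.contDiffOn_vert)

theorem contDiffOn_flatK (h : IsEnergy L U) : ContDiffOn ℝ ∞ (flatK L) U :=
  h.contDiffOn_coeff3 (h.contDiffOn_lieBracket h.contDiffOn_spray h.contDiffOn_horiz)

theorem contDiffOn_thermo (h : IsEnergy L U) (hℓ : ContDiffOn ℝ ∞ ℓ U) :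
    ContDiffOn ℝ ∞ (thermo L ℓ) U :=
  h.contDiffOn_spray.add (hℓ.smul h.contDiffOn_vert)

theorem continuousOn_fderiv_apply (h : IsEnergy L U) (hℓ : ContDiffOn ℝ ∞ ℓ U)
    {Z : Plane × Plane → Plane × Plane} (hZ : ContDiffOn ℝ ∞ Z U) :
    ContinuousOn (fun z => fderiv ℝ ℓ z (Z z)) U :=
  ((hℓ.fderiv_of_isOpen (m := ∞) h.isOpen (by simp)).continuousOn).clm_apply hZ.continuousOn

theorem continuousOn_flatDamping (h : IsEnergy L U) (hℓ : ContDiffOn ℝ ∞ ℓ U) :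
    ContinuousOn (flatDamping L ℓ) U :=
  (hℓ.continuousOn.mul h.contDiffOn_flatI.continuousOn).add
    (h.continuousOn_fderiv_apply hℓ h.contDiffOn_vert)

theorem continuousOn_flatCurvature (h : IsEnergy L U) (hℓ : ContDiffOn ℝ ∞ ℓ U) :
    ContinuousOn (flatCurvature L ℓ) U :=
  ((((h.contDiffOn_flatK.continuousOn.sub
    (h.continuousOn_fderiv_apply hℓ h.contDiffOn_horiz)).sub
    (hℓ.continuousOn.mul h.contDiffOn_flatJ.continuousOn)).add (hℓ.continuousOn.pow 2)).add
    ((hℓ.continuousOn.mul h.contDiffOn_flatI.continuousOn).mul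
      (h.continuousOn_fderiv_apply hℓ h.contDiffOn_vert))).sub
    (h.continuousOn_fderiv_apply (hℓ.mul h.contDiffOn_flatI) (h.contDiffOn_thermo hℓ))

theorem energy_thermo (h : IsEnergy L U) (hz : z ∈ U) : fderiv ℝ L z (thermo L ℓ z) = 0 := by
  rw [thermo, map_add, map_smul, h.energy_spray hz, h.energy_vert hz]
  simp

theorem fderiv_thermo (h : IsEnergy L U) (hℓ : ContDiffOn ℝ ∞ ℓ U) (hz : z ∈ U)
    (v : Plane × Plane) : fderiv ℝ (thermo L ℓ) z v
      = fderiv ℝ (spray L) z v + (ℓ z • fderiv ℝ (vert L) z v + fderiv ℝ ℓ z v • vert L z) := by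
  have h1 := (h.diffAt hz h.contDiffOn_spray).hasFDerivAt.add
    ((h.diffAt hz hℓ).hasFDerivAt.smul (h.diffAt hz h.contDiffOn_vert).hasFDerivAt)
  have h2 : HasFDerivAt (thermo L ℓ) _ z := h1
  rw [h2.fderiv]
  simp

/-- The left side is [𝐅, V] written out. Since [V, V] = 0, the term λV contributes only through the
derivative of λ. -/
theorem thermo_bracket_vert (h : IsEnergy L U) (hℓ : ContDiffOn ℝ ∞ ℓ U) (hz : z ∈ U) :
    fderiv ℝ (vert L) z (thermo L ℓ z) - fderiv ℝ (thermo L ℓ) z (vert L z)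
      = -horiz L z - fderiv ℝ ℓ z (vert L z) • vert L z := by
  rw [h.fderiv_thermo hℓ hz, thermo, map_add, map_smul, horiz, lieBracket]
  abel

/-- The left side is [𝐅, H] = [X, H] + λ[V, H] - H(λ)V, with the structure equations inserted. -/
theorem thermo_bracket_horiz (h : IsEnergy L U) (hℓ : ContDiffOn ℝ ∞ ℓ U) (hz : z ∈ U) :
    fderiv ℝ (horiz L) z (thermo L ℓ z) - fderiv ℝ (thermo L ℓ) z (horiz L z)
      = flatK L z • vert L z
        - ℓ z • (spray L z + flatI L z • horiz L z + flatJ L z • vert L z)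
        - fderiv ℝ ℓ z (horiz L z) • vert L z := by
  have e1 := h.lieBracket_horiz_vert hz
  have e2 := h.lieBracket_spray_horiz hz
  rw [flatI, flatJ, flatK, ← e1, ← e2, h.fderiv_thermo hℓ hz, thermo, map_add, map_smul,
    lieBracket, lieBracket]
  simp only [smul_sub]
  abel

/-- The linearization of the thermostat flow in the frame `(𝐅, H, V)`. -/
theorem hasDerivAt_linearized (h : IsEnergy L U) (hℓ : ContDiffOn ℝ ∞ ℓ U)
    {β : ℝ → Plane × Plane} {t : ℝ} (hβt : β t ∈ U) (hβ : HasDerivAt β (thermo L ℓ (β t)) t)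
    {a y w : ℝ → ℝ} (ha : HasDerivAt a (ℓ (β t) * y t) t) (hy : HasDerivAt y (w t) t)
    (hw : HasDerivAt w (flatDamping L ℓ (β t) * w t - flatCurvature L ℓ (β t) * y t) t) :
    HasDerivAt (fun s => a s • thermo L ℓ (β s) + y s • horiz L (β s)
        + (w s - (ℓ (β s) * flatI L (β s)) * y s) • vert L (β s))
      (fderiv ℝ (thermo L ℓ) (β t) (a t • thermo L ℓ (β t) + y t • horiz L (β t)
        + (w t - (ℓ (β t) * flatI L (β t)) * y t) • vert L (β t))) t := by
  have hF := (h.diffAt hβt (h.contDiffOn_thermo hℓ)).hasFDerivAt.comp_hasDerivAt t hβ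
  have hH := (h.diffAt hβt h.contDiffOn_horiz).hasFDerivAt.comp_hasDerivAt t hβ
  have hV := (h.diffAt hβt h.contDiffOn_vert).hasFDerivAt.comp_hasDerivAt t hβ
  have hI : HasDerivAt (fun s => ℓ (β s) * flatI L (β s)) _ t :=
    HasFDerivAt.comp_hasDerivAt (l := fun q => ℓ q * flatI L q) t
      (h.diffAt hβt (hℓ.mul h.contDiffOn_flatI)).hasFDerivAt hβ
  have key := ((ha.smul hF).add (hy.smul hH)).add ((hw.sub (hI.mul hy)).smul hV)
  refine key.congr_deriv ?_
  have bV := h.thermo_bracket_vert hℓ hβt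
  have bH := h.thermo_bracket_horiz hℓ hβt
  simp only [Function.comp_apply, map_add, map_smul]
  rw [sub_eq_iff_eq_add] at bV bH
  rw [bV, bH]
  -- Substituting X = 𝐅 - λV in [𝐅, H] separates the components. The 𝐅-part is a' = λy; the H-part
  -- is y' = w, which is the purpose of the shift by -λIy; the V-part is w' = d w - k y, and the λ²
  -- in the curvature comes from this substitution.
  have e : spray L (β t) = thermo L ℓ (β t) - ℓ (β t) • vert L (β t) := by simp [thermo]
  rw [e, flatDamping, flatCurvature]
  simp only [Pi.sub_apply, Pi.mul_apply]
  module

end IsEnergy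

end FlatFinsler

/-! ### Chart independence of I, J, K and continuity of the Riccati coefficients -/

namespace FinslerMetric

open FlatFinsler TangentChart ChartRep VectorField

variable {M : Type*} [TopologicalSpace M] [ChartedSpace Plane M] [IsManifold (𝓡 2) ∞ M]
  {F : FinslerMetric M} {p q : TangentBundle (𝓡 2) M}

theorem tangentCoordChange_self_tangent (v : Plane × Plane) :
    tangentCoordChange (𝓡 2).tangent p p p v = v :=
  tangentCoordChange_self (mem_extChartAt_source p)

theorem toFun_sq (F : FinslerMetric M) (p : TangentBundle (𝓡 2) M) :
    F.toFun p ^ 2 = 2 * F.energyInChart p (extChartAt (𝓡 2).tangent p p) := by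
  rw [energyInChart_self]; ring

theorem omega1_eq (hp : p ∈ slitBundle M) (Z : TangentSpace (𝓡 2).tangent p) :
    F.omega1 p Z = coeff1 (F.energyInChart p) (extChartAt (𝓡 2).tangent p p) Z := by
  have h : F.g p (base p Z) (p.snd : Plane) / F.toFun p ^ 2 = _ :=
    congrArg₂ _ (F.g_eq_flatG hp _ _) (toFun_sq F p)
  exact h.trans (by rw [← extChartAt_self_snd]; rfl)

theorem omega2_eq (hp : p ∈ slitBundle M) (Z : TangentSpace (𝓡 2).tangent p) :
    F.omega2 p Z = coeff2 (F.energyInChart p) (extChartAt (𝓡 2).tangent p p) Z := by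
  have h : F.g p (base p Z) (F.rot p) / F.toFun p ^ 2 = _ :=
    congrArg₂ _ (F.g_eq_flatG hp _ _) (toFun_sq F p)
  exact h.trans (by rw [F.rot_eq hp]; rfl)

variable [OrientedAtlas M]

theorem fieldH_eq (hp : p ∈ slitBundle M) :
    F.fieldH p = horiz (F.energyInChart p) (extChartAt (𝓡 2).tangent p p) := by
  rw [← tangentCoordChange_fieldH hp (mem_extChartAt_source p)]
  exact (tangentCoordChange_self_tangent _).symm

theorem omega3_eq (hp : p ∈ slitBundle M) (Z : TangentSpace (𝓡 2).tangent p) :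
    F.omega3 p Z = coeff3 (F.energyInChart p) (extChartAt (𝓡 2).tangent p p) Z := by
  have h : F.g p (vertical p (Z - F.omega1 p Z • F.fieldX p - F.omega2 p Z • F.fieldH p))
      (F.rot p) / F.toFun p ^ 2 = _ := congrArg₂ _ (F.g_eq_flatG hp _ _) (toFun_sq F p)
  exact h.trans (by
    rw [F.rot_eq hp, omega1_eq hp, omega2_eq hp, F.fieldX_eq hp, fieldH_eq hp]; rfl)

theorem bracket_horiz_vert_center (hp : p ∈ slitBundle M) :
    mlieBracket (𝓡 2).tangent F.fieldH F.fieldV p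
      = lieBracket ℝ (horiz (F.energyInChart p)) (vert (F.energyInChart p))
          (extChartAt (𝓡 2).tangent p p) := by
  rw [← tangentCoordChange_bracket_horiz_vert hp (mem_extChartAt_source p)]
  exact (tangentCoordChange_self_tangent _).symm

theorem bracket_spray_horiz_center (hp : p ∈ slitBundle M) :
    mlieBracket (𝓡 2).tangent F.fieldX F.fieldH p
      = lieBracket ℝ (spray (F.energyInChart p)) (horiz (F.energyInChart p))
          (extChartAt (𝓡 2).tangent p p) := by
  rw [← tangentCoordChange_bracket_spray_horiz hp (mem_extChartAt_source p)]
  exact (tangentCoordChange_self_tangent _).symm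

/-- I and J are read at p in the chart centred there. The coordinate change is linear on the tangent
space and respects the frame and the bracket, so it carries the structure equation to the chart at q
with the same scalars. -/
theorem bracket_horiz_vert_eq (hp : p ∈ slitBundle M)
    (hq : p ∈ (extChartAt (𝓡 2).tangent q).source) :
    lieBracket ℝ (horiz (F.energyInChart q)) (vert (F.energyInChart q))
        (extChartAt (𝓡 2).tangent q p)
      = (1 : ℝ) • spray (F.energyInChart q) (extChartAt (𝓡 2).tangent q p)
        + F.mainScalar p • horiz (F.energyInChart q) (extChartAt (𝓡 2).tangent q p)
        + F.scalarJ p • vert (F.energyInChart q) (extChartAt (𝓡 2).tangent q p) := by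
  have h1 := (F.isEnergy p).lieBracket_horiz_vert (extChartAt_self_mem_slitTarget hp)
  rw [← tangentCoordChange_bracket_horiz_vert hp hq, ← tangentCoordChange_fieldX hp hq,
    ← tangentCoordChange_fieldH hp hq, ← tangentCoordChange_fieldV hp hq]
  have h2 : mlieBracket (𝓡 2).tangent F.fieldH F.fieldV p
      = ((F.fieldX p + F.mainScalar p • F.fieldH p + F.scalarJ p • F.fieldV p :
        TangentSpace (𝓡 2).tangent p)) := by
    have e2 : F.mainScalar p = _ := omega2_eq hp _
    have e3 : F.scalarJ p = _ := omega3_eq hp _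
    rw [e2, e3, bracket_horiz_vert_center hp, F.fieldX_eq hp, fieldH_eq hp, F.fieldV_eq hp]
    exact h1
  rw [h2, one_smul]
  exact ((map_add (tangentCoordChange (𝓡 2).tangent p q p) _ _).trans
    (congrArg₂ _ ((map_add (tangentCoordChange (𝓡 2).tangent p q p) _ _).trans
      (congrArg₂ _ rfl (map_smul (tangentCoordChange (𝓡 2).tangent p q p) _ _)))
      (map_smul (tangentCoordChange (𝓡 2).tangent p q p) _ _)))

theorem bracket_spray_horiz_eq (hp : p ∈ slitBundle M)
    (hq : p ∈ (extChartAt (𝓡 2).tangent q).source) :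
    lieBracket ℝ (spray (F.energyInChart q)) (horiz (F.energyInChart q))
        (extChartAt (𝓡 2).tangent q p)
      = F.curvature p • vert (F.energyInChart q) (extChartAt (𝓡 2).tangent q p) := by
  have h1 := (F.isEnergy p).lieBracket_spray_horiz (extChartAt_self_mem_slitTarget hp)
  rw [← tangentCoordChange_bracket_spray_horiz hp hq, ← tangentCoordChange_fieldV hp hq]
  have h2 : mlieBracket (𝓡 2).tangent F.fieldX F.fieldH p
      = (F.curvature p • F.fieldV p : TangentSpace (𝓡 2).tangent p) := by
    have e3 : F.curvature p = _ := omega3_eq hp _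
    rw [e3, bracket_spray_horiz_center hp, F.fieldV_eq hp]
    exact h1
  rw [h2]
  exact map_smul (tangentCoordChange (𝓡 2).tangent p q p) _ _

theorem mainScalar_eq (hp : p ∈ slitBundle M) (hq : p ∈ (extChartAt (𝓡 2).tangent q).source) :
    F.mainScalar p = flatI (F.energyInChart q) (extChartAt (𝓡 2).tangent q p) := by
  rw [flatI, bracket_horiz_vert_eq hp hq,
    (F.isEnergy q).coeff2_frame (extChartAt_mem_slitTarget hq hp)]

theorem scalarJ_eq (hp : p ∈ slitBundle M) (hq : p ∈ (extChartAt (𝓡 2).tangent q).source) :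
    F.scalarJ p = flatJ (F.energyInChart q) (extChartAt (𝓡 2).tangent q p) := by
  rw [flatJ, bracket_horiz_vert_eq hp hq,
    (F.isEnergy q).coeff3_frame (extChartAt_mem_slitTarget hq hp)]

theorem curvature_eq (hp : p ∈ slitBundle M) (hq : p ∈ (extChartAt (𝓡 2).tangent q).source) :
    F.curvature p = flatK (F.energyInChart q) (extChartAt (𝓡 2).tangent q p) := by
  have := (F.isEnergy q).coeff3_frame (extChartAt_mem_slitTarget hq hp) 0 0 (F.curvature p)
  rw [flatK, bracket_spray_horiz_eq hp hq]
  simpa using this.symm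

omit [OrientedAtlas M] in
theorem derivAlong_eq {Z : (p : TangentBundle (𝓡 2) M) → TangentSpace (𝓡 2).tangent p}
    {f : TangentBundle (𝓡 2) M → ℝ} {f' : Plane × Plane → ℝ}
    (hp : p ∈ slitBundle M) (hq : p ∈ (extChartAt (𝓡 2).tangent q).source)
    (hf : ∀ p' ∈ slitBundle M, p' ∈ (extChartAt (𝓡 2).tangent q).source →
      f p' = f' (extChartAt (𝓡 2).tangent q p'))
    (hf' : ContDiffOn ℝ ∞ f' (slitTarget q)) :
    derivAlong Z f p = fderiv ℝ f' (extChartAt (𝓡 2).tangent q p)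
      (tangentCoordChange (𝓡 2).tangent p q p (Z p)) := by
  have h1 := ((hf'.contDiffAt ((isOpen_slitTarget q).mem_nhds
    (extChartAt_mem_slitTarget hq hp))).differentiableAt (by simp)).hasFDerivAt.hasMFDerivAt
  have h2 := h1.comp p (hasMFDerivAt_extChartAt_tangentCoordChange hq)
  have h3 : f =ᶠ[𝓝 p] f' ∘ extChartAt (𝓡 2).tangent q := by
    filter_upwards [isOpen_slitBundle.mem_nhds hp,
      (isOpen_extChartAt_source (I := (𝓡 2).tangent) q).mem_nhds hq] with p' h4 h5 using hf p' h4 h5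
  rw [derivAlong, (h2.congr_of_eventuallyEq h3).mfderiv]
  rfl

/-- A function on the tangent bundle in the chart at `q`. -/
noncomputable def inChart (f : TangentBundle (𝓡 2) M → ℝ) (q : TangentBundle (𝓡 2) M)
    (z : Plane × Plane) : ℝ := f ((extChartAt (𝓡 2).tangent q).symm z)

omit [OrientedAtlas M] in
theorem inChart_extChartAt (f : TangentBundle (𝓡 2) M → ℝ)
    (hq : p ∈ (extChartAt (𝓡 2).tangent q).source) :
    f p = inChart f q (extChartAt (𝓡 2).tangent q p) := by
  rw [inChart, (extChartAt (𝓡 2).tangent q).left_inv hq]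

variable {lam : TangentBundle (𝓡 2) M → ℝ}

theorem tangentCoordChange_thermostatField (hp : p ∈ slitBundle M)
    (hq : p ∈ (extChartAt (𝓡 2).tangent q).source) :
    tangentCoordChange (𝓡 2).tangent p q p (F.thermostatField lam p)
      = thermo (F.energyInChart q) (inChart lam q) (extChartAt (𝓡 2).tangent q p) := by
  rw [thermo, ← inChart_extChartAt lam hq, ← tangentCoordChange_fieldX hp hq,
    ← tangentCoordChange_fieldV hp hq, thermostatField]
  exact (map_add (tangentCoordChange (𝓡 2).tangent p q p) _ _).trans
    (congrArg₂ _ rfl (map_smul (tangentCoordChange (𝓡 2).tangent p q p) _ _))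

variable (hlam : ContMDiffOn (𝓡 2).tangent 𝓘(ℝ, ℝ) ∞ lam (slitBundle M))
include hlam

theorem dampingCoeff_eq (hp : p ∈ slitBundle M) (hq : p ∈ (extChartAt (𝓡 2).tangent q).source) :
    F.dampingCoeff lam p
      = flatDamping (F.energyInChart q) (inChart lam q) (extChartAt (𝓡 2).tangent q p) := by
  rw [dampingCoeff, flatDamping, ← inChart_extChartAt lam hq, mainScalar_eq hp hq,
    derivAlong_eq hp hq (fun p' _ h => inChart_extChartAt lam h)
      (contDiffOn_comp_extChartAt_symm hlam q), tangentCoordChange_fieldV hp hq]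

theorem thermostatCurvature_eq (hp : p ∈ slitBundle M)
    (hq : p ∈ (extChartAt (𝓡 2).tangent q).source) :
    F.thermostatCurvature lam p
      = flatCurvature (F.energyInChart q) (inChart lam q) (extChartAt (𝓡 2).tangent q p) := by
  have hl := contDiffOn_comp_extChartAt_symm hlam q
  have e (Z) := derivAlong_eq (Z := Z) hp hq (fun p' _ h => inChart_extChartAt lam h) hl
  have e2 := derivAlong_eq (Z := F.thermostatField lam)
    (f := fun q => lam q * F.mainScalar q) hp hq
    (f' := fun z => inChart lam q z * flatI (F.energyInChart q) z)
    (fun p' h0 h => by rw [← inChart_extChartAt lam h, mainScalar_eq h0 h])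
    (hl.mul (F.isEnergy q).contDiffOn_flatI)
  rw [thermostatCurvature, flatCurvature, e, e, e2, ← inChart_extChartAt lam hq,
    mainScalar_eq hp hq, scalarJ_eq hp hq, curvature_eq hp hq, tangentCoordChange_fieldV hp hq,
    tangentCoordChange_fieldH hp hq, tangentCoordChange_thermostatField hp hq]

omit hlam [OrientedAtlas M] in
theorem continuousAt_of_chart {f : TangentBundle (𝓡 2) M → ℝ} {f' : Plane × Plane → ℝ}
    (hp : p ∈ slitBundle M)
    (hf : ∀ p' ∈ slitBundle M, p' ∈ (extChartAt (𝓡 2).tangent p).source →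
      f p' = f' (extChartAt (𝓡 2).tangent p p'))
    (hf' : ContinuousOn f' (slitTarget p)) : ContinuousAt f p := by
  have h1 : ContinuousAt (fun p' => f' (extChartAt (𝓡 2).tangent p p')) p :=
    ContinuousAt.comp (hf'.continuousAt
      ((isOpen_slitTarget p).mem_nhds (extChartAt_self_mem_slitTarget hp)))
      (continuousAt_extChartAt p)
  refine h1.congr ?_
  filter_upwards [isOpen_slitBundle.mem_nhds hp,
    extChartAt_source_mem_nhds (I := (𝓡 2).tangent) p] with p' h4 h5 using (hf p' h4 h5).symm

theorem continuousAt_dampingCoeff (hp : p ∈ slitBundle M) :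
    ContinuousAt (F.dampingCoeff lam) p :=
  continuousAt_of_chart hp (fun _ h0 h => dampingCoeff_eq hlam h0 h)
    ((F.isEnergy p).continuousOn_flatDamping (contDiffOn_comp_extChartAt_symm hlam p))

theorem continuousAt_thermostatCurvature (hp : p ∈ slitBundle M) :
    ContinuousAt (F.thermostatCurvature lam) p :=
  continuousAt_of_chart hp (fun _ h0 h => thermostatCurvature_eq hlam h0 h)
    ((F.isEnergy p).continuousOn_flatCurvature (contDiffOn_comp_extChartAt_symm hlam p))

end FinslerMetric

/-! ### Completeness of the thermostat flow on the unit sphere bundle -/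

namespace ChartRep

variable {E H N : Type*} [NormedAddCommGroup E] [NormedSpace ℝ E]
  [TopologicalSpace H] {I : ModelWithCorners ℝ E H} [TopologicalSpace N] [ChartedSpace H N]
  [IsManifold I 1 N] [CompleteSpace E] [I.Boundaryless]

theorem exists_isMIntegralCurveOn_nhds {Y : (p : N) → TangentSpace I p}
    (hY : ContMDiff I I.tangent 1 (fun p => (⟨p, Y p⟩ : TangentBundle I N))) (q : N) :
    ∃ ε > 0, ∀ᶠ p in 𝓝 q, ∃ γ : ℝ → N, γ 0 = p ∧ IsMIntegralCurveOn γ Y (Ioo (-ε) ε) := by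
  obtain ⟨α, r, ε, L', hr, hε, -, hα, -⟩ := exists_local_flow (contDiffAt_chartRep (hY q))
    (extChartAt_target_mem_nhds (I := I) q)
  refine ⟨ε, hε, ?_⟩
  filter_upwards [extChartAt_source_mem_nhds (I := I) q,
    (continuousAt_extChartAt (I := I) q).preimage_mem_nhds (Metric.ball_mem_nhds _ hr)] with p h1 h2
  refine ⟨_, ?_, isMIntegralCurveOn_symm_comp (hα _ h2).2⟩
  rw [Function.comp, (hα _ h2).1, (extChartAt I q).left_inv h1]

/-- A `C¹` vector field that vanishes outside a compact set is complete. -/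
theorem exists_isMIntegralCurve_of_compact [T2Space N] {Y : (p : N) → TangentSpace I p}
    (hY : ContMDiff I I.tangent 1 (fun p => (⟨p, Y p⟩ : TangentBundle I N))) {S : Set N}
    (hS : IsCompact S) (hYS : ∀ p ∉ S, Y p = 0) (p : N) :
    ∃ γ : ℝ → N, γ 0 = p ∧ IsMIntegralCurve γ Y := by
  -- Compactness gives a common existence time on S, and outside S constant curves are solutions. A
  -- uniform existence time yields completeness.
  have key : ∃ ε > 0, ∀ p ∈ S, ∃ γ : ℝ → N, γ 0 = p ∧ IsMIntegralCurveOn γ Y (Ioo (-ε) ε) := by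
    refine hS.induction_on (p := fun S => ∃ ε > 0, ∀ p ∈ S, ∃ γ : ℝ → N, γ 0 = p ∧
      IsMIntegralCurveOn γ Y (Ioo (-ε) ε)) ⟨1, one_pos, by simp⟩ ?_ ?_ ?_
    · rintro s t hst ⟨ε, hε, h⟩
      exact ⟨ε, hε, fun p hp => h p (hst hp)⟩
    · rintro s t ⟨ε, hε, h⟩ ⟨ε', hε', h'⟩
      refine ⟨min ε ε', lt_min hε hε', fun p hp => ?_⟩
      have h1 := min_le_left ε ε'
      have h2 := min_le_right ε ε'
      rcases hp with hp | hp
      · obtain ⟨γ, h0, hγ⟩ := h p hp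
        exact ⟨γ, h0, hγ.mono (Ioo_subset_Ioo (by linarith) h1)⟩
      · obtain ⟨γ, h0, hγ⟩ := h' p hp
        exact ⟨γ, h0, hγ.mono (Ioo_subset_Ioo (by linarith) h2)⟩
    · intro q _
      obtain ⟨ε, hε, h⟩ := exists_isMIntegralCurveOn_nhds hY q
      exact ⟨_, nhdsWithin_le_nhds h, ε, hε, fun p hp => hp⟩
  obtain ⟨ε, hε, h⟩ := key
  refine exists_isMIntegralCurve_of_isMIntegralCurveOn hY hε (fun p => ?_) p
  by_cases hp : p ∈ S
  · exact h p hp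
  · exact ⟨fun _ => p, rfl, (isMIntegralCurve_const (hYS p hp)).isMIntegralCurveOn _⟩

end ChartRep

/-! ### Separation in the tangent bundle -/

namespace TangentChart

variable {M : Type*} [TopologicalSpace M] [ChartedSpace Plane M] [IsManifold (𝓡 2) ∞ M]

theorem t2Space_tangentBundle [T2Space M] : T2Space (TangentBundle (𝓡 2) M) := by
  refine ⟨fun p p' hne => ?_⟩
  have hproj : Continuous (fun p : TangentBundle (𝓡 2) M => p.proj) :=
    FiberBundle.continuous_proj Plane (fun x : M => TangentSpace (𝓡 2) x)
  by_cases h : p.proj = p'.proj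
  · have h1 : p ∈ (extChartAt (𝓡 2).tangent p).source := mem_extChartAt_source p
    have h2 : p' ∈ (extChartAt (𝓡 2).tangent p).source := by
      rw [extChartAt_source]
      show p'.proj ∈ (extChartAt (𝓡 2) p.proj).source
      rw [← h]
      exact mem_extChartAt_source p.proj
    have h3 : extChartAt (𝓡 2).tangent p p ≠ extChartAt (𝓡 2).tangent p p' := fun e =>
      hne ((extChartAt (𝓡 2).tangent p).injOn h1 h2 e)
    obtain ⟨u, v, hu, hv, hpu, hpv, huv⟩ := t2_separation h3
    refine ⟨_, _, isOpen_extChartAt_preimage' p hu, isOpen_extChartAt_preimage' p hv, ⟨h1, hpu⟩,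
      ⟨h2, hpv⟩, ?_⟩
    exact Disjoint.mono inter_subset_right inter_subset_right (huv.preimage _)
  · obtain ⟨u, v, hu, hv, hpu, hpv, huv⟩ := t2_separation h
    exact ⟨_, _, hu.preimage hproj, hv.preimage hproj, hpu, hpv, huv.preimage _⟩

end TangentChart

/-! ### Compactness of the unit sphere bundle -/

namespace FinslerMetric

open FlatFinsler TangentChart ChartRep VectorField

variable {M : Type*} [TopologicalSpace M] [ChartedSpace Plane M] [IsManifold (𝓡 2) ∞ M]
  {F : FinslerMetric M} {p q : TangentBundle (𝓡 2) M}

theorem toFun_of_not_mem_slitBundle (F : FinslerMetric M) (hp : p ∉ slitBundle M) :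
    F.toFun p = 0 := by
  have h : (p.snd : Plane) = 0 := not_not.1 hp
  have h1 := F.homogeneous p.proj 0 0 le_rfl
  rw [smul_zero, zero_mul] at h1
  exact (congrArg (fun v : Plane => F.toFun ⟨p.proj, v⟩) h).trans h1

theorem mem_slitBundle_of_pos (hp : 0 < F.toFun p) : p ∈ slitBundle M := by
  by_contra h
  rw [F.toFun_of_not_mem_slitBundle h] at hp
  exact lt_irrefl _ hp

theorem inChart_toFun_smul (F : FinslerMetric M) {u : Plane}
    (hu : u ∈ (extChartAt (𝓡 2) q.proj).target) (v : Plane) {c : ℝ} (hc : 0 ≤ c) :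
    inChart F.toFun q (u, c • v) = c * inChart F.toFun q (u, v) := by
  rw [inChart, inChart, extChartAt_symm_apply q (z := (u, c • v)) hu,
    extChartAt_symm_apply q (z := (u, v)) hu]
  simp only [map_smul]
  exact F.homogeneous _ _ c hc

theorem contDiffOn_inChart_toFun (F : FinslerMetric M) (q : TangentBundle (𝓡 2) M) :
    ContDiffOn ℝ ∞ (inChart F.toFun q) (slitTarget q) :=
  contDiffOn_comp_extChartAt_symm F.smooth q

theorem inChart_toFun_pos (F : FinslerMetric M) {z : Plane × Plane} (hz : z ∈ slitTarget q) :
    0 < inChart F.toFun q z := F.pos _ (extChartAt_symm_mem_slitBundle hz)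

/-- F is assumed smooth only off the zero section. Near it, F is small by homogeneity, being bounded
on unit vectors over a compact coordinate ball. -/
theorem eventually_toFun_lt (F : FinslerMetric M) (hp : p ∉ slitBundle M) {c : ℝ} (hc : 0 < c) :
    ∀ᶠ p' in 𝓝 p, F.toFun p' < c := by
  obtain ⟨r, hr, hball⟩ := Metric.nhds_basis_closedBall.mem_iff.1
    (extChartAt_target_mem_nhds (I := 𝓡 2) p.proj)
  set B := Metric.closedBall (extChartAt (𝓡 2) p.proj p.proj) r with hB
  have hcomp : IsCompact (B ×ˢ Metric.sphere (0 : Plane) 1) :=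
    (isCompact_closedBall _ _).prod (isCompact_sphere _ _)
  have hsub : B ×ˢ Metric.sphere (0 : Plane) 1 ⊆ slitTarget p := fun z hz =>
    ⟨hball hz.1, fun h => by have := hz.2; rw [h] at this; simp at this⟩
  obtain ⟨C, hC⟩ := hcomp.exists_bound_of_continuousOn
    ((F.contDiffOn_inChart_toFun p).continuousOn.mono hsub)
  have hbound : ∀ z : Plane × Plane, z.1 ∈ B → inChart F.toFun p z ≤ ‖z.2‖ * |C| := by
    intro z hz
    by_cases h0 : z.2 = 0
    · have := F.inChart_toFun_smul (hball hz) 0 le_rfl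
      rw [smul_zero, zero_mul] at this
      have e : z = (z.1, 0) := Prod.ext rfl h0
      rw [e, this]; simp
    · have hn : 0 < ‖z.2‖ := norm_pos_iff.2 h0
      have e : z = (z.1, ‖z.2‖ • (‖z.2‖⁻¹ • z.2)) := by
        rw [smul_inv_smul₀ hn.ne']
      have h1 := hC (z.1, ‖z.2‖⁻¹ • z.2) ⟨hz, by
        simp [norm_smul, inv_mul_cancel₀ hn.ne']⟩
      rw [e, F.inChart_toFun_smul (hball hz) _ hn.le]
      simp only [norm_smul, norm_norm, norm_inv, inv_mul_cancel₀ hn.ne', mul_one]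
      exact mul_le_mul_of_nonneg_left ((le_abs_self _).trans (h1.trans (le_abs_self _))) hn.le
  have hcont : ContinuousAt (extChartAt (𝓡 2).tangent p) p := continuousAt_extChartAt p
  have h0 : (extChartAt (𝓡 2).tangent p p).2 = 0 := by
    rw [extChartAt_self_snd]; exact not_not.1 hp
  have h1 : ∀ᶠ p' in 𝓝 p, (extChartAt (𝓡 2).tangent p p').1 ∈ B := by
    have : ContinuousAt (fun p' => (extChartAt (𝓡 2).tangent p p').1) p := hcont.fst
    refine this.preimage_mem_nhds ?_
    rw [extChartAt_self]
    exact Metric.closedBall_mem_nhds _ hr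
  have h2 : ∀ᶠ p' in 𝓝 p, ‖(extChartAt (𝓡 2).tangent p p').2‖ * |C| < c := by
    have : ContinuousAt (fun p' => ‖(extChartAt (𝓡 2).tangent p p').2‖ * |C|) p :=
      hcont.snd.norm.mul continuousAt_const
    refine this.eventually_lt_const ?_
    show ‖(extChartAt (𝓡 2).tangent p p).2‖ * |C| < c
    rw [h0]; simpa using hc
  filter_upwards [h1, h2, extChartAt_source_mem_nhds (I := (𝓡 2).tangent) p] with p' h3 h4 h5
  rw [inChart_extChartAt F.toFun h5]
  exact (hbound _ h3).trans_lt h4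

/-- Over a compact coordinate ball B the shell is the image of B × S¹ × [a, b] under (x, v, c) ↦ (x,
(c / F(x, v)) v). Finitely many such balls cover M. -/
theorem isCompact_shell [CompactSpace M] (F : FinslerMetric M) {a b : ℝ} (ha : 0 < a) :
    IsCompact {p | a ≤ F.toFun p ∧ F.toFun p ≤ b} := by
  have hloc : ∀ x : M, ∃ S ∈ 𝓝 x, ∃ T : Set (TangentBundle (𝓡 2) M), IsCompact T ∧
      T ⊆ {p | a ≤ F.toFun p ∧ F.toFun p ≤ b} ∧
      ∀ p : TangentBundle (𝓡 2) M, p.proj ∈ S → a ≤ F.toFun p ∧ F.toFun p ≤ b → p ∈ T := by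
    intro x
    set q : TangentBundle (𝓡 2) M := ⟨x, (0 : Plane)⟩ with hq
    obtain ⟨r, hr, hball⟩ := Metric.nhds_basis_closedBall.mem_iff.1
      (extChartAt_target_mem_nhds (I := 𝓡 2) x)
    set B := Metric.closedBall (extChartAt (𝓡 2) x x) r with hB
    have hcomp : IsCompact ((B ×ˢ Metric.sphere (0 : Plane) 1) ×ˢ Icc a b) :=
      ((isCompact_closedBall _ _).prod (isCompact_sphere _ _)).prod isCompact_Icc
    have hsub : B ×ˢ Metric.sphere (0 : Plane) 1 ⊆ slitTarget q := fun z hz =>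
      ⟨hball hz.1, fun h => by have := hz.2; rw [h] at this; simp at this⟩
    set f : (Plane × Plane) × ℝ → TangentBundle (𝓡 2) M := fun w =>
      (extChartAt (𝓡 2).tangent q).symm (w.1.1, (w.2 / inChart F.toFun q w.1) • w.1.2) with hf
    have hfF : ∀ w ∈ (B ×ˢ Metric.sphere (0 : Plane) 1) ×ˢ Icc a b, F.toFun (f w) = w.2 := by
      rintro w ⟨h1, h2⟩
      have hp := F.inChart_toFun_pos (hsub h1)
      have := F.inChart_toFun_smul (q := q) (hball h1.1) w.1.2
        (c := w.2 / inChart F.toFun q w.1) (div_nonneg (ha.le.trans h2.1) hp.le)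
      refine Eq.trans this ?_
      exact div_mul_cancel₀ _ hp.ne'
    have hfc : ContinuousOn f ((B ×ˢ Metric.sphere (0 : Plane) 1) ×ˢ Icc a b) := by
      refine (continuousOn_extChartAt_symm q).comp ?_ fun w hw => ?_
      · have h1 : ContinuousOn (fun w : (Plane × Plane) × ℝ => inChart F.toFun q w.1)
            ((B ×ˢ Metric.sphere (0 : Plane) 1) ×ˢ Icc a b) :=
          ((F.contDiffOn_inChart_toFun q).continuousOn.mono hsub).comp continuousOn_fst
            fun w hw => hw.1
        exact (continuous_fst.fst.continuousOn).prodMk ((continuousOn_snd.div h1 fun w hw =>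
          (F.inChart_toFun_pos (hsub hw.1)).ne').smul continuous_fst.snd.continuousOn)
      · rw [TangentChart.extChartAt_target]
        exact ⟨hball hw.1.1, trivial⟩
    refine ⟨(extChartAt (𝓡 2) x).source ∩ extChartAt (𝓡 2) x ⁻¹' B,
      Filter.inter_mem (extChartAt_source_mem_nhds x)
        ((continuousAt_extChartAt x).preimage_mem_nhds (Metric.closedBall_mem_nhds _ hr)),
      _, hcomp.image_of_continuousOn hfc, ?_, ?_⟩
    · rintro _ ⟨w, hw, rfl⟩
      show a ≤ F.toFun (f w) ∧ F.toFun (f w) ≤ b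
      rw [hfF w hw]
      exact hw.2
    · intro p hp hpF
      have hslit : p ∈ slitBundle M := mem_slitBundle_of_pos (ha.trans_le hpF.1)
      have hps : p ∈ (extChartAt (𝓡 2).tangent q).source := by
        rw [TangentChart.extChartAt_source]; exact hp.1
      have hz := extChartAt_mem_slitTarget hps hslit
      set z := extChartAt (𝓡 2).tangent q p with hzdef
      have hn : 0 < ‖z.2‖ := norm_pos_iff.2 hz.2
      have hzF : inChart F.toFun q z = F.toFun p := (inChart_extChartAt F.toFun hps).symm
      have h1 := F.inChart_toFun_smul hz.1 z.2 (inv_nonneg.2 hn.le)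
      rw [Prod.mk.eta, hzF] at h1
      have hzB : z.1 ∈ B := hp.2
      refine ⟨((z.1, ‖z.2‖⁻¹ • z.2), F.toFun p), ⟨⟨hzB, ?_⟩, hpF⟩, ?_⟩
      · simp [norm_smul, inv_mul_cancel₀ hn.ne']
      · have hFp : F.toFun p ≠ 0 := (ha.trans_le hpF.1).ne'
        have e : (F.toFun p / (‖z.2‖⁻¹ * F.toFun p)) • ‖z.2‖⁻¹ • z.2 = z.2 := by
          rw [smul_smul]
          have : F.toFun p / (‖z.2‖⁻¹ * F.toFun p) * ‖z.2‖⁻¹ = 1 := by field_simp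
          rw [this, one_smul]
        simp only [hf, h1]
        rw [e, Prod.mk.eta, hzdef, (extChartAt (𝓡 2).tangent q).left_inv hps]
  choose S hS T hT hT1 hT2 using hloc
  obtain ⟨t, ht⟩ := CompactSpace.elim_nhds_subcover S hS
  have : {p | a ≤ F.toFun p ∧ F.toFun p ≤ b} = ⋃ x ∈ t, T x := by
    refine Subset.antisymm (fun p hp => ?_) (iUnion₂_subset fun x _ => hT1 x)
    have h1 : p.proj ∈ ⋃ x ∈ t, S x := by rw [ht]; trivial
    obtain ⟨x, hx, hpx⟩ := mem_iUnion₂.1 h1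
    exact mem_iUnion₂.2 ⟨x, hx, hT2 x p hpx hp⟩
  rw [this]
  exact t.isCompact_biUnion fun x _ => hT x

theorem isCompact_unitBundle [CompactSpace M] (F : FinslerMetric M) : IsCompact F.unitBundle := by
  convert! F.isCompact_shell (a := 1) (b := 1) one_pos using 1
  ext p
  exact ⟨fun h => ⟨ge_of_eq h, le_of_eq h⟩, fun h => le_antisymm h.2 h.1⟩

theorem unitBundle_subset_slitBundle (hp : p ∈ F.unitBundle) : p ∈ slitBundle M :=
  mem_slitBundle_of_pos (by rw [show F.toFun p = 1 from hp]; exact one_pos)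

end FinslerMetric

/-! ### Cutting off the thermostat field; the global flow on the unit sphere bundle -/

namespace FinslerMetric

open FlatFinsler TangentChart ChartRep VectorField

variable {M : Type*} [TopologicalSpace M] [ChartedSpace Plane M] [IsManifold (𝓡 2) ∞ M]

/-- A bump function that singles out the unit level. -/
noncomputable def unitBump : ContDiffBump (1 : ℝ) := ⟨1 / 4, 1 / 2, by norm_num, by norm_num⟩

theorem unitBump_one : unitBump 1 = 1 := unitBump.one_of_mem_closedBall (by simp [unitBump])

theorem unitBump_eq_zero {x : ℝ} (hx : x < 1 / 2 ∨ 3 / 2 < x) : unitBump x = 0 := by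
  refine unitBump.zero_of_le_dist ?_
  rw [Real.dist_eq, show unitBump.rOut = 1 / 2 from rfl, le_abs]
  rcases hx with h | h
  · right; linarith
  · left; linarith

variable (F : FinslerMetric M) (lam : TangentBundle (𝓡 2) M → ℝ)

/-- The thermostat field, cut off away from the unit sphere bundle. -/
noncomputable def cutoffField (p : TangentBundle (𝓡 2) M) : TangentSpace (𝓡 2).tangent p :=
  unitBump (F.toFun p) • F.thermostatField lam p

variable {F lam} {p q : TangentBundle (𝓡 2) M}

theorem cutoffField_eq_zero (h : F.toFun p < 1 / 2 ∨ 3 / 2 < F.toFun p) :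
    F.cutoffField lam p = 0 := by
  rw [cutoffField, unitBump_eq_zero h, zero_smul]

theorem cutoffField_of_mem_unitBundle (hp : p ∈ F.unitBundle) :
    F.cutoffField lam p = F.thermostatField lam p := by
  rw [cutoffField, show F.toFun p = 1 from hp, unitBump_one, one_smul]

section

variable [OrientedAtlas M]

theorem tangentCoordChange_smul_thermostatField (ψ : TangentBundle (𝓡 2) M → ℝ)
    (hp : p ∈ slitBundle M) (hq : p ∈ (extChartAt (𝓡 2).tangent q).source) :
    tangentCoordChange (𝓡 2).tangent p q p (ψ p • F.thermostatField lam p)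
      = ψ p • thermo (F.energyInChart q) (inChart lam q) (extChartAt (𝓡 2).tangent q p) := by
  rw [← tangentCoordChange_thermostatField hp hq]
  exact map_smul (tangentCoordChange (𝓡 2).tangent p q p) _ _

/-- Completeness and uniqueness are applied to a field that is C¹ on the whole tangent bundle. The
cut-off field is one: near the zero section F < 1/2, and it vanishes there. -/
theorem contMDiff_cutoffField
    (hlam : ContMDiffOn (𝓡 2).tangent 𝓘(ℝ, ℝ) ∞ lam (slitBundle M)) :
    ContMDiff (𝓡 2).tangent (𝓡 2).tangent.tangent 1
      (fun p => (⟨p, F.cutoffField lam p⟩ :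
        TangentBundle (𝓡 2).tangent (TangentBundle (𝓡 2) M))) := by
  intro p
  by_cases hp : p ∈ slitBundle M
  · refine contMDiffAt_of_rep (Z' := fun z => unitBump (inChart F.toFun p z) •
      thermo (F.energyInChart p) (inChart lam p) z) hp (fun p' h0 h => ?_) ?_
    · rw [← inChart_extChartAt F.toFun h]
      exact tangentCoordChange_smul_thermostatField (fun p => unitBump (F.toFun p)) h0 h
    · exact (unitBump.contDiff.comp_contDiffOn (F.contDiffOn_inChart_toFun p)).smul
        ((F.isEnergy p).contDiffOn_thermo (contDiffOn_comp_extChartAt_symm hlam p))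
  · have : IsManifold (𝓡 2).tangent (1 + 1) (TangentBundle (𝓡 2) M) :=
      IsManifold.of_le (n := ∞) (by rw [one_add_one_eq_two]; exact two_le_infty)
    refine contMDiffAt_of_chartRep ((contDiffAt_const (c := (0 : Plane × Plane))).congr_of_eventuallyEq ?_)
    have h1 := F.eventually_toFun_lt hp (c := 1 / 2) (by norm_num)
    have h2 : Tendsto (extChartAt (𝓡 2).tangent p).symm
        (𝓝 (extChartAt (𝓡 2).tangent p p)) (𝓝 p) := by
      have := continuousAt_extChartAt_symm (I := (𝓡 2).tangent) p
      rwa [ContinuousAt, (extChartAt (𝓡 2).tangent p).left_inv (mem_extChartAt_source p)] at this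
    filter_upwards [h2.eventually h1] with z hz
    rw [chartRep, cutoffField_eq_zero (Or.inl hz)]
    exact map_zero (tangentCoordChange (𝓡 2).tangent _ _ _)

/-- The Finsler norm is constant along integral curves of multiples of the thermostat field. -/
theorem mem_unitBundle_of_isMIntegralCurve [T2Space M] [CompactSpace M]
    {Z : (p : TangentBundle (𝓡 2) M) → TangentSpace (𝓡 2).tangent p}
    {ψ : TangentBundle (𝓡 2) M → ℝ} (hZ : ∀ p, Z p = ψ p • F.thermostatField lam p)
    {γ : ℝ → TangentBundle (𝓡 2) M} (hγ : IsMIntegralCurve γ Z) (h0 : γ 0 ∈ F.unitBundle) (t : ℝ) :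
    γ t ∈ F.unitBundle := by
  have : T2Space (TangentBundle (𝓡 2) M) := t2Space_tangentBundle
  have hder : ∀ t, γ t ∈ slitBundle M → HasDerivAt (fun s => F.toFun (γ s) ^ 2 / 2) 0 t := by
    intro t ht
    have hs := mem_extChartAt_source (I := (𝓡 2).tangent) (γ t)
    have h1 := hasDerivAt_of_isMIntegralCurve hγ hs
    rw [chartRep_extChartAt _ _ hs, hZ, tangentCoordChange_smul_thermostatField ψ ht hs] at h1
    have hm := extChartAt_self_mem_slitTarget ht
    have h2 := ((F.isEnergy (γ t)).differentiableAt hm).hasFDerivAt.comp_hasDerivAt t h1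
    rw [map_smul, (F.isEnergy (γ t)).energy_thermo hm, smul_zero] at h2
    refine h2.congr_of_eventuallyEq ?_
    filter_upwards [hγ.continuous.continuousAt.preimage_mem_nhds
      (extChartAt_source_mem_nhds (I := (𝓡 2).tangent) (γ t))] with s hs
    rw [Function.comp, energyInChart, (extChartAt (𝓡 2).tangent (γ t)).left_inv hs]
  -- The set of times on SM is closed since SM is compact. It is open since off the zero section the
  -- energy is locally constant along the curve, and F is positive there.
  have hclopen : IsClopen (γ ⁻¹' F.unitBundle) := by
    refine ⟨F.isCompact_unitBundle.isClosed.preimage hγ.continuous, ?_⟩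
    rw [Metric.isOpen_iff]
    intro t ht
    have h1 : γ ⁻¹' slitBundle M ∈ 𝓝 t := hγ.continuous.continuousAt.preimage_mem_nhds
      (isOpen_slitBundle.mem_nhds (unitBundle_subset_slitBundle ht))
    obtain ⟨ε, hε, hball⟩ := Metric.mem_nhds_iff.1 h1
    refine ⟨ε, hε, fun s hs => ?_⟩
    have hconst := (convex_ball t ε).is_const_of_fderivWithin_eq_zero (𝕜 := ℝ)
      (f := fun s => F.toFun (γ s) ^ 2 / 2)
      (fun u hu => (hder u (hball hu)).differentiableAt.differentiableWithinAt)
      (fun u hu => by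
        rw [fderivWithin_of_isOpen Metric.isOpen_ball hu]
        simpa using! (hder u (hball hu)).hasFDerivAt.fderiv)
      (Metric.mem_ball_self hε) hs
    have h2 : F.toFun (γ t) = 1 := ht
    have h3 : 0 < F.toFun (γ s) := F.pos _ (hball hs)
    simp only [h2] at hconst
    show F.toFun (γ s) = 1
    nlinarith
  have := hclopen.eq_univ ⟨0, h0⟩
  exact this.symm.subset (mem_univ t)

variable [T2Space M] [CompactSpace M]
  (hlam : ContMDiffOn (𝓡 2).tangent 𝓘(ℝ, ℝ) ∞ lam (slitBundle M))

/-- Either kind of curve stays on SM, where the two fields agree. -/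
theorem isMIntegralCurve_cutoff_iff {γ : ℝ → TangentBundle (𝓡 2) M} (h0 : γ 0 ∈ F.unitBundle) :
    IsMIntegralCurve γ (F.cutoffField lam) ↔ IsMIntegralCurve γ (F.thermostatField lam) := by
  constructor
  · intro h t
    have hm := mem_unitBundle_of_isMIntegralCurve (ψ := fun p => unitBump (F.toFun p))
      (fun _ => rfl) h h0 t
    have := h t
    rwa [cutoffField_of_mem_unitBundle hm] at this
  · intro h t
    have hm := mem_unitBundle_of_isMIntegralCurve (ψ := fun _ => 1)
      (fun _ => (one_smul _ _).symm) h h0 t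
    have := h t
    rwa [← cutoffField_of_mem_unitBundle hm] at this

include hlam

theorem exists_isMIntegralCurve (hp : p ∈ F.unitBundle) :
    ∃ γ : ℝ → TangentBundle (𝓡 2) M,
      γ 0 = p ∧ IsMIntegralCurve (I := (𝓡 2).tangent) γ (F.thermostatField lam) := by
  have : T2Space (TangentBundle (𝓡 2) M) := t2Space_tangentBundle
  obtain ⟨γ, h0, hγ⟩ := exists_isMIntegralCurve_of_compact (contMDiff_cutoffField (F := F) hlam)
    (F.isCompact_shell (a := 1 / 2) (b := 3 / 2) (by norm_num)) (fun p hp => by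
      refine cutoffField_eq_zero ?_
      by_contra! h
      exact hp h) p
  exact ⟨γ, h0, (isMIntegralCurve_cutoff_iff (by rwa [h0])).1 hγ⟩

theorem flow_zero (hp : p ∈ F.unitBundle) : F.flow lam p 0 = p := by
  rw [flow, dif_pos (exists_isMIntegralCurve hlam hp)]
  exact (exists_isMIntegralCurve hlam hp).choose_spec.1

theorem isMIntegralCurve_flow (hp : p ∈ F.unitBundle) :
    IsMIntegralCurve (I := (𝓡 2).tangent) (F.flow lam p) (F.thermostatField lam) := by
  rw [flow, dif_pos (exists_isMIntegralCurve hlam hp)]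
  exact (exists_isMIntegralCurve hlam hp).choose_spec.2

theorem isMIntegralCurve_flow_cutoff (hp : p ∈ F.unitBundle) :
    IsMIntegralCurve (I := (𝓡 2).tangent) (F.flow lam p) (F.cutoffField lam) :=
  (isMIntegralCurve_cutoff_iff (by rwa [flow_zero hlam hp])).2 (isMIntegralCurve_flow hlam hp)

theorem flow_mem_unitBundle (hp : p ∈ F.unitBundle) (t : ℝ) : F.flow lam p t ∈ F.unitBundle :=
  mem_unitBundle_of_isMIntegralCurve (ψ := fun _ => 1) (fun _ => (one_smul _ _).symm)
    (isMIntegralCurve_flow hlam hp) (by rwa [flow_zero hlam hp]) t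

/-- The flow is a choice of integral curve. Uniqueness, applied to the cut-off field, makes the
choice irrelevant and gives the group law. -/
theorem flow_add (hp : p ∈ F.unitBundle) (s t : ℝ) :
    F.flow lam (F.flow lam p s) t = F.flow lam p (t + s) := by
  have : T2Space (TangentBundle (𝓡 2) M) := t2Space_tangentBundle
  have hs := flow_mem_unitBundle hlam hp s
  have h := isMIntegralCurve_Ioo_eq_of_contMDiff_boundaryless (t₀ := 0)
    (contMDiff_cutoffField (F := F) hlam) (isMIntegralCurve_flow_cutoff hlam hs)
    ((isMIntegralCurve_flow_cutoff hlam hp).comp_add s)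
    (by rw [flow_zero hlam hs, Function.comp, zero_add])
  exact congrFun h t

theorem continuous_flow (hp : p ∈ F.unitBundle) : Continuous (F.flow lam p) :=
  (isMIntegralCurve_flow hlam hp).continuous

omit [T2Space M] in
theorem exists_bound_coefficients : ∃ B C : ℝ, 0 ≤ B ∧ 0 ≤ C ∧ ∀ p ∈ F.unitBundle,
    |F.thermostatCurvature lam p| ≤ B ^ 2 ∧ |F.dampingCoeff lam p| ≤ C := by
  obtain ⟨B, hB⟩ := F.isCompact_unitBundle.exists_bound_of_continuousOn
    (f := F.thermostatCurvature lam) fun p hp =>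
      (continuousAt_thermostatCurvature hlam (unitBundle_subset_slitBundle hp)).continuousWithinAt
  obtain ⟨C, hC⟩ := F.isCompact_unitBundle.exists_bound_of_continuousOn
    (f := F.dampingCoeff lam) fun p hp =>
      (continuousAt_dampingCoeff hlam (unitBundle_subset_slitBundle hp)).continuousWithinAt
  refine ⟨√|B|, |C|, Real.sqrt_nonneg _, abs_nonneg _, fun p hp => ⟨?_, ?_⟩⟩
  · rw [Real.sq_sqrt (abs_nonneg _)]
    exact (hB p hp).trans (le_abs_self _)
  · exact (hC p hp).trans (le_abs_self _)

theorem isCoeff_flow (hp : p ∈ F.unitBundle) :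
    JacobiODE.IsCoeff (fun t => F.dampingCoeff lam (F.flow lam p t))
      (fun t => F.thermostatCurvature lam (F.flow lam p t)) := by
  obtain ⟨B, C, hB, hC, h⟩ := exists_bound_coefficients (F := F) hlam
  have hc := (continuous_flow hlam hp)
  refine ⟨?_, ?_, max (B ^ 2) C, (le_max_of_le_right hC), fun t => ?_⟩
  · exact continuous_iff_continuousAt.2 fun t => ContinuousAt.comp
      (continuousAt_dampingCoeff hlam (unitBundle_subset_slitBundle
        (flow_mem_unitBundle hlam hp t))) hc.continuousAt
  · exact continuous_iff_continuousAt.2 fun t => ContinuousAt.comp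
      (continuousAt_thermostatCurvature hlam (unitBundle_subset_slitBundle
        (flow_mem_unitBundle hlam hp t))) hc.continuousAt
  · have := h _ (flow_mem_unitBundle hlam hp t)
    exact ⟨this.2.trans (le_max_right _ _), this.1.trans (le_max_left _ _)⟩

end

end FinslerMetric

/-! ### Jacobi fields and the exponential map -/

namespace FinslerMetric

open FlatFinsler TangentChart ChartRep VectorField

variable {M : Type*} [TopologicalSpace M] [ChartedSpace Plane M] [IsManifold (𝓡 2) ∞ M]
  (F : FinslerMetric M) (lam : TangentBundle (𝓡 2) M → ℝ)

/-- The field `a 𝐅 + y H + (w - λ I y) V` along a curve. -/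
noncomputable def jacobiField (γ : ℝ → TangentBundle (𝓡 2) M) (a y w : ℝ → ℝ) (t : ℝ) :
    TangentSpace (𝓡 2).tangent (γ t) :=
  a t • F.thermostatField lam (γ t) + y t • F.fieldH (γ t)
    + (w t - (lam (γ t) * F.mainScalar (γ t)) * y t) • F.fieldV (γ t)

variable {F lam} {p q : TangentBundle (𝓡 2) M}

/-- The vector `ξ` of a point `(x, ξ)` of the tangent bundle. -/
def velocity (p : TangentBundle (𝓡 2) M) : Plane := p.snd

theorem extChartAt_self_eq (p : TangentBundle (𝓡 2) M) :
    extChartAt (𝓡 2).tangent p p = (extChartAt (𝓡 2) p.proj p.proj, velocity p) :=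
  extChartAt_self p

theorem fderiv_energyInChart_rot (hp : p ∈ slitBundle M) :
    fderiv ℝ (F.energyInChart p) (extChartAt (𝓡 2).tangent p p) (0, F.rot p) = 0 := by
  rw [F.rot_eq hp, ← (F.isEnergy p).flatG_velocity (extChartAt_self_mem_slitTarget hp),
    IsEnergy.flatG_velocity_rotate]

theorem area_rot_pos (hp : p ∈ slitBundle M) : 0 < area (velocity p) (F.rot p) := by
  have := (F.isEnergy p).area_pos (extChartAt_self_mem_slitTarget hp)
  rwa [extChartAt_self_eq, ← extChartAt_self_eq, ← F.rot_eq hp, extChartAt_self_eq] at this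

variable (F p) in
/-- The vector `ξ + θ iξ`. -/
noncomputable def turnedVector (θ : ℝ) : Plane := velocity p + θ • F.rot p

theorem turnedVector_ne_zero (hp : p ∈ slitBundle M) (θ : ℝ) : turnedVector F p θ ≠ 0 := by
  intro h
  have h1 : area (turnedVector F p θ) (F.rot p) = area (velocity p) (F.rot p) := by
    simp only [turnedVector, area, PiLp.add_apply, PiLp.smul_apply, smul_eq_mul]
    ring
  rw [h] at h1
  have := area_rot_pos (F := F) hp
  rw [← h1] at this
  simp [area] at this

variable (F p) in
/-- The curve `(ξ + θ iξ) / F(ξ + θ iξ)` in the unit circle of `T_x M`. -/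
noncomputable def unitCurve (θ : ℝ) : Plane :=
  (F.toFun ⟨p.proj, turnedVector F p θ⟩)⁻¹ • turnedVector F p θ

theorem toFun_fiber_pos {x : M} {v : Plane} (hv : v ≠ 0) : 0 < F.toFun ⟨x, v⟩ :=
  F.pos ⟨x, v⟩ hv

variable (F p) in
/-- The curve `(ξ + θ iξ) / F(ξ + θ iξ)` as a curve in the unit sphere bundle. -/
noncomputable def unitPoint (θ : ℝ) : TangentBundle (𝓡 2) M := ⟨p.proj, unitCurve F p θ⟩

theorem unitCurve_mem (hp : p ∈ slitBundle M) (θ : ℝ) :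
    unitPoint F p θ ∈ F.unitBundle := by
  have h := toFun_fiber_pos (F := F) (x := p.proj) (turnedVector_ne_zero (F := F) hp θ)
  refine (F.homogeneous _ _ _ (inv_nonneg.2 h.le)).trans ?_
  exact inv_mul_cancel₀ h.ne'

theorem turnedVector_zero : turnedVector F p 0 = velocity p := by
  simp [turnedVector]

theorem unitCurve_zero (hp : p ∈ F.unitBundle) : unitCurve F p 0 = velocity p := by
  have h1 : F.toFun ⟨p.proj, velocity p⟩ = 1 := hp
  rw [unitCurve, turnedVector_zero, h1, inv_one, one_smul]

theorem unitPoint_zero (hp : p ∈ F.unitBundle) : unitPoint F p 0 = p := by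
  rw [unitPoint, unitCurve_zero hp]
  rfl

theorem hasDerivAt_turnedVector (θ : ℝ) : HasDerivAt (turnedVector F p) (F.rot p) θ :=
  (((hasDerivAt_id θ).smul_const (F.rot p)).const_add (velocity p)).congr_deriv
    (one_smul _ _)

/-- The vector iξ is tangent to the unit circle, because dL(0, iξ) = g(ξ, iξ) = 0. So normalizing ξ
+ θ iξ does not change its velocity at θ = 0. -/
theorem hasDerivAt_toFun_turnedVector (hp : p ∈ F.unitBundle) :
    HasDerivAt (fun θ => F.toFun ⟨p.proj, turnedVector F p θ⟩) 0 0 := by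
  have hs := unitBundle_subset_slitBundle hp
  have hm := extChartAt_self_mem_slitTarget hs
  have h1 : HasDerivAt (fun θ => (extChartAt (𝓡 2) p.proj p.proj, turnedVector F p θ))
      ((0 : Plane), F.rot p) 0 := (hasDerivAt_const 0 _).prodMk (hasDerivAt_turnedVector 0)
  have h2 : HasDerivAt (fun θ => F.energyInChart p
      (extChartAt (𝓡 2) p.proj p.proj, turnedVector F p θ)) 0 0 := by
    refine HasDerivAt.congr_deriv (HasFDerivAt.comp_hasDerivAt (l := F.energyInChart p)
      (l' := fderiv ℝ (F.energyInChart p) (extChartAt (𝓡 2).tangent p p)) 0 ?_ h1)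
      (fderiv_energyInChart_rot hs)
    rw [turnedVector_zero, ← extChartAt_self_eq]
    exact ((F.isEnergy p).differentiableAt hm).hasFDerivAt
  simp only [energyInChart_fiber] at h2
  have h0 : F.toFun ⟨p.proj, turnedVector F p 0⟩ = 1 := by rw [turnedVector_zero]; exact hp
  have h3 := (h2.const_mul 2).sqrt (by rw [h0]; norm_num)
  simp only [mul_zero, zero_div] at h3
  refine h3.congr_of_eventuallyEq (Eventually.of_forall fun θ => ?_)
  have hpos := toFun_fiber_pos (F := F) (x := p.proj) (turnedVector_ne_zero (F := F) hs θ)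
  simp only
  rw [mul_div_cancel₀ _ two_ne_zero, Real.sqrt_sq hpos.le]

theorem hasDerivAt_unitCurve (hp : p ∈ F.unitBundle) :
    HasDerivAt (unitCurve F p) (F.rot p) 0 := by
  have h0 : F.toFun ⟨p.proj, turnedVector F p 0⟩ = 1 := by rw [turnedVector_zero]; exact hp
  have h := ((hasDerivAt_toFun_turnedVector hp).inv (by rw [h0]; exact one_ne_zero)).smul
    (hasDerivAt_turnedVector (F := F) (p := p) 0)
  refine h.congr_deriv ?_
  simp [h0]

theorem hasMFDerivAt_unitCurve (hp : p ∈ F.unitBundle) :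
    HasMFDerivAt 𝓘(ℝ, ℝ) (𝓡 2).tangent
      (fun θ => unitPoint F p θ) 0
      ((1 : ℝ →L[ℝ] ℝ).smulRight (((0 : Plane), F.rot p) : Plane × Plane) :
        ℝ →L[ℝ] Plane × Plane) := by
  have hd : HasDerivAt (fun θ => (extChartAt (𝓡 2) p.proj p.proj, unitCurve F p θ))
      (((0 : Plane), F.rot p) : Plane × Plane) 0 :=
    (hasDerivAt_const 0 _).prodMk (hasDerivAt_unitCurve hp)
  have e (θ : ℝ) : unitPoint F p θ
      = (extChartAt (𝓡 2).tangent p).symm (extChartAt (𝓡 2) p.proj p.proj, unitCurve F p θ) :=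
    (extChartAt_symm_fiber p _).symm
  have htarget (θ : ℝ) : (extChartAt (𝓡 2) p.proj p.proj, unitCurve F p θ)
      ∈ (extChartAt (𝓡 2).tangent p).target := by
    rw [TangentChart.extChartAt_target]; exact ⟨mem_extChartAt_target _, trivial⟩
  have h0 : unitPoint F p 0 = p := unitPoint_zero hp
  refine hasMFDerivAt_of_chart (q := p) ?_ ?_ ?_
  · simp only [e]
    exact ContinuousAt.comp (f := fun θ => (extChartAt (𝓡 2) p.proj p.proj, unitCurve F p θ))
      (continuousAt_extChartAt_symm'' (htarget 0)) hd.continuousAt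
  · rw [h0]; exact mem_extChartAt_source p
  · rw [h0, tangentCoordChange_self_tangent]
    refine hd.congr_of_eventuallyEq (Eventually.of_forall fun θ => ?_)
    simp only
    rw [e, (extChartAt (𝓡 2).tangent p).right_inv (htarget θ)]

variable [OrientedAtlas M]

theorem tangentCoordChange_jacobiField {γ : ℝ → TangentBundle (𝓡 2) M} {a y w : ℝ → ℝ} {t : ℝ}
    (hp : γ t ∈ slitBundle M) (hq : γ t ∈ (extChartAt (𝓡 2).tangent q).source) :
    tangentCoordChange (𝓡 2).tangent (γ t) q (γ t) (F.jacobiField lam γ a y w t)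
      = a t • thermo (F.energyInChart q) (inChart lam q) (extChartAt (𝓡 2).tangent q (γ t))
        + y t • horiz (F.energyInChart q) (extChartAt (𝓡 2).tangent q (γ t))
        + (w t - (inChart lam q (extChartAt (𝓡 2).tangent q (γ t))
            * flatI (F.energyInChart q) (extChartAt (𝓡 2).tangent q (γ t))) * y t)
          • vert (F.energyInChart q) (extChartAt (𝓡 2).tangent q (γ t)) := by
  rw [← inChart_extChartAt lam hq, ← mainScalar_eq hp hq,
    ← tangentCoordChange_thermostatField hp hq, ← tangentCoordChange_fieldH hp hq,
    ← tangentCoordChange_fieldV hp hq, jacobiField]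
  exact ((map_add (tangentCoordChange (𝓡 2).tangent (γ t) q (γ t)) _ _).trans
    (congrArg₂ _ ((map_add (tangentCoordChange (𝓡 2).tangent (γ t) q (γ t)) _ _).trans
      (congrArg₂ _ (map_smul (tangentCoordChange (𝓡 2).tangent (γ t) q (γ t)) _ _)
        (map_smul (tangentCoordChange (𝓡 2).tangent (γ t) q (γ t)) _ _)))
      (map_smul (tangentCoordChange (𝓡 2).tangent (γ t) q (γ t)) _ _)))

/-- The bump function is 1 near the unit level and not only on it, so the linearizations of the two
fields also agree on SM. -/
theorem chartRep_cutoffField_eventuallyEq (hp : p ∈ F.unitBundle)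
    (hq : p ∈ (extChartAt (𝓡 2).tangent q).source) :
    chartRep (𝓡 2).tangent q (F.cutoffField lam) =ᶠ[𝓝 (extChartAt (𝓡 2).tangent q p)]
      thermo (F.energyInChart q) (inChart lam q) := by
  have hm := extChartAt_mem_slitTarget hq (unitBundle_subset_slitBundle hp)
  have hnhds := (isOpen_slitTarget q).mem_nhds hm
  have h1 : ContinuousAt (inChart F.toFun q) (extChartAt (𝓡 2).tangent q p) :=
    (F.contDiffOn_inChart_toFun q).continuousOn.continuousAt hnhds
  have h2 : ∀ᶠ x in 𝓝 (1 : ℝ), unitBump x = 1 := unitBump.eventuallyEq_one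
  have h3 : inChart F.toFun q (extChartAt (𝓡 2).tangent q p) = 1 := by
    rw [← inChart_extChartAt F.toFun hq]; exact hp
  filter_upwards [hnhds, h1.eventually (by rwa [h3])] with z hz hz1
  have := chartRep_eq (q := q) (Z := F.cutoffField lam)
    (Z' := fun z => unitBump (inChart F.toFun q z) •
      thermo (F.energyInChart q) (inChart lam q) z) (fun p' h0 h => by
        rw [← inChart_extChartAt F.toFun h]
        exact tangentCoordChange_smul_thermostatField (fun p => unitBump (F.toFun p)) h0 h) hz
  rw [this, hz1, one_smul]

variable [T2Space M] [CompactSpace M]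
  (hlam : ContMDiffOn (𝓡 2).tangent 𝓘(ℝ, ℝ) ∞ lam (slitBundle M))
include hlam

/-- Jacobi fields are the derivatives of the flow along the unit circles of the tangent spaces. -/
theorem hasMFDerivAt_flow_unitCurve (hp : p ∈ F.unitBundle) {a y w : ℝ → ℝ}
    (ha : ∀ t, HasDerivAt a (lam (F.flow lam p t) * y t) t)
    (hJ : JacobiODE.IsJacobi (fun t => F.dampingCoeff lam (F.flow lam p t))
      (fun t => F.thermostatCurvature lam (F.flow lam p t)) y w)
    (ha0 : a 0 = 0) (hy0 : y 0 = 0) (hw0 : w 0 = 1) {t : ℝ} (ht : 0 ≤ t) :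
    HasMFDerivAt 𝓘(ℝ, ℝ) (𝓡 2).tangent
      (fun θ => F.flow lam (unitPoint F p θ) t) 0
      ((1 : ℝ →L[ℝ] ℝ).smulRight (F.jacobiField lam (F.flow lam p) a y w t : Plane × Plane) :
        ℝ →L[ℝ] Plane × Plane) := by
  have : T2Space (TangentBundle (𝓡 2) M) := t2Space_tangentBundle
  have hs := unitBundle_subset_slitBundle hp
  have h0 : unitPoint F p 0 = p := unitPoint_zero hp
  refine hasMFDerivAt_family (contMDiff_cutoffField (F := F) hlam)
    (Φ := fun θ => F.flow lam (unitPoint F p θ))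
    (W := fun t => (F.jacobiField lam (F.flow lam p) a y w t : Plane × Plane))
    (fun θ => isMIntegralCurve_flow_cutoff hlam (unitCurve_mem hs θ)) (fun t₁ => ?_) ht ?_
  · simp only [h0]
    set q := F.flow lam p t₁ with hq
    have hsrc : ∀ᶠ s in 𝓝 t₁, F.flow lam p s ∈ (extChartAt (𝓡 2).tangent q).source :=
      (continuous_flow hlam hp).continuousAt.preimage_mem_nhds
        (extChartAt_source_mem_nhds (I := (𝓡 2).tangent) q)
    filter_upwards [hsrc.eventually_nhds] with t ht
    have hqt := ht.self_of_nhds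
    have hu (s : ℝ) := flow_mem_unitBundle hlam hp s
    have hsl (s : ℝ) := unitBundle_subset_slitBundle (hu s)
    have hβ := hasDerivAt_of_isMIntegralCurve (isMIntegralCurve_flow hlam hp) hqt
    rw [chartRep_extChartAt _ _ hqt, tangentCoordChange_thermostatField (hsl t) hqt] at hβ
    have hlin := (F.isEnergy q).hasDerivAt_linearized
      (contDiffOn_comp_extChartAt_symm hlam q) (β := fun s => extChartAt (𝓡 2).tangent q (F.flow lam p s))
      (extChartAt_mem_slitTarget hqt (hsl t)) hβ (a := a) (y := y) (w := w)
      ((ha t).congr_deriv (by rw [inChart_extChartAt lam hqt]; rfl)) (hJ t).1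
      ((hJ t).2.congr_deriv (by
        beta_reduce
        rw [dampingCoeff_eq hlam (hsl t) hqt, thermostatCurvature_eq hlam (hsl t) hqt]; rfl))
    rw [(chartRep_cutoffField_eventuallyEq (hu t) hqt).fderiv_eq,
      tangentCoordChange_jacobiField (hsl t) hqt]
    refine hlin.congr_of_eventuallyEq ?_
    filter_upwards [ht] with s hs'
    rw [tangentCoordChange_jacobiField (hsl s) hs']
    rfl
  · have e (θ : ℝ) : F.flow lam (unitPoint F p θ) 0 = unitPoint F p θ :=
      flow_zero hlam (unitCurve_mem hs θ)
    have hW : (F.jacobiField lam (F.flow lam p) a y w 0 : Plane × Plane) = (0, F.rot p) := by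
      have : F.jacobiField lam (F.flow lam p) a y w 0 = F.fieldV (F.flow lam p 0) := by
        rw [jacobiField, ha0, hy0, hw0]
        simp
      rw [this, flow_zero hlam hp]
      rfl
    have h1 : HasMFDerivAt 𝓘(ℝ, ℝ) (𝓡 2).tangent
        (fun θ => F.flow lam (unitPoint F p θ) 0) 0 _ :=
      (hasMFDerivAt_unitCurve hp).congr_of_eventuallyEq (Eventually.of_forall e)
    rw [hW]
    exact h1

omit hlam [OrientedAtlas M] [T2Space M] [CompactSpace M] in
theorem expMap_smul {x : M} {v : Plane} (hv : F.toFun ⟨x, v⟩ = 1) {t : ℝ} (ht : 0 < t) :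
    F.expMap lam x (t • v) = (F.flow lam ⟨x, v⟩ t).proj := by
  have h : F.toFun ⟨x, t • v⟩ = t := by
    rw [F.homogeneous x v t ht.le, hv, mul_one]
  rw [expMap, h, smul_smul, inv_mul_cancel₀ ht.ne', one_smul]

omit hlam [OrientedAtlas M] [T2Space M] [CompactSpace M] in
theorem base_jacobiField {γ : ℝ → TangentBundle (𝓡 2) M} {a y w : ℝ → ℝ} {t : ℝ} (hy : y t = 0) :
    base (γ t) (F.jacobiField lam γ a y w t) = a t • velocity (γ t) := by
  rw [jacobiField, hy, zero_smul, add_zero]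
  show a t • (velocity (γ t) + lam (γ t) • (0 : Plane)) + _ • (0 : Plane) = _
  rw [smul_zero, smul_zero, add_zero, add_zero]

/-- If y(t) = 0, the variation projects to a(t) γ̇(t). It is also the image of t iξ under the
differential of the exponential map at tξ, and that differential sends ξ to γ̇(t). Injectivity gives
t iξ = a(t) ξ, impossible since ξ and iξ span a parallelogram of positive area. -/
theorem jacobi_ne_zero (hconj : F.NoConjugatePoints lam) (hp : p ∈ F.unitBundle) {y w : ℝ → ℝ}
    (hJ : JacobiODE.IsJacobi (fun t => F.dampingCoeff lam (F.flow lam p t))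
      (fun t => F.thermostatCurvature lam (F.flow lam p t)) y w)
    (hy0 : y 0 = 0) (hw0 : w 0 = 1) {t : ℝ} (ht : 0 < t) : y t ≠ 0 := by
  intro hyt
  have hs := unitBundle_subset_slitBundle hp
  have hcont : Continuous (fun s => lam (F.flow lam p s) * y s) := by
    refine Continuous.mul (continuous_iff_continuousAt.2 fun s => ?_)
      (continuous_iff_continuousAt.2 fun s => (hJ s).1.continuousAt)
    exact ContinuousAt.comp (hlam.continuousOn.continuousAt (isOpen_slitBundle.mem_nhds
      (unitBundle_subset_slitBundle (flow_mem_unitBundle hlam hp s))))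
      (continuous_flow hlam hp).continuousAt
  -- The 𝐅-component does not enter the equation for y and is recovered by integrating λy.
  obtain ⟨a, ha0, ha⟩ : ∃ a : ℝ → ℝ, a 0 = 0 ∧
      ∀ s, HasDerivAt a (lam (F.flow lam p s) * y s) s :=
    ⟨fun u => ∫ s in (0 : ℝ)..u, lam (F.flow lam p s) * y s, by simp,
      fun s => (hcont.integral_hasStrictDerivAt 0 s).hasDerivAt⟩
  have hvar := hasMFDerivAt_flow_unitCurve hlam hp ha hJ ha0 hy0 hw0 ht.le
  set P := F.flow lam p t with hP
  have h0 : unitPoint F p 0 = p := unitPoint_zero hp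
  have hPs : F.flow lam (unitPoint F p 0) t ∈ (extChartAt (𝓡 2).tangent P).source := by
    rw [h0]; exact mem_extChartAt_source P
  have hc1 : HasDerivAt (fun θ => extChartAt (𝓡 2).tangent P (F.flow lam (unitPoint F p θ) t))
      (F.jacobiField lam (F.flow lam p) a y w t : Plane × Plane) 0 := by
    have h := hasMFDerivAt_curve hvar hPs
    rw [h0] at h
    exact h.congr_deriv (tangentCoordChange_self_tangent (p := P) _)
  have hc1' : HasDerivAt (fun θ => extChartAt (𝓡 2) P.proj
      (F.flow lam (unitPoint F p θ) t).proj) (a t • velocity P) 0 := by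
    rw [← base_jacobiField (F := F) (lam := lam) (γ := F.flow lam p) (w := w) hyt]
    exact hc1.fst
  have hc2 := hasDerivAt_of_isMIntegralCurve (isMIntegralCurve_flow hlam hp)
    (mem_extChartAt_source (I := (𝓡 2).tangent) P)
  rw [chartRep_self] at hc2
  have hc2' : HasDerivAt (fun s => extChartAt (𝓡 2) P.proj (F.flow lam p s).proj)
      (velocity P) t := by
    have h := hc2.fst
    have e : (F.thermostatField lam P : Plane × Plane).1 = velocity P := by
      show velocity P + lam P • (0 : Plane) = _
      rw [smul_zero, add_zero]
    rw [← e]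
    exact h
  have hpp : F.toFun ⟨p.proj, velocity p⟩ = 1 := hp
  have hexpt : F.expMap lam p.proj (t • velocity p) = P.proj := expMap_smul hpp ht
  have hloc := hconj p.proj (t • velocity p)
  have hmd := hloc.mdifferentiableAt one_ne_zero
  set g : Plane → Plane := fun v => extChartAt (𝓡 2) P.proj (F.expMap lam p.proj v) with hg
  obtain ⟨D, hD, hDinj⟩ : ∃ D : Plane →L[ℝ] Plane, HasFDerivAt g D (t • velocity p) ∧
      Function.Injective D := by
    have h1 := hmd.hasMFDerivAt.2
    rw [hexpt] at h1
    refine ⟨mfderiv 𝓘(ℝ, Plane) (𝓡 2) (F.expMap lam p.proj) (t • velocity p), ?_, ?_⟩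
    · have h2 := h1
      simp only [writtenInExtChartAt, hexpt] at h2
      exact hasFDerivWithinAt_univ.1 (by simpa using! h2)
    · rw [← hloc.mfderivToContinuousLinearEquiv_coe one_ne_zero]
      exact (hloc.mfderivToContinuousLinearEquiv one_ne_zero).injective
  have hd1 : HasDerivAt (fun θ => g (t • unitCurve F p θ)) (D (t • F.rot p)) 0 := by
    refine HasFDerivAt.comp_hasDerivAt (l := g) 0 ?_ ((hasDerivAt_unitCurve hp).const_smul t)
    rw [unitCurve_zero hp]; exact hD
  have hd2 : HasDerivAt (fun s : ℝ => g (s • velocity p)) (D ((1 : ℝ) • velocity p)) t :=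
    HasFDerivAt.comp_hasDerivAt (l := g) t hD ((hasDerivAt_id t).smul_const (velocity p))
  have e1 : D (t • F.rot p) = a t • velocity P := by
    refine hd1.unique (hc1'.congr_of_eventuallyEq (Eventually.of_forall fun θ => ?_))
    simp only [hg]
    rw [expMap_smul (unitCurve_mem hs θ) ht, unitPoint]
  have e2 : D ((1 : ℝ) • velocity p) = velocity P := by
    refine hd2.unique (hc2'.congr_of_eventuallyEq ?_)
    filter_upwards [lt_mem_nhds ht] with s hs'
    simp only [hg]
    rw [expMap_smul hpp hs']
    rfl
  rw [one_smul] at e2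
  rw [← e2, ← map_smul] at e1
  have e3 := hDinj e1
  have hpos := area_rot_pos (F := F) hs
  have e4 : t * area (velocity p) (F.rot p) = area (velocity p) (t • F.rot p) := by
    simp only [area, PiLp.smul_apply, smul_eq_mul]; ring
  rw [e3] at e4
  have e5 : area (velocity p) (a t • velocity p) = 0 := by
    simp only [area, PiLp.smul_apply, smul_eq_mul]; ring
  rw [e5] at e4
  exact (mul_pos ht hpos).ne' e4

/-- A zero at time s is moved to time 0 by starting the orbit at φ_s(p). -/
theorem noConj_flow (hconj : F.NoConjugatePoints lam) (hp : p ∈ F.unitBundle) :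
    JacobiODE.NoConj (fun t => F.dampingCoeff lam (F.flow lam p t))
      (fun t => F.thermostatCurvature lam (F.flow lam p t)) := by
  intro y w hJ s t hst hy hw
  have h := jacobi_ne_zero hlam hconj (flow_mem_unitBundle hlam hp s)
    (y := fun u => y (u + s)) (w := fun u => w (u + s)) (fun u => ?_) (by simpa using hy)
    (by simpa using hw) (sub_pos.2 hst)
  · simpa using h
  · simp only [flow_add hlam hp]
    exact ⟨(hJ (u + s)).1.comp_add_const u s, (hJ (u + s)).2.comp_add_const u s⟩

end FinslerMetric

/-! ### Assembly of the theorem -/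

theorem mainTheorem9 {M : Type*} [TopologicalSpace M] [T2Space M] [CompactSpace M]
    [ChartedSpace Plane M] [IsManifold (𝓡 2) ∞ M] [OrientedAtlas M]
    (F : FinslerMetric M) (lam : TangentBundle (𝓡 2) M → ℝ)
    (hlam : ContMDiffOn (𝓡 2).tangent 𝓘(ℝ, ℝ) ∞ lam (slitBundle M))
    (hconj : F.NoConjugatePoints lam) :
    ∃ (rRplus rRminus : ℝ → TangentBundle (𝓡 2) M → ℝ → ℝ)
      (rplus rminus : TangentBundle (𝓡 2) M → ℝ),
      -- (1) the solution with value `+∞` at `-R` is defined for all `t > -R` (and is unique)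
      (∀ R : ℝ, 0 < R → ∀ p ∈ F.unitBundle,
        F.IsRiccatiSolution lam p (Ioi (-R)) (rRplus R p) ∧
        Tendsto (rRplus R p) (𝓝[>] (-R)) atTop ∧
        ∀ T : ℝ, -R < T → ∀ s : ℝ → ℝ, F.IsRiccatiSolution lam p (Ioo (-R) T) s →
          Tendsto s (𝓝[>] (-R)) atTop → EqOn s (rRplus R p) (Ioo (-R) T)) ∧
      -- the solution with value `-∞` at `R` is defined for all `t < R` (and is unique)
      (∀ R : ℝ, 0 < R → ∀ p ∈ F.unitBundle,
        F.IsRiccatiSolution lam p (Iio R) (rRminus R p) ∧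
        Tendsto (rRminus R p) (𝓝[<] R) atBot ∧
        ∀ T : ℝ, T < R → ∀ s : ℝ → ℝ, F.IsRiccatiSolution lam p (Ioo T R) s →
          Tendsto s (𝓝[<] R) atBot → EqOn s (rRminus R p) (Ioo T R)) ∧
      -- (2) the limits exist everywhere on `SM`, and are solutions along the flow
      (∀ p ∈ F.unitBundle,
        Tendsto (fun R : ℝ => rRplus R p 0) atTop (𝓝 (rplus p)) ∧
        Tendsto (fun R : ℝ => rRminus R p 0) atTop (𝓝 (rminus p)) ∧
        F.IsRiccatiSolution lam p univ (fun t => rplus (F.flow lam p t)) ∧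
        F.IsRiccatiSolution lam p univ (fun t => rminus (F.flow lam p t))) ∧
      -- (3) the limits are bounded, with the explicit bound `A (1 + √5) / 2`, `A = max {B, C}`
      (∃ B C : ℝ, 0 ≤ B ∧ 0 ≤ C ∧ ∀ p ∈ F.unitBundle,
        |F.thermostatCurvature lam p| ≤ B ^ 2 ∧ |F.dampingCoeff lam p| ≤ C) ∧
      (∀ B C : ℝ, 0 ≤ B → 0 ≤ C →
        (∀ p ∈ F.unitBundle,
          |F.thermostatCurvature lam p| ≤ B ^ 2 ∧ |F.dampingCoeff lam p| ≤ C) →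
        ∀ p ∈ F.unitBundle,
          |rplus p| ≤ max B C / 2 * (1 + Real.sqrt 5) ∧
          |rminus p| ≤ max B C / 2 * (1 + Real.sqrt 5)) := by
  have hpl (p : TangentBundle (𝓡 2) M) (hp : p ∈ F.unitBundle) :=
    JacobiODE.exists_plus_family (FinslerMetric.isCoeff_flow hlam hp)
      (FinslerMetric.noConj_flow hlam hconj hp)
  have hmi (p : TangentBundle (𝓡 2) M) (hp : p ∈ F.unitBundle) :=
    JacobiODE.exists_minus_family (FinslerMetric.isCoeff_flow hlam hp)
      (FinslerMetric.noConj_flow hlam hconj hp)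
  -- The families become total functions of p; their values off SM carry no information.
  choose! rP ρP hP1 hP2 hP3 using hpl
  choose! rM ρM hM1 hM2 hM3 using hmi
  have hmem {p : TangentBundle (𝓡 2) M} (hp : p ∈ F.unitBundle) (t : ℝ) :=
    FinslerMetric.flow_mem_unitBundle hlam hp t
  -- Starting at φ_t(p) instead of p shifts time by t, so the pole at -R becomes one at -(R - t) for
  -- the orbit of p. Uniqueness of the solution with this pole identifies r_R^+ for φ_t(p) at time 0
  -- with r_{R-t}^+ for p at time t, and R → ∞ removes the shift. The families are defined for every
  -- real R, so R - t may be negative.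
  have hplus : ∀ p ∈ F.unitBundle, ∀ t, ρP (F.flow lam p t) 0 = ρP p t := by
    intro p hp t
    refine tendsto_nhds_unique (hP2 _ (hmem hp t) 0) ?_
    have h1 : Tendsto (fun R : ℝ => rP p (R - t) t) atTop (𝓝 (ρP p t)) :=
      (hP2 p hp t).comp (tendsto_atTop_add_const_right _ (-t) tendsto_id)
    refine h1.congr' ?_
    filter_upwards [eventually_gt_atTop 0] with R hR
    have h2 := (hP1 p hp (R - t))
    have h3 := (hP1 _ (hmem hp t) R).2.2 1 (by linarith) (fun τ => rP p (R - t) (τ + t))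
      (fun τ hτ => ?_) ?_ (show (0 : ℝ) ∈ Ioo (-R) 1 from ⟨by linarith, one_pos⟩)
    · simpa using h3
    · have := (h2.1 (τ + t) (show -(R - t) < τ + t by linarith [hτ.1])).comp_add_const τ t
      simpa only [FinslerMetric.flow_add hlam hp] using this
    · refine h2.2.1.comp (tendsto_nhdsWithin_of_tendsto_nhds_of_eventually_within _ ?_ ?_)
      · have : Tendsto (fun τ : ℝ => τ + t) (𝓝 (-R)) (𝓝 (-R + t)) :=
          (continuous_add_const t).tendsto _
        rw [show -R + t = -(R - t) by ring] at this
        exact this.mono_left nhdsWithin_le_nhds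
      · filter_upwards [self_mem_nhdsWithin] with τ hτ
        have : -R < τ := hτ
        show -(R - t) < τ + t
        linarith
  have hminus : ∀ p ∈ F.unitBundle, ∀ t, ρM (F.flow lam p t) 0 = ρM p t := by
    intro p hp t
    refine tendsto_nhds_unique (hM2 _ (hmem hp t) 0) ?_
    have h1 : Tendsto (fun R : ℝ => rM p (R + t) t) atTop (𝓝 (ρM p t)) :=
      (hM2 p hp t).comp (tendsto_atTop_add_const_right _ t tendsto_id)
    refine h1.congr' ?_
    filter_upwards [eventually_gt_atTop 0] with R hR
    have h2 := (hM1 p hp (R + t))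
    have h3 := (hM1 _ (hmem hp t) R).2.2 (-1) (by linarith) (fun τ => rM p (R + t) (τ + t))
      (fun τ hτ => ?_) ?_ (show (0 : ℝ) ∈ Ioo (-1) R from ⟨by norm_num, hR⟩)
    · simpa using h3
    · have := (h2.1 (τ + t) (show τ + t < R + t by linarith [hτ.2])).comp_add_const τ t
      simpa only [FinslerMetric.flow_add hlam hp] using this
    · refine h2.2.1.comp (tendsto_nhdsWithin_of_tendsto_nhds_of_eventually_within _ ?_ ?_)
      · have : Tendsto (fun τ : ℝ => τ + t) (𝓝 R) (𝓝 (R + t)) :=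
          (continuous_add_const t).tendsto _
        exact this.mono_left nhdsWithin_le_nhds
      · filter_upwards [self_mem_nhdsWithin] with τ hτ
        have : τ < R := hτ
        show τ + t < R + t
        linarith
  refine ⟨fun R p => rP p R, fun R p => rM p R, fun p => ρP p 0, fun p => ρM p 0,
    fun R _ p hp => hP1 p hp R, fun R _ p hp => hM1 p hp R,
    fun p hp => ⟨hP2 p hp 0, hM2 p hp 0, ?_, ?_⟩,
    FinslerMetric.exists_bound_coefficients hlam, fun B C hB hC hBC p hp => ?_⟩
  · simp only [hplus p hp]
    exact hP3 p hp
  · simp only [hminus p hp]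
    exact hM3 p hp
  · have hA : 0 ≤ max B C := le_max_of_le_left hB
    have hd (t : ℝ) : |F.dampingCoeff lam (F.flow lam p t)| ≤ max B C :=
      (hBC _ (hmem hp t)).2.trans (le_max_right _ _)
    have hk (t : ℝ) : |F.thermostatCurvature lam (F.flow lam p t)| ≤ max B C ^ 2 :=
      (hBC _ (hmem hp t)).1.trans (pow_le_pow_left₀ hB (le_max_left _ _) 2)
    exact ⟨(hP3 p hp).abs_le_bound hA hd hk 0, (hM3 p hp).abs_le_bound hA hd hk 0⟩
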